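/- For real $a>1$ and $z\ge 0$ let $$\mathrm{ci}(a,z)=\Gamma(a)\cos(\tfrac{\pi a}{2})-\int_0^z t^{a-1}\cos t\,dt,\qquad \mathrm{si}(a,z)=\Gamma(a)\sin(\tfrac{\pi a}{2})-\int_0^z t^{a-1}\sin t\,dt,$$ $$\phi_a(x)=ax-\arctan x,\qquad \chi(a,x)=\frac{\Gamma(a+1)\cos(\frac{\pi a}{2})\sqrt{x^2+1}}{(ax)^a},\qquad \sigma(a,x)=\frac{\Gamma(a+1)\sin(\frac{\pi a}{2})\sqrt{x^2+1}}{(ax)^a}\qquad(x>0).$$ There are functions $\tilde q_k(x;C,S)$, $k\ge2$, not depending on $a$, rational in $(x,C,S)$ with poles only where $x(x^2+1)(Sx-C)=0$, the first four being $$\tilde q_2=\frac{x^2(Sx^2+2Cx-S)}{(x^2+1)^2(Sx-C)},$$ $$\tilde q_3=\frac{x^2}{2(x^2+1)^4(Sx-C)^3}\Big\{C^3x(5x^2-9)(x^2+1)^2-2C^2S(6x^2-1)(x^2+1)^2-Cx(5x^6+9x^4-49x^2+3)+8Sx^4(2x^2-3)\Big\},$$ $$\begin{aligned}\tilde q_4=-\frac{x^2}{6(x^2+1)^6(Sx-C)^5}\Big\{&C^5x(151x^2-69)(x^2+1)^4+C^4S(47x^4-167x^2+6)(x^2+1)^4\\&-C^3x(284x^{10}+2445x^8-4962x^6+3124x^4-1258x^2+15)\\&-C^2Sx^2(79x^{10}-711x^8+2252x^6-6460x^4+2013x^2-5)\\&+Cx^3(133x^8+1862x^6-5076x^4+1202x^2+7)+4Sx^6(8x^6-183x^4+336x^2-65)\Big\},\end{aligned}$$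 $$\begin{aligned}\tilde q_5=-\frac{x^2}{24(x^2+1)^8(Sx-C)^7}\Big\{&2C^7x(379x^4-2365x^2+318)(x^2+1)^6-4C^6S(802x^4-723x^2+6)(x^2+1)^6\\&-C^5x(2139x^{16}+6650x^{14}-352255x^{12}+1102732x^{10}-2195479x^8+1221754x^6-255889x^4+28256x^2-84)\\&+4C^4Sx^2(2944x^{14}-12111x^{12}+171062x^{10}-479729x^8+418084x^6-187793x^4+18502x^2-15)\\&+2C^3x^3(1002x^{14}+6707x^{12}-318554x^{10}+955395x^8-1211026x^6+568777x^4-46366x^2-31)\\&-16C^2Sx^4(875x^{12}-8242x^{10}+48471x^8-110732x^6+54721x^4-3906x^2-3)\\&-Cx^5(623x^{12}+6582x^{10}-301803x^8+762660x^6-350055x^4+22566x^2-29)\\&+8Sx^8(679x^8-8384x^6+17226x^4-7168x^2+431)\Big\},\end{aligned}$$ such that the following holds. **Zeros of $\mathrm{ci}$.** Let $a>1$ with $\cos(\frac{\pi a}2)\ne0$. The positive zeros of $\theta\mapsto\mathrm{ci}(a,a\theta)$ form an infinite increasing sequence $\tilde c_1<\tilde c_2<\cdots$, and the positive roots of $$\cos\phi_a(x)=\chi(a,x)$$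 form an infinite increasing sequence $\tilde c_{1,0}<\tilde c_{2,0}<\cdots$. For every $m\ge1$ one has $|\chi(a,\tilde c_{m,0})|\le1$ and $$a\tilde c_{m,0}-\arctan\tilde c_{m,0}=(-1)^{p_m-1}\arccos\big(\chi(a,\tilde c_{m,0})\big)+2\lfloor\tfrac12p_m\rfloor\pi$$ with integers $p_m=p_m(a)\ge1$ satisfying $p_2\in\{p_1,p_1+1\}$ and $p_{m+1}=p_m+1$ for $m\ge2$. Put $C_m=\chi(a,\tilde c_{m,0})$ and $S_m=\sin\phi_a(\tilde c_{m,0})$ (so $C_m=\cos\phi_a(\tilde c_{m,0})$ and $S_m=\pm(1-C_m^2)^{1/2}$). As $a\to\infty$, $$\tilde c_m\sim\tilde c_{m,0}+\sum_{k\ge2}\frac{\tilde q_k(\tilde c_{m,0};C_m,S_m)}{a^k},\qquad m=1,2,3,\dots,$$ uniformly in $m$, away from degeneracy. Precisely: for all $\delta>0$ and $N\ge1$ there are $A,K$ such that, for every $a>1$ with $a\ge A$ and $\cos(\frac{\pi a}2)\neq0$: (i) if $|S_m\tilde c_{m,0}-C_m|\ge\delta\min(1,\tilde c_{m,0})$ for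 all $m\ge1$, then for all $m\ge1$ $$\Big|\tilde c_m-\tilde c_{m,0}-\sum_{k=2}^N\frac{\tilde q_k(\tilde c_{m,0};C_m,S_m)}{a^k}\Big|\le\frac K{a^{N+1}};$$ (ii) for each single $m$ with $|S_m\tilde c_{m,0}-C_m|\ge\delta\min(1,\tilde c_{m,0})$, the same bound holds with $\tilde c_m$ replaced by $\tilde c_j$ for some $j\ge1$. **Zeros of $\mathrm{si}$.** Let $a>1$ with $\sin(\frac{\pi a}2)\ne0$. The positive zeros of $\theta\mapsto\mathrm{si}(a,a\theta)$ form an infinite increasing sequence $\tilde s_1<\tilde s_2<\cdots$, and the positive roots of $\sin\phi_a(x)=\sigma(a,x)$ form an infinite increasing sequence $\tilde s_{1,0}<\tilde s_{2,0}<\cdots$. For every $m\ge1$ one has $|\sigma(a,\tilde s_{m,0})|\le1$ and $$a\tilde s_{m,0}-\arctan\tilde s_{m,0}=(-1)^{p_m-1}\big|\arcsin\sigma(a,\tilde s_{m,0})\big|+(l+p_m-1)\pi,$$ where $l=0$ if $\arcsin\sigma(a,\tilde s_{1,0})>0$ and $l=1$ otherwise, and the integers $p_m=p_m(a)\ge1$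 again satisfy $p_2\in\{p_1,p_1+1\}$ and $p_{m+1}=p_m+1$ for $m\ge2$. With $\hat S_m=\sigma(a,\tilde s_{m,0})=\sin\phi_a(\tilde s_{m,0})$, $\hat C_m=\cos\phi_a(\tilde s_{m,0})$ and $$\hat q_k(x)=\tilde q_k(x;\hat S,-\hat C),\qquad\text{for example}\quad \hat q_2(x)=\frac{x^2(\hat Cx^2-2\hat Sx-\hat C)}{(x^2+1)^2(\hat Cx+\hat S)},$$ the expansion $$\tilde s_m\sim\tilde s_{m,0}+\sum_{k\ge2}\frac{\hat q_k(\tilde s_{m,0})}{a^k}\qquad(a\to\infty,\ m=1,2,3,\dots)$$ holds in exactly the same sense (with $\sin(\frac{\pi a}{2})\neq0$), the nondegeneracy condition now being $|\hat C_m\tilde s_{m,0}+\hat S_m|\ge\delta\min(1,\tilde s_{m,0})$. -/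

import Mathlib

/-- `Ci(a, z) = ∫₀ᶻ t^(a-1) cos t dt`. -/
noncomputable def gtiCi (a z : ℝ) : ℝ := ∫ t in (0 : ℝ)..z, t ^ (a - 1) * Real.cos t

/-- `Si(a, z) = ∫₀ᶻ t^(a-1) sin t dt`. -/
noncomputable def gtiSi (a z : ℝ) : ℝ := ∫ t in (0 : ℝ)..z, t ^ (a - 1) * Real.sin t

/-- `ci(a, z) = Γ(a) cos(πa/2) - Ci(a, z)`. -/
noncomputable def gtici (a z : ℝ) : ℝ := Real.Gamma a * Real.cos (Real.pi * a / 2) - gtiCi a z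

/-- `si(a, z) = Γ(a) sin(πa/2) - Si(a, z)`. -/
noncomputable def gtisi (a z : ℝ) : ℝ := Real.Gamma a * Real.sin (Real.pi * a / 2) - gtiSi a z

/-- `χ(a, θ) = Γ(a+1) cos(πa/2) √(θ²+1) / (aθ)^a`. -/
noncomputable def gtiChi (a θ : ℝ) : ℝ :=
  Real.Gamma (a + 1) * Real.cos (Real.pi * a / 2) * Real.sqrt (θ ^ 2 + 1) / (a * θ) ^ a

/-- `σ(a, θ) = Γ(a+1) sin(πa/2) √(θ²+1) / (aθ)^a`. -/
noncomputable def gtiSigma (a θ : ℝ) : ℝ :=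
  Real.Gamma (a + 1) * Real.sin (Real.pi * a / 2) * Real.sqrt (θ ^ 2 + 1) / (a * θ) ^ a

/-- The phase `aθ - arctan θ`. -/
noncomputable def gtiPhase (a θ : ℝ) : ℝ := a * θ - Real.arctan θ

/-- The positive zeros `θ` of `ci(a, aθ)`. -/
def ciZeros (a : ℝ) : Set ℝ := {θ | 0 < θ ∧ gtici a (a * θ) = 0}

/-- The positive zeros `θ` of `si(a, aθ)`. -/
def siZeros (a : ℝ) : Set ℝ := {θ | 0 < θ ∧ gtisi a (a * θ) = 0}

/-- The positive roots of `cos(aθ - arctan θ) = χ(a, θ)`. -/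
def ciRoots (a : ℝ) : Set ℝ := {θ | 0 < θ ∧ Real.cos (gtiPhase a θ) = gtiChi a θ}

/-- The positive roots of `sin(aθ - arctan θ) = σ(a, θ)`. -/
def siRoots (a : ℝ) : Set ℝ := {θ | 0 < θ ∧ Real.sin (gtiPhase a θ) = gtiSigma a θ}

/-- `z 1 < z 2 < z 3 < …` are all the elements of `Z`, each listed once, so that `z m` is the
`m`-th smallest element of `Z` (`m = 1, 2, 3, …`; the value `z 0` is irrelevant). -/
def IsIncreasingList (Z : Set ℝ) (z : ℕ → ℝ) : Prop :=
  StrictMonoOn z (Set.Ici 1) ∧ z '' Set.Ici 1 = Z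

noncomputable def qTilde2 (x C S : ℝ) : ℝ :=
  x ^ 2 * (S * x ^ 2 + 2 * C * x - S) / ((x ^ 2 + 1) ^ 2 * (S * x - C))

noncomputable def qTilde3 (x C S : ℝ) : ℝ :=
  x ^ 2 / (2 * (x ^ 2 + 1) ^ 4 * (S * x - C) ^ 3) *
    (C ^ 3 * x * (5 * x ^ 2 - 9) * (x ^ 2 + 1) ^ 2
      - 2 * C ^ 2 * S * (6 * x ^ 2 - 1) * (x ^ 2 + 1) ^ 2
      - C * x * (5 * x ^ 6 + 9 * x ^ 4 - 49 * x ^ 2 + 3)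
      + 8 * S * x ^ 4 * (2 * x ^ 2 - 3))

noncomputable def qTilde4 (x C S : ℝ) : ℝ :=
  -(x ^ 2 / (6 * (x ^ 2 + 1) ^ 6 * (S * x - C) ^ 5)) *
    (C ^ 5 * x * (151 * x ^ 2 - 69) * (x ^ 2 + 1) ^ 4
      + C ^ 4 * S * (47 * x ^ 4 - 167 * x ^ 2 + 6) * (x ^ 2 + 1) ^ 4
      - C ^ 3 * x * (284 * x ^ 10 + 2445 * x ^ 8 - 4962 * x ^ 6 + 3124 * x ^ 4
          - 1258 * x ^ 2 + 15)
      - C ^ 2 * S * x ^ 2 * (79 * x ^ 10 - 711 * x ^ 8 + 2252 * x ^ 6 - 6460 * x ^ 4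
          + 2013 * x ^ 2 - 5)
      + C * x ^ 3 * (133 * x ^ 8 + 1862 * x ^ 6 - 5076 * x ^ 4 + 1202 * x ^ 2 + 7)
      + 4 * S * x ^ 6 * (8 * x ^ 6 - 183 * x ^ 4 + 336 * x ^ 2 - 65))

noncomputable def qTilde5 (x C S : ℝ) : ℝ :=
  -(x ^ 2 / (24 * (x ^ 2 + 1) ^ 8 * (S * x - C) ^ 7)) *
    (2 * C ^ 7 * x * (379 * x ^ 4 - 2365 * x ^ 2 + 318) * (x ^ 2 + 1) ^ 6
      - 4 * C ^ 6 * S * (802 * x ^ 4 - 723 * x ^ 2 + 6) * (x ^ 2 + 1) ^ 6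
      - C ^ 5 * x * (2139 * x ^ 16 + 6650 * x ^ 14 - 352255 * x ^ 12 + 1102732 * x ^ 10
          - 2195479 * x ^ 8 + 1221754 * x ^ 6 - 255889 * x ^ 4 + 28256 * x ^ 2 - 84)
      + 4 * C ^ 4 * S * x ^ 2 * (2944 * x ^ 14 - 12111 * x ^ 12 + 171062 * x ^ 10
          - 479729 * x ^ 8 + 418084 * x ^ 6 - 187793 * x ^ 4 + 18502 * x ^ 2 - 15)
      + 2 * C ^ 3 * x ^ 3 * (1002 * x ^ 14 + 6707 * x ^ 12 - 318554 * x ^ 10 + 955395 * x ^ 8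
          - 1211026 * x ^ 6 + 568777 * x ^ 4 - 46366 * x ^ 2 - 31)
      - 16 * C ^ 2 * S * x ^ 4 * (875 * x ^ 12 - 8242 * x ^ 10 + 48471 * x ^ 8
          - 110732 * x ^ 6 + 54721 * x ^ 4 - 3906 * x ^ 2 - 3)
      - C * x ^ 5 * (623 * x ^ 12 + 6582 * x ^ 10 - 301803 * x ^ 8 + 762660 * x ^ 6
          - 350055 * x ^ 4 + 22566 * x ^ 2 - 29)
      + 8 * S * x ^ 8 * (679 * x ^ 8 - 8384 * x ^ 6 + 17226 * x ^ 4 - 7168 * x ^ 2 + 431))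

/-- `f` is a rational function of `(x, C, S)` whose only possible poles are at the zeros of
`x (x² + 1) (S x - C)`. -/
def IsRationalCoeff (f : ℝ → ℝ → ℝ → ℝ) : Prop :=
  ∃ (P : MvPolynomial (Fin 3) ℝ) (n : ℕ), ∀ x C S : ℝ, 0 < x → S * x - C ≠ 0 →
    f x C S = MvPolynomial.eval ![x, C, S] P / (x * (x ^ 2 + 1) * (S * x - C)) ^ n

/-- The partial sum `x + ∑_{k=2}^{N} e_k(a, x) / a^k`. -/
noncomputable def zeroApprox (e : ℕ → ℝ → ℝ → ℝ) (N : ℕ) (a x : ℝ) : ℝ :=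
  x + ∑ k ∈ Finset.Icc 2 N, e k a x / a ^ k

/-- Uniform asymptotic expansion, as `a → ∞` through the set of those `a > 1` with `ok a`, of the
elements of `Z a` in terms of the elements of `R a`, with coefficients `e k a x`.

With `z m` and `r m` the `m`-th smallest elements of `Z a` and `R a`, call an index `m`
nondegenerate when `|D a (r m)| ≥ δ min(1, r m)`. To every order, with constants that depend only
on `δ` and on the order:
* each `r m` of nondegenerate index is the leading term of the expansion of some element of `Z a`;
* if all indices are nondegenerate then, for every `m`, this element is the `m`-th one. -/
def UniformZeroExpansion (ok : ℝ → Prop) (Z R : ℝ → Set ℝ) (D : ℝ → ℝ → ℝ)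
    (e : ℕ → ℝ → ℝ → ℝ) : Prop :=
  ∀ δ : ℝ, 0 < δ → ∀ N : ℕ, 1 ≤ N → ∃ A K : ℝ, ∀ a : ℝ, 1 < a → A ≤ a → ok a →
    ∀ z r : ℕ → ℝ, IsIncreasingList (Z a) z → IsIncreasingList (R a) r →
      (∀ m : ℕ, 1 ≤ m → δ * min 1 (r m) ≤ |D a (r m)| →
        ∃ j : ℕ, 1 ≤ j ∧ |z j - zeroApprox e N a (r m)| ≤ K / a ^ (N + 1)) ∧
      ((∀ m : ℕ, 1 ≤ m → δ * min 1 (r m) ≤ |D a (r m)|) →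
        ∀ m : ℕ, 1 ≤ m → |z m - zeroApprox e N a (r m)| ≤ K / a ^ (N + 1))

/-- Branch numbers of the successive roots: `p m` is a positive integer, it increases by exactly
one from each root to the next, except that the first two roots may share the same branch. -/
def IsBranchNumbering (p : ℕ → ℕ) : Prop :=
  1 ≤ p 1 ∧ (p 2 = p 1 ∨ p 2 = p 1 + 1) ∧ ∀ m : ℕ, 2 ≤ m → p (m + 1) = p m + 1

/-! Both families are one problem. Let I(z) = ∫₀ᶻ t^(a-1) cos(t-β) dt; the zeros solve I(aθ) = c,
with β = 0 for `ci` and β = π/2 for `si`. Of c only 0 < |c| ≤ Γ(a) is used. Repeated integration by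
parts, with w = 1/(1+ix) = e^{-i arctan x}/√(1+x²), gives √(1+x²) a (ax)^(-a) I(ax) =
Re(e^{i(φ_a(x)-β)} ∑ a^(-k) T_k(w)), with T_0 = 1 and T_{k+1} = w(1-w)(w T_k)'. The leading term is
cos(φ_a(x)-β), so to leading order the zeros are the roots of cos(φ_a-β) = χ.

Let x be a root, C and S the cosine and sine of φ_a(x)-β, ρ = 1/(1+x²), ω = x/(1+x²), and put aθ =
ax + ωζ = ax(1+ρζ/a). After division by the slope at x, I(aθ) = c becomes exactly ∫₀^ζ
(1+ρτ/a)^(a-1)(cos ωτ + m sin(ωτ)/ω) dτ = b. Here b has an expansion starting at order 1/a, because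
the leading terms cancel at a root. Every coefficient is a polynomial in ρ, ω, u = Cx/(Sx-C), v =
Sx/(Sx-C), and nondegeneracy says precisely that these four stay bounded. So the equation is
inverted once and for all as a formal power series in ε = 1/a over ℝ[ρ,ω,u,v], and polynomials are
bounded on the parameter box: this yields uniformity in x, β and c. A derivative bound F' ≥ 1/2 and
the intermediate value theorem then turn the approximate solution into a true zero
(`exists_zero_near_root`). The condition |Sx-C| ≥ δ min(1,x) implies |Sx-C| ≥ δ'x, since |χ| ≤ 1/4
on [1/2,∞) for large a by a crude Stirling bound. The displayed coefficients are recovered by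
running the inversion to order four and using C²+S² = 1.

The m-th zero is matched with the m-th root by half periods of cos(aθ-β). I is strictly monotone on
each, so each holds at most one zero; if all roots are nondegenerate, the sign of Sx-C is fixed
there and each also holds at most one root. The zero built near a root stays in its half period, and
conversely the half period of a zero contains a root, by comparing signs at the endpoints. Two
increasing lists occupying the same half periods agree index by index (`halfPeriod_list_eq`).

The branch numbers come from counting the roots in the phase intervals ((n-1)π, nπ]. With c > 0, χ
is decreasing, and after the first root χ ≤ 1. Then each later interval contains exactly one root,
by monotonicity of cos on the even intervals and by unimodality of cos/χ on the odd ones. Before the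
first root χ may exceed 1, which is why the first two roots may share a branch. -/

/-! ### Formal inversion of a power series equation. -/

section FormalInversion

open Polynomial

variable {A : Type*} [CommRing A]

/-- The residual `∑_{i=1}^n Φ_i Z^i - ∑_{k=1}^n b_k X^k` of a truncated power series equation. -/
noncomputable def formalResidual (Φ : ℕ → A[X]) (b : ℕ → A) (n : ℕ) (Z : A[X]) : A[X] :=
  ∑ i ∈ Finset.Icc 1 n, Φ i * Z ^ i - ∑ k ∈ Finset.Icc 1 n, C (b k) * X ^ k

/-- Successive polynomial approximations to the solution of `∑ Φ_i Z^i = ∑ b_k X^k`. -/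
noncomputable def formalSolution (Φ : ℕ → A[X]) (b : ℕ → A) : ℕ → A[X]
  | 0 => 0
  | n + 1 => formalSolution Φ b n +
      C (-(formalResidual Φ b (n + 1) (formalSolution Φ b n)).coeff (n + 1)) * X ^ (n + 1)

/-- The coefficients of the formal solution of `∑ Φ_i Z^i = ∑ b_k X^k`. -/
noncomputable def formalCoeff (Φ : ℕ → A[X]) (b : ℕ → A) (n : ℕ) : A :=
  -(formalResidual Φ b n (formalSolution Φ b (n - 1))).coeff n

theorem formalSolution_eq_sum (Φ : ℕ → A[X]) (b : ℕ → A) (n : ℕ) :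
    formalSolution Φ b n = ∑ j ∈ Finset.Icc 1 n, C (formalCoeff Φ b j) * X ^ j := by
  induction n with
  | zero => simp [formalSolution]
  | succ n ih =>
    rw [Finset.sum_Icc_succ_top (by omega), ← ih, formalSolution, formalCoeff]
    simp

theorem X_dvd_formalSolution (Φ : ℕ → A[X]) (b : ℕ → A) (n : ℕ) :
    X ∣ formalSolution Φ b n := by
  rw [formalSolution_eq_sum]
  refine Finset.dvd_sum fun j hj => Dvd.dvd.mul_left (dvd_pow_self _ ?_) _
  have := (Finset.mem_Icc.1 hj).1
  omega

/-- An exponent of at least 2 leaves, besides Z' - Z, another factor Z or Z', and each of these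
contributes one more X. -/
theorem X_pow_succ_dvd_pow_sub_pow {Z Z' : A[X]} {k : ℕ} (hZ : X ∣ Z) (hZ' : X ∣ Z')
    (h : X ^ k ∣ Z' - Z) (i : ℕ) : X ^ (k + 1) ∣ Z' ^ (i + 2) - Z ^ (i + 2) := by
  have e : Z' ^ (i + 2) - Z ^ (i + 2) = (Z' ^ (i + 1) - Z ^ (i + 1)) * Z' + (Z' - Z) * Z ^ (i + 1) := by
    ring
  rw [e, pow_succ]
  exact dvd_add (mul_dvd_mul (h.trans (sub_dvd_pow_sub_pow _ _ _)) hZ')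
    (mul_dvd_mul h (hZ.trans (dvd_pow_self _ (by omega))))

/-- Since Φ 1 = 1, the residual is the identity in Z up to terms one order higher. Existence and
uniqueness of the formal solution both rest on this contraction property. -/
theorem X_pow_succ_dvd_formalResidual_sub {Φ : ℕ → A[X]} (b : ℕ → A) (hΦ : Φ 1 = 1)
    {Z Z' : A[X]} {k n : ℕ} (hn : 1 ≤ n) (hZ : X ∣ Z) (hZ' : X ∣ Z') (h : X ^ k ∣ Z' - Z) :
    X ^ (k + 1) ∣ formalResidual Φ b n Z' - formalResidual Φ b n Z - (Z' - Z) := by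
  have e : formalResidual Φ b n Z' - formalResidual Φ b n Z - (Z' - Z)
      = ∑ i ∈ Finset.Icc 2 n, Φ i * (Z' ^ i - Z ^ i) := by
    simp only [formalResidual]
    rw [← Finset.add_sum_Ioc_eq_sum_Icc (f := fun i => Φ i * Z' ^ i) hn,
      ← Finset.add_sum_Ioc_eq_sum_Icc (f := fun i => Φ i * Z ^ i) hn]
    have : Finset.Ioc 1 n = Finset.Icc 2 n := by ext; simp; omega
    rw [this, hΦ]
    simp only [mul_sub, Finset.sum_sub_distrib]
    ring
  rw [e]
  refine Finset.dvd_sum fun i hi => Dvd.dvd.mul_left ?_ _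
  obtain ⟨j, rfl⟩ := Nat.exists_eq_add_of_le (Finset.mem_Icc.1 hi).1
  rw [add_comm 2 j]
  exact X_pow_succ_dvd_pow_sub_pow hZ hZ' h j

theorem X_pow_succ_dvd_formalResidual {Φ : ℕ → A[X]} (b : ℕ → A) (hΦ : Φ 1 = 1) (n : ℕ) :
    X ^ (n + 1) ∣ formalResidual Φ b n (formalSolution Φ b n) := by
  induction n with
  | zero => simp [formalResidual]
  | succ n ih =>
    set Z := formalSolution Φ b n with hZdef
    set r := formalResidual Φ b (n + 1) Z with hr
    have hXZ : X ∣ Z := X_dvd_formalSolution Φ b n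
    have h1 : X ^ (n + 1) ∣ r := by
      have : r = formalResidual Φ b n Z + (Φ (n + 1) * Z ^ (n + 1) - C (b (n + 1)) * X ^ (n + 1)) := by
        rw [hr, formalResidual, formalResidual, Finset.sum_Icc_succ_top (by omega),
          Finset.sum_Icc_succ_top (by omega)]
        ring
      rw [this]
      exact dvd_add ih (dvd_sub ((pow_dvd_pow_of_dvd hXZ _).mul_left _) (Dvd.intro_left _ rfl))
    -- The new coefficient in `formalSolution` is chosen to cancel exactly the lowest remaining term
    -- of the residual.
    have h2 : X ^ (n + 2) ∣ r + C (-r.coeff (n + 1)) * X ^ (n + 1) := by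
      rw [X_pow_dvd_iff] at h1 ⊢
      intro d hd
      rcases Nat.lt_succ_iff_lt_or_eq.1 hd with hd | rfl
      · simp [h1 d hd, coeff_X_pow, hd.ne]
      · simp [coeff_X_pow]
    have hs : formalSolution Φ b (n + 1) = Z + C (-r.coeff (n + 1)) * X ^ (n + 1) := rfl
    have h3 := X_pow_succ_dvd_formalResidual_sub (Φ := Φ) b hΦ (k := n + 1) (n := n + 1)
      (by omega) hXZ (X_dvd_formalSolution Φ b (n + 1)) (by rw [hs]; simp)
    rw [← hr] at h3
    have h4 := dvd_add h3 h2
    rw [hs] at h4 ⊢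
    convert h4 using 1
    ring

/-- By the contraction property, agreement to order k improves to order k + 1 as long as both
residuals vanish to that order. -/
theorem formalSolution_unique {Φ : ℕ → A[X]} (b : ℕ → A) (hΦ : Φ 1 = 1) {n : ℕ} (hn : 1 ≤ n)
    {Z : A[X]} (hZ : X ∣ Z) (hr : X ^ (n + 1) ∣ formalResidual Φ b n Z) :
    X ^ (n + 1) ∣ Z - formalSolution Φ b n := by
  have key : ∀ k ≤ n + 1, X ^ k ∣ Z - formalSolution Φ b n := by
    intro k
    induction k with
    | zero => simp
    | succ k ih =>
      intro hk
      have h1 := X_pow_succ_dvd_formalResidual_sub b hΦ hn (X_dvd_formalSolution Φ b n) hZ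
        (ih (by omega))
      have h2 : X ^ (k + 1) ∣ formalResidual Φ b n Z - formalResidual Φ b n (formalSolution Φ b n) :=
        (pow_dvd_pow X hk).trans (dvd_sub hr (X_pow_succ_dvd_formalResidual b hΦ n))
      have h3 := dvd_sub h2 h1
      simpa using h3
  exact key _ le_rfl

/-- The first four coefficients of the formal solution. -/
theorem formalCoeff_one_to_four {Φ : ℕ → A[X]} (b : ℕ → A) (hΦ : Φ 1 = 1)
    {f20 f21 f30 f31 f40 : A} {r3 r4 : A[X]}
    (h2 : Φ 2 = C f20 + C f21 * X) (h3 : Φ 3 = C f30 + C f31 * X + X ^ 2 * r3)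
    (h4 : Φ 4 = C f40 + X * r4) {z1 z2 z3 z4 : A} (e1 : z1 = b 1)
    (e2 : z2 = b 2 - f20 * z1 ^ 2)
    (e3 : z3 = b 3 - 2 * f20 * z1 * z2 - f21 * z1 ^ 2 - f30 * z1 ^ 3)
    (e4 : z4 = b 4 - f20 * (2 * z1 * z3 + z2 ^ 2) - 2 * f21 * z1 * z2 - 3 * f30 * z1 ^ 2 * z2
      - f31 * z1 ^ 3 - f40 * z1 ^ 4) :
    formalCoeff Φ b 1 = z1 ∧ formalCoeff Φ b 2 = z2 ∧ formalCoeff Φ b 3 = z3 ∧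
      formalCoeff Φ b 4 = z4 := by
  -- By uniqueness it suffices that this quartic candidate solves the equation modulo X ^ 5.
  set Z : A[X] := C z1 * X + C z2 * X ^ 2 + C z3 * X ^ 3 + C z4 * X ^ 4 with hZ
  have hXZ : X ∣ Z := ⟨C z1 + C z2 * X + C z3 * X ^ 2 + C z4 * X ^ 3, by rw [hZ]; ring⟩
  obtain ⟨s2, hs2⟩ : ∃ s, Z ^ 2 = C (z1 ^ 2) * X ^ 2 + C (2 * z1 * z2) * X ^ 3
      + C (2 * z1 * z3 + z2 ^ 2) * X ^ 4 + X ^ 5 * s :=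
    ⟨2 * C z1 * C z4 + 2 * C z2 * C z3 + (2 * C z2 * C z4 + C z3 ^ 2) * X
      + 2 * C z3 * C z4 * X ^ 2 + C z4 ^ 2 * X ^ 3, by
      rw [hZ]; simp only [map_mul, map_add, map_pow, map_ofNat]; ring⟩
  obtain ⟨s3, hs3⟩ : ∃ s, Z ^ 3 = C (z1 ^ 3) * X ^ 3 + C (3 * z1 ^ 2 * z2) * X ^ 4 + X ^ 5 * s :=
    ⟨C (z1 ^ 2) * (C z3 + C z4 * X) + C (2 * z1 * z2) * (C z2 + C z3 * X + C z4 * X ^ 2)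
      + C (2 * z1 * z3 + z2 ^ 2) * (C z1 + C z2 * X + C z3 * X ^ 2 + C z4 * X ^ 3)
      + s2 * Z, by
      rw [pow_succ, hs2, hZ]; simp only [map_mul, map_add, map_pow, map_ofNat]; ring⟩
  obtain ⟨s4, hs4⟩ : ∃ s, Z ^ 4 = C (z1 ^ 4) * X ^ 4 + X ^ 5 * s :=
    ⟨C (z1 ^ 3) * (C z2 + C z3 * X + C z4 * X ^ 2)
      + C (3 * z1 ^ 2 * z2) * (C z1 + C z2 * X + C z3 * X ^ 2 + C z4 * X ^ 3)
      + s3 * Z, by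
      rw [pow_succ, hs3, hZ]; simp only [map_mul, map_pow, map_ofNat]; ring⟩
  have hres : X ^ 5 ∣ formalResidual Φ b 4 Z := by
    have e : formalResidual Φ b 4 Z = (Z - C (b 1) * X - C (b 2) * X ^ 2 - C (b 3) * X ^ 3
        - C (b 4) * X ^ 4) + Φ 2 * Z ^ 2 + Φ 3 * Z ^ 3 + Φ 4 * Z ^ 4 := by
      have : Finset.Icc 1 4 = ({1, 2, 3, 4} : Finset ℕ) := by decide
      rw [formalResidual, this]
      simp [hΦ]
      ring
    rw [e, h2, h3, h4, hs2, hs3, hs4]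
    refine ⟨C f21 * C (2 * z1 * z3 + z2 ^ 2) + (C f20 + C f21 * X) * s2
      + C f31 * C (3 * z1 ^ 2 * z2) + r3 * (C (z1 ^ 3) + C (3 * z1 ^ 2 * z2) * X)
      + (C f30 + C f31 * X + X ^ 2 * r3) * s3 + r4 * C (z1 ^ 4) + (C f40 + X * r4) * s4, ?_⟩
    have g1 : C z1 = C (b 1) := by rw [e1]
    have g2 : C z2 = C (b 2) - C f20 * C z1 ^ 2 := by rw [e2]; simp
    have g3 : C z3 = C (b 3) - 2 * C f20 * C z1 * C z2 - C f21 * C z1 ^ 2 - C f30 * C z1 ^ 3 := by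
      rw [e3]; simp only [map_mul, map_sub, map_pow, map_ofNat]
    have g4 : C z4 = C (b 4) - C f20 * (2 * C z1 * C z3 + C z2 ^ 2) - 2 * C f21 * C z1 * C z2
        - 3 * C f30 * C z1 ^ 2 * C z2 - C f31 * C z1 ^ 3 - C f40 * C z1 ^ 4 := by
      rw [e4]; simp only [map_mul, map_sub, map_add, map_pow, map_ofNat]
    simp only [map_mul, map_add, map_pow, map_ofNat]
    rw [hZ]
    linear_combination X * g1 + X ^ 2 * g2 + X ^ 3 * g3 + X ^ 4 * g4
  have hu := formalSolution_unique b hΦ (by norm_num) hXZ hres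
  rw [X_pow_dvd_iff] at hu
  have hS : formalSolution Φ b 4 = C (formalCoeff Φ b 1) * X + C (formalCoeff Φ b 2) * X ^ 2
      + C (formalCoeff Φ b 3) * X ^ 3 + C (formalCoeff Φ b 4) * X ^ 4 := by
    have : Finset.Icc 1 4 = ({1, 2, 3, 4} : Finset ℕ) := by decide
    rw [formalSolution_eq_sum, this]
    simp
    ring
  rw [hS, hZ] at hu
  refine ⟨?_, ?_, ?_, ?_⟩
  · have := hu 1 (by norm_num)
    simp [coeff_X_pow] at this
    exact (sub_eq_zero.1 this).symm
  · have := hu 2 (by norm_num)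
    simp [coeff_X_pow] at this
    exact (sub_eq_zero.1 this).symm
  · have := hu 3 (by norm_num)
    simp [coeff_X_pow] at this
    exact (sub_eq_zero.1 this).symm
  · have := hu 4 (by norm_num)
    simp [coeff_X_pow] at this
    exact (sub_eq_zero.1 this).symm

end FormalInversion

/-! ### Coefficient polynomials in the bounded parameters ρ, ω, u, v. -/

section ExpansionCoefficients

open Polynomial

/-- Polynomials in the four bounded parameters `1/(1+x²)`, `x/(1+x²)`, `Cx/(Sx-C)`, `Sx/(Sx-C)`. -/
abbrev ParamRing := MvPolynomial (Fin 4) ℝ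

/-- Evaluation at a parameter value `p` and at `ε`. -/
noncomputable def paramEval (p : Fin 4 → ℝ) (ε : ℝ) : ParamRing[X] →+* ℝ :=
  eval₂RingHom (MvPolynomial.eval p) ε

@[simp] theorem paramEval_C (p : Fin 4 → ℝ) (ε : ℝ) (f : ParamRing) :
    paramEval p ε (C f) = MvPolynomial.eval p f := by simp [paramEval]

@[simp] theorem paramEval_X (p : Fin 4 → ℝ) (ε : ℝ) : paramEval p ε X = ε := by simp [paramEval]

theorem MvPolynomial.exists_abs_eval_le (f : ParamRing) (M : ℝ) :
    ∃ K : ℝ, ∀ p : Fin 4 → ℝ, (∀ i, |p i| ≤ M) → |MvPolynomial.eval p f| ≤ K := by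
  induction f using MvPolynomial.induction_on with
  | C a => exact ⟨|a|, fun p _ => by simp⟩
  | add f g hf hg =>
    obtain ⟨K, hK⟩ := hf
    obtain ⟨L, hL⟩ := hg
    refine ⟨K + L, fun p hp => ?_⟩
    rw [map_add]
    exact (abs_add_le _ _).trans (add_le_add (hK p hp) (hL p hp))
  | mul_X f i hf =>
    obtain ⟨K, hK⟩ := hf
    refine ⟨K * M, fun p hp => ?_⟩
    rw [map_mul, MvPolynomial.eval_X, abs_mul]
    exact mul_le_mul (hK p hp) (hp i) (abs_nonneg _) ((abs_nonneg _).trans (hK p hp))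

/-- This is the source of all uniformity: a bound depends only on the polynomial and on the size of
the parameter box, never on x, β or c. -/
theorem exists_abs_paramEval_le (Q : ParamRing[X]) (M : ℝ) :
    ∃ K : ℝ, 0 ≤ K ∧ ∀ (p : Fin 4 → ℝ) (ε : ℝ), (∀ i, |p i| ≤ M) → |ε| ≤ 1 →
      |paramEval p ε Q| ≤ K := by
  suffices h : ∃ K : ℝ, ∀ (p : Fin 4 → ℝ) (ε : ℝ), (∀ i, |p i| ≤ M) → |ε| ≤ 1 →
      |paramEval p ε Q| ≤ K by
    obtain ⟨K, hK⟩ := h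
    exact ⟨max K 0, le_max_right _ _, fun p ε hp hε => (hK p ε hp hε).trans (le_max_left _ _)⟩
  induction Q using Polynomial.induction_on' with
  | add f g hf hg =>
    obtain ⟨K, hK⟩ := hf
    obtain ⟨L, hL⟩ := hg
    refine ⟨K + L, fun p ε hp hε => ?_⟩
    rw [map_add]
    exact (abs_add_le _ _).trans (add_le_add (hK p ε hp hε) (hL p ε hp hε))
  | monomial n f =>
    obtain ⟨K, hK⟩ := MvPolynomial.exists_abs_eval_le f M
    refine ⟨K, fun p ε hp hε => ?_⟩
    rw [← C_mul_X_pow_eq_monomial, map_mul, map_pow, paramEval_C, paramEval_X, abs_mul, abs_pow]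
    calc _ ≤ |MvPolynomial.eval p f| * 1 :=
          mul_le_mul_of_nonneg_left (pow_le_one₀ (abs_nonneg _) hε) (abs_nonneg _)
      _ ≤ K := by rw [mul_one]; exact hK p hp

/-- Converts a formal order of vanishing in X into a genuine O(ε ^ n), uniform in the parameters. -/
theorem exists_abs_paramEval_le_of_X_pow_dvd {Q : ParamRing[X]} {n : ℕ} (h : X ^ n ∣ Q) (M : ℝ) :
    ∃ K : ℝ, 0 ≤ K ∧ ∀ (p : Fin 4 → ℝ) (ε : ℝ), (∀ i, |p i| ≤ M) → |ε| ≤ 1 →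
      |paramEval p ε Q| ≤ K * |ε| ^ n := by
  obtain ⟨Q', rfl⟩ := h
  obtain ⟨K, hK0, hK⟩ := exists_abs_paramEval_le Q' M
  refine ⟨K, hK0, fun p ε hp hε => ?_⟩
  rw [map_mul, map_pow, paramEval_X, abs_mul, abs_pow, mul_comm]
  exact mul_le_mul_of_nonneg_right (hK p ε hp hε) (by positivity)

/-- `c_k = ρ (1 - (k+1) ε)`. -/
noncomputable def rateCoeff (k : ℕ) : ParamRing[X] :=
  C (MvPolynomial.X 0) * (1 - C (MvPolynomial.C ((k : ℝ) + 1)) * X)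

/-- The `i`-th Taylor coefficients at `τ = 0` of `(1+ρετ)^(1/ε-1-k) cos ωτ` and of
`(1+ρετ)^(1/ε-1-k) sin(ωτ)/ω`. -/
noncomputable def taylorPair : ℕ → ℕ → ParamRing[X] × ParamRing[X]
  | _, 0 => (1, 0)
  | k, i + 1 =>
    (C (MvPolynomial.C ((i : ℝ) + 1)⁻¹) *
        (rateCoeff k * (taylorPair (k + 1) i).1 - C (MvPolynomial.X 1 ^ 2) * (taylorPair k i).2),
      C (MvPolynomial.C ((i : ℝ) + 1)⁻¹) *
        (rateCoeff k * (taylorPair (k + 1) i).2 + (taylorPair k i).1))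

/-- `m = ρ v + ω u`. -/
noncomputable def sineCoeff : ParamRing :=
  MvPolynomial.X 0 * MvPolynomial.X 3 + MvPolynomial.X 1 * MvPolynomial.X 2

/-- The Taylor coefficients in `ζ` of `∫₀^ζ (1+ρετ)^(1/ε-1) (cos ωτ + m sin(ωτ)/ω) dτ`. -/
noncomputable def phaseCoeff : ℕ → ParamRing[X]
  | 0 => 0
  | i + 1 => C (MvPolynomial.C ((i : ℝ) + 1)⁻¹) *
      ((taylorPair 0 i).1 + C sineCoeff * (taylorPair 0 i).2)

theorem phaseCoeff_one : phaseCoeff 1 = 1 := by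
  simp [phaseCoeff, taylorPair]

/-- `gammaPoly k` is `p_{k+1} / (w (1 - w))`, where `p_k` are the coefficients, as polynomials in
`w = 1/(1+ix)`, of the large parameter expansion of the incomplete gamma function. -/
noncomputable def gammaPoly : ℕ → ℂ[X]
  | 0 => 1
  | k + 1 => derivative (X ^ 2 * (1 - X) * gammaPoly k)

/-- Multiplication by ρ - iω acts on the pair (real part, imaginary part) with coefficients
polynomial in ρ and ω. -/
theorem exists_reIm (P : ℂ[X]) : ∃ f : ParamRing × ParamRing, ∀ p : Fin 4 → ℝ,
    P.eval ((p 0 : ℂ) - p 1 * Complex.I)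
      = (MvPolynomial.eval p f.1 : ℝ) + (MvPolynomial.eval p f.2 : ℝ) * Complex.I := by
  induction P using Polynomial.induction_on with
  | C a =>
    refine ⟨(MvPolynomial.C a.re, MvPolynomial.C a.im), fun p => ?_⟩
    simp [Complex.re_add_im]
  | add P Q hP hQ =>
    obtain ⟨f, hf⟩ := hP
    obtain ⟨g, hg⟩ := hQ
    refine ⟨f + g, fun p => ?_⟩
    rw [eval_add, hf, hg]
    simp only [Prod.fst_add, Prod.snd_add, map_add, Complex.ofReal_add]
    ring
  | monomial n a hf =>
    obtain ⟨f, hf⟩ := hf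
    refine ⟨(f.1 * MvPolynomial.X 0 + f.2 * MvPolynomial.X 1,
      f.2 * MvPolynomial.X 0 - f.1 * MvPolynomial.X 1), fun p => ?_⟩
    rw [pow_succ, ← mul_assoc, eval_mul, hf, eval_X]
    simp only [map_add, map_mul, map_sub, MvPolynomial.eval_X, Complex.ofReal_add,
      Complex.ofReal_mul, Complex.ofReal_sub]
    linear_combination -((MvPolynomial.eval p f.2 : ℝ) : ℂ) * p 1 * Complex.I_sq

/-- Real and imaginary part of `gammaPoly k` at `ρ - iω`. -/
noncomputable def gammaReIm (k : ℕ) : ParamRing × ParamRing :=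
  (exists_reIm (gammaPoly k)).choose

theorem eval_gammaPoly (k : ℕ) (p : Fin 4 → ℝ) :
    (gammaPoly k).eval ((p 0 : ℂ) - p 1 * Complex.I)
      = (MvPolynomial.eval p (gammaReIm k).1 : ℝ)
        + (MvPolynomial.eval p (gammaReIm k).2 : ℝ) * Complex.I :=
  (exists_reIm (gammaPoly k)).choose_spec p

/-- The coefficients of the right-hand side of the equation for the scaled correction. -/
noncomputable def sourceCoeff (k : ℕ) : ParamRing :=
  (2 * MvPolynomial.X 2 * MvPolynomial.X 1 - MvPolynomial.X 3 * (2 * MvPolynomial.X 0 - 1))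
      * (gammaReIm (k - 1)).1
    - (MvPolynomial.X 2 * (2 * MvPolynomial.X 0 - 1) + 2 * MvPolynomial.X 3 * MvPolynomial.X 1)
      * (gammaReIm (k - 1)).2

/-- With w = ρ - iω one has w(1-w) = i x w² = xρ (2ω + (2ρ-1)i). Multiplying by C + iS and dividing
by the slope factor ρ(Sx-C) turns the prefactor into (u + iv)(2ω + (2ρ-1)i). -/
theorem eval_sourceCoeff (k : ℕ) (p : Fin 4 → ℝ) :
    MvPolynomial.eval p (sourceCoeff k)
      = (((p 2 : ℂ) + p 3 * Complex.I) * (2 * p 1 + (2 * p 0 - 1) * Complex.I)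
        * (gammaPoly (k - 1)).eval ((p 0 : ℂ) - p 1 * Complex.I)).re := by
  rw [eval_gammaPoly]
  simp [sourceCoeff]
  ring

/-- The coefficients `ζ_k` of the scaled correction. -/
noncomputable def correctionCoeff (k : ℕ) : ParamRing := formalCoeff phaseCoeff sourceCoeff k

/-- The bounded parameters attached to `x, C, S`. -/
noncomputable def zeroParam (x C S : ℝ) : Fin 4 → ℝ :=
  ![1 / (1 + x ^ 2), x / (1 + x ^ 2), C * x / (S * x - C), S * x / (S * x - C)]

theorem gammaPoly_one : gammaPoly 1 = 2 * X - 3 * X ^ 2 := by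
  simp [gammaPoly]; ring

theorem gammaPoly_two : gammaPoly 2 = C 6 * X ^ 2 - C 20 * X ^ 3 + C 15 * X ^ 4 := by
  have e : (X : ℂ[X]) ^ 2 * (1 - X) * (2 * X - 3 * X ^ 2)
      = C 2 * X ^ 3 - C 5 * X ^ 4 + C 3 * X ^ 5 := by
    simp only [map_ofNat]; ring
  rw [gammaPoly, gammaPoly_one, e]
  simp only [derivative_add, derivative_sub, derivative_C_mul_X_pow]
  norm_num

theorem gammaPoly_three :
    gammaPoly 3 = C 24 * X ^ 3 - C 130 * X ^ 4 + C 210 * X ^ 5 - C 105 * X ^ 6 := by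
  have e : (X : ℂ[X]) ^ 2 * (1 - X) * (C 6 * X ^ 2 - C 20 * X ^ 3 + C 15 * X ^ 4)
      = C 6 * X ^ 4 - C 26 * X ^ 5 + C 35 * X ^ 6 - C 15 * X ^ 7 := by
    simp only [map_ofNat]; ring
  rw [gammaPoly, gammaPoly_two, e]
  simp only [derivative_add, derivative_sub, derivative_C_mul_X_pow]
  norm_num

end ExpansionCoefficients

/-! ### The first four source, phase and correction coefficients. -/

section ExplicitCoefficients

open Polynomial

/-- Collects the source term over a power of 1 + x², once the value w of the polynomial has been
written with such a denominator; here 2ρ - 1 = (1-x²)/(1+x²). -/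
theorem re_source_aux (x u v : ℝ) (r1 i1 : ℝ) (n : ℕ) {w : ℂ}
    (hw : w = ((r1 : ℂ) + i1 * Complex.I) / (1 + x ^ 2) ^ n) :
    (((u : ℂ) + v * Complex.I) * (2 * ((x / (1 + x ^ 2) : ℝ) : ℂ)
      + (2 * ((1 / (1 + x ^ 2) : ℝ) : ℂ) - 1) * Complex.I) * w).re
      = (u * (2 * x * r1 - (1 - x ^ 2) * i1) - v * ((1 - x ^ 2) * r1 + 2 * x * i1))
        / (1 + x ^ 2) ^ (n + 1) := by
  have hn : (1 + x ^ 2) ≠ 0 := by positivity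
  have e : w = (((r1 / (1 + x ^ 2) ^ n : ℝ)) : ℂ) + ((i1 / (1 + x ^ 2) ^ n : ℝ) : ℂ) * Complex.I := by
    rw [hw]; push_cast; ring
  rw [e]
  simp only [Complex.mul_re, Complex.add_re, Complex.mul_im, Complex.add_im, Complex.sub_re,
    Complex.sub_im, Complex.ofReal_re, Complex.ofReal_im, Complex.I_re, Complex.I_im,
    Complex.re_ofNat, Complex.im_ofNat, Complex.one_re, Complex.one_im]
  field_simp
  ring

theorem one_sub_mul_I_pow (x : ℝ) :
    (1 - (x : ℂ) * Complex.I) ^ 2 = (1 - x ^ 2) - 2 * x * Complex.I ∧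
    (1 - (x : ℂ) * Complex.I) ^ 3 = (1 - 3 * x ^ 2) + (x ^ 3 - 3 * x) * Complex.I ∧
    (1 - (x : ℂ) * Complex.I) ^ 4 = (1 - 6 * x ^ 2 + x ^ 4) + (4 * x ^ 3 - 4 * x) * Complex.I ∧
    (1 - (x : ℂ) * Complex.I) ^ 5
      = (1 - 10 * x ^ 2 + 5 * x ^ 4) + (10 * x ^ 3 - 5 * x - x ^ 5) * Complex.I ∧
    (1 - (x : ℂ) * Complex.I) ^ 6
      = (1 - 15 * x ^ 2 + 15 * x ^ 4 - x ^ 6) + (20 * x ^ 3 - 6 * x - 6 * x ^ 5) * Complex.I := by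
  have h2 : (1 - (x : ℂ) * Complex.I) ^ 2 = (1 - x ^ 2) - 2 * x * Complex.I := by
    linear_combination (x : ℂ) ^ 2 * Complex.I_sq
  have h3 : (1 - (x : ℂ) * Complex.I) ^ 3 = (1 - 3 * x ^ 2) + (x ^ 3 - 3 * x) * Complex.I := by
    rw [pow_succ, h2]; linear_combination 2 * (x : ℂ) ^ 2 * Complex.I_sq
  have h4 : (1 - (x : ℂ) * Complex.I) ^ 4
      = (1 - 6 * x ^ 2 + x ^ 4) + (4 * x ^ 3 - 4 * x) * Complex.I := by
    rw [pow_succ, h3]; linear_combination -((x : ℂ) ^ 3 - 3 * x) * x * Complex.I_sq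
  have h5 : (1 - (x : ℂ) * Complex.I) ^ 5
      = (1 - 10 * x ^ 2 + 5 * x ^ 4) + (10 * x ^ 3 - 5 * x - x ^ 5) * Complex.I := by
    rw [pow_succ, h4]; linear_combination -(4 * (x : ℂ) ^ 3 - 4 * x) * x * Complex.I_sq
  refine ⟨h2, h3, h4, h5, ?_⟩
  rw [pow_succ, h5]
  linear_combination -(10 * (x : ℂ) ^ 3 - 5 * x - x ^ 5) * x * Complex.I_sq

variable {x : ℝ} {p : Fin 4 → ℝ}

theorem param_point_eq (h0 : p 0 = 1 / (1 + x ^ 2)) (h1 : p 1 = x / (1 + x ^ 2)) :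
    (p 0 : ℂ) - p 1 * Complex.I = (1 - (x : ℂ) * Complex.I) / (1 + x ^ 2) := by
  rw [h0, h1]; push_cast; ring

theorem one_add_sq_ofReal_ne_zero (x : ℝ) : (1 + (x : ℂ) ^ 2) ≠ 0 := by
  have : (1 + x ^ 2) ≠ 0 := by positivity
  exact_mod_cast this

theorem eval_sourceCoeff_one (h0 : p 0 = 1 / (1 + x ^ 2)) (h1 : p 1 = x / (1 + x ^ 2)) :
    MvPolynomial.eval p (sourceCoeff 1) = (p 2 * (2 * x) - p 3 * (1 - x ^ 2)) / (1 + x ^ 2) := by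
  rw [eval_sourceCoeff, h0, h1, re_source_aux x _ _ 1 0 0]
  · ring
  · simp [gammaPoly]

theorem eval_sourceCoeff_two (h0 : p 0 = 1 / (1 + x ^ 2)) (h1 : p 1 = x / (1 + x ^ 2)) :
    MvPolynomial.eval p (sourceCoeff 2)
      = (p 2 * (-2 * x ^ 5 + 16 * x ^ 3 - 6 * x) - p 3 * (-9 * x ^ 4 + 14 * x ^ 2 - 1))
        / (1 + x ^ 2) ^ 3 := by
  obtain ⟨h2, h3, h4, h5, h6⟩ := one_sub_mul_I_pow x
  have hn := one_add_sq_ofReal_ne_zero x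
  rw [eval_sourceCoeff, param_point_eq h0 h1, h0, h1,
    re_source_aux x _ _ (5 * x ^ 2 - 1) (4 * x - 2 * x ^ 3) 2]
  · ring
  · simp only [gammaPoly_one, Nat.add_one_sub_one, eval_sub, eval_mul, eval_pow, eval_X, eval_ofNat, div_pow, h2]
    push_cast
    field_simp
    ring

theorem eval_sourceCoeff_three (h0 : p 0 = 1 / (1 + x ^ 2)) (h1 : p 1 = x / (1 + x ^ 2)) :
    MvPolynomial.eval p (sourceCoeff 3)
      = (p 2 * (-44 * x ^ 7 + 246 * x ^ 5 - 176 * x ^ 3 + 14 * x)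
          - p 3 * (6 * x ^ 8 - 139 * x ^ 6 + 265 * x ^ 4 - 69 * x ^ 2 + 1)) / (1 + x ^ 2) ^ 5 := by
  obtain ⟨h2, h3, h4, h5, h6⟩ := one_sub_mul_I_pow x
  have hn := one_add_sq_ofReal_ne_zero x
  rw [eval_sourceCoeff, param_point_eq h0 h1, h0, h1,
    re_source_aux x _ _ (6 * (1 - x ^ 2) * (1 + x ^ 2) ^ 2 - 20 * (1 - 3 * x ^ 2) * (1 + x ^ 2)
        + 15 * (1 - 6 * x ^ 2 + x ^ 4))
      (-12 * x * (1 + x ^ 2) ^ 2 - 20 * (x ^ 3 - 3 * x) * (1 + x ^ 2)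
        + 15 * (4 * x ^ 3 - 4 * x)) 4]
  · ring
  · simp only [gammaPoly_two, Nat.reduceSub, eval_sub, eval_add, eval_mul, eval_pow, eval_X, eval_C, div_pow, h2, h3, h4]
    push_cast
    field_simp
    ring

theorem eval_sourceCoeff_four (h0 : p 0 = 1 / (1 + x ^ 2)) (h1 : p 1 = x / (1 + x ^ 2)) :
    MvPolynomial.eval p (sourceCoeff 4)
      = (p 2 * (24 * x ^ 11 - 1158 * x ^ 9 + 5552 * x ^ 7 - 5516 * x ^ 5 + 1160 * x ^ 3 - 30 * x)
          - p 3 * (250 * x ^ 10 - 3145 * x ^ 8 + 6664 * x ^ 6 - 3118 * x ^ 4 + 262 * x ^ 2 - 1))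
        / (1 + x ^ 2) ^ 7 := by
  obtain ⟨h2, h3, h4, h5, h6⟩ := one_sub_mul_I_pow x
  have hn := one_add_sq_ofReal_ne_zero x
  rw [eval_sourceCoeff, param_point_eq h0 h1, h0, h1,
    re_source_aux x _ _ (24 * (1 - 3 * x ^ 2) * (1 + x ^ 2) ^ 3
        - 130 * (1 - 6 * x ^ 2 + x ^ 4) * (1 + x ^ 2) ^ 2
        + 210 * (1 - 10 * x ^ 2 + 5 * x ^ 4) * (1 + x ^ 2)
        - 105 * (1 - 15 * x ^ 2 + 15 * x ^ 4 - x ^ 6))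
      (24 * (x ^ 3 - 3 * x) * (1 + x ^ 2) ^ 3 - 130 * (4 * x ^ 3 - 4 * x) * (1 + x ^ 2) ^ 2
        + 210 * (10 * x ^ 3 - 5 * x - x ^ 5) * (1 + x ^ 2)
        - 105 * (20 * x ^ 3 - 6 * x - 6 * x ^ 5)) 6]
  · ring
  · simp only [gammaPoly_three, Nat.reduceSub, eval_sub, eval_add, eval_mul, eval_pow, eval_X, eval_C, div_pow, h3, h4, h5, h6]
    push_cast
    field_simp
    ring

theorem phaseCoeff_two : phaseCoeff 2 =
    C (MvPolynomial.C (1 / 2) * (MvPolynomial.X 0 + sineCoeff))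
      + C (-(MvPolynomial.C (1 / 2) * MvPolynomial.X 0)) * X := by
  simp [phaseCoeff, taylorPair, rateCoeff]
  norm_num
  ring

theorem exists_phaseCoeff_three : ∃ r, phaseCoeff 3 =
    C (MvPolynomial.C (1 / 6) * (MvPolynomial.X 0 ^ 2 - MvPolynomial.X 1 ^ 2
        + 2 * MvPolynomial.X 0 * sineCoeff))
      + C (-(MvPolynomial.C (1 / 2) * MvPolynomial.X 0 ^ 2
        + MvPolynomial.C (1 / 3) * (MvPolynomial.X 0 * sineCoeff))) * X
      + X ^ 2 * r := by
  refine ⟨C (MvPolynomial.C (1 / 3) * MvPolynomial.X 0 ^ 2), ?_⟩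
  -- All rational constants are integer multiples of a = 1/6, so the identity only has to hold
  -- modulo 6a = 1.
  obtain ⟨a, ha⟩ : ∃ a : ParamRing[X], a = C (MvPolynomial.C (1 / 6)) := ⟨_, rfl⟩
  have e2 : (C (MvPolynomial.C (1 / 2)) : ParamRing[X]) = 3 * a := by
    rw [ha, ← map_ofNat C, ← map_ofNat MvPolynomial.C, ← map_mul, ← map_mul]; norm_num
  have e3 : (C (MvPolynomial.C (1 / 3)) : ParamRing[X]) = 2 * a := by
    rw [ha, ← map_ofNat C, ← map_ofNat MvPolynomial.C, ← map_mul, ← map_mul]; norm_num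
  have e4 : 6 * a = 1 := by
    rw [ha, ← map_ofNat C, ← map_ofNat MvPolynomial.C, ← map_mul, ← map_mul]; norm_num
  have t1 : ((1 : ℝ) + 1) = 2 := by norm_num
  have t3 : (2 : ℝ)⁻¹ = 1 / 2 := by norm_num
  have t2 : ((2 : ℝ) + 1)⁻¹ = 1 / 3 := by norm_num
  simp only [phaseCoeff, taylorPair, rateCoeff, Nat.cast_zero, Nat.cast_one, Nat.cast_ofNat,
    zero_add, map_mul, map_add, map_sub, map_neg, map_pow, map_ofNat, map_one, t1, t2, t3, inv_one,
    mul_one, one_mul, mul_zero, sub_zero, e2, e3, ← ha]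
  linear_combination a * (C (MvPolynomial.X 0) * (1 - X) * (C (MvPolynomial.X 0) * (1 - 2 * X))
    - C (MvPolynomial.X 1) ^ 2 + 2 * C sineCoeff * C (MvPolynomial.X 0) * (1 - X)) * e4

theorem paramEval_zero (p : Fin 4 → ℝ) (Q : ParamRing[X]) :
    paramEval p 0 Q = MvPolynomial.eval p (Q.coeff 0) := by
  simp [paramEval, eval₂_at_zero]

theorem eval_sineCoeff (p : Fin 4 → ℝ) :
    MvPolynomial.eval p sineCoeff = p 0 * p 3 + p 1 * p 2 := by
  simp [sineCoeff]

theorem eval_phaseCoeff_four_coeff_zero (p : Fin 4 → ℝ) :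
    MvPolynomial.eval p ((phaseCoeff 4).coeff 0) = (p 0 ^ 3 - 3 * p 0 * p 1 ^ 2
      + (p 0 * p 3 + p 1 * p 2) * (3 * p 0 ^ 2 - p 1 ^ 2)) / 24 := by
  rw [← paramEval_zero]
  simp [phaseCoeff, taylorPair, rateCoeff, eval_sineCoeff]
  ring

/-- The recursion for the first four correction coefficients. -/
theorem eval_correctionCoeff (p : Fin 4 → ℝ) {m b1 b2 b3 b4 z1 z2 z3 z4 : ℝ}
    (hm : p 0 * p 3 + p 1 * p 2 = m)
    (hb1 : MvPolynomial.eval p (sourceCoeff 1) = b1) (hb2 : MvPolynomial.eval p (sourceCoeff 2) = b2)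
    (hb3 : MvPolynomial.eval p (sourceCoeff 3) = b3) (hb4 : MvPolynomial.eval p (sourceCoeff 4) = b4)
    (e1 : z1 = b1) (e2 : z2 = b2 - (p 0 + m) / 2 * z1 ^ 2)
    (e3 : z3 = b3 - (p 0 + m) * z1 * z2 + p 0 / 2 * z1 ^ 2
      - (p 0 ^ 2 - p 1 ^ 2 + 2 * p 0 * m) / 6 * z1 ^ 3)
    (e4 : z4 = b4 - (p 0 + m) / 2 * (2 * z1 * z3 + z2 ^ 2) + p 0 * z1 * z2
      - (p 0 ^ 2 - p 1 ^ 2 + 2 * p 0 * m) / 2 * z1 ^ 2 * z2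
      + (p 0 ^ 2 / 2 + p 0 * m / 3) * z1 ^ 3
      - (p 0 ^ 3 - 3 * p 0 * p 1 ^ 2 + m * (3 * p 0 ^ 2 - p 1 ^ 2)) / 24 * z1 ^ 4) :
    MvPolynomial.eval p (correctionCoeff 1) = z1 ∧ MvPolynomial.eval p (correctionCoeff 2) = z2 ∧
    MvPolynomial.eval p (correctionCoeff 3) = z3 ∧ MvPolynomial.eval p (correctionCoeff 4) = z4 := by
  obtain ⟨r3, h3⟩ := exists_phaseCoeff_three
  have h4 : phaseCoeff 4 = C ((phaseCoeff 4).coeff 0) + X * divX (phaseCoeff 4) := by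
    rw [add_comm]; exact (X_mul_divX_add _).symm
  obtain ⟨Z1, hZ1⟩ : ∃ Z, Z = sourceCoeff 1 := ⟨_, rfl⟩
  obtain ⟨Z2, hZ2⟩ : ∃ Z, Z = sourceCoeff 2
    - MvPolynomial.C (1 / 2) * (MvPolynomial.X 0 + sineCoeff) * Z1 ^ 2 := ⟨_, rfl⟩
  obtain ⟨Z3, hZ3⟩ : ∃ Z, Z = sourceCoeff 3
    - 2 * (MvPolynomial.C (1 / 2) * (MvPolynomial.X 0 + sineCoeff)) * Z1 * Z2
    - -(MvPolynomial.C (1 / 2) * MvPolynomial.X 0) * Z1 ^ 2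
    - MvPolynomial.C (1 / 6) * (MvPolynomial.X 0 ^ 2 - MvPolynomial.X 1 ^ 2
        + 2 * MvPolynomial.X 0 * sineCoeff) * Z1 ^ 3 := ⟨_, rfl⟩
  obtain ⟨c1, c2, c3, c4⟩ := formalCoeff_one_to_four sourceCoeff phaseCoeff_one phaseCoeff_two h3 h4
    hZ1 hZ2 hZ3 rfl
  have hm' := (eval_sineCoeff p).trans hm
  have h40 := eval_phaseCoeff_four_coeff_zero p
  rw [hm] at h40
  have k1 : MvPolynomial.eval p Z1 = z1 := by rw [hZ1, hb1, e1]
  have k2 : MvPolynomial.eval p Z2 = z2 := by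
    rw [hZ2, e2]
    simp only [map_sub, map_mul, map_pow, map_add, MvPolynomial.eval_C, MvPolynomial.eval_X, hm', hb2,
      k1]
    ring
  have k3 : MvPolynomial.eval p Z3 = z3 := by
    rw [hZ3, e3]
    simp only [map_sub, map_mul, map_pow, map_add, map_neg, map_ofNat, MvPolynomial.eval_C,
      MvPolynomial.eval_X, hm', hb3, k1, k2]
    ring
  refine ⟨(congrArg _ c1).trans k1, (congrArg _ c2).trans k2, (congrArg _ c3).trans k3,
    (congrArg _ c4).trans ?_⟩
  rw [e4]
  simp only [map_sub, map_mul, map_pow, map_add, map_neg, map_ofNat, MvPolynomial.eval_C,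
    MvPolynomial.eval_X, hm', hb4, h40, k1, k2, k3]
  ring

end ExplicitCoefficients

/-! ### The correction coefficients in the single ratio s = S/(Sx-C). -/

section ExplicitComparison

/-- The first four correction coefficients in terms of `x` and `s = S/(Sx-C)`. -/
theorem eval_correctionCoeff_explicit (x : ℝ) {s n : ℝ} {p : Fin 4 → ℝ} (hn : n = 1 + x ^ 2)
    (h0 : p 0 = 1 / (1 + x ^ 2))
    (h1 : p 1 = x / (1 + x ^ 2)) (h2 : p 2 = (s * x - 1) * x) (h3 : p 3 = s * x) :
    ∃ z1 z2 z3 z4 : ℝ,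
    MvPolynomial.eval p (correctionCoeff 1) = z1 / n ∧
    MvPolynomial.eval p (correctionCoeff 2) = z2 / (2 * n ^ 3) ∧
    MvPolynomial.eval p (correctionCoeff 3) = z3 / (6 * n ^ 5) ∧
    MvPolynomial.eval p (correctionCoeff 4) = z4 / (24 * n ^ 7) ∧
    z1 = (s * x - 1) * x * (2 * x) - s * x * (1 - x ^ 2) ∧
    z2 = 2 * ((s * x - 1) * x * (-2 * x ^ 5 + 16 * x ^ 3 - 6 * x)
        - s * x * (-9 * x ^ 4 + 14 * x ^ 2 - 1))
      - (1 - x ^ 2 + s * x * n) * z1 ^ 2 ∧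
    z3 = 6 * ((s * x - 1) * x * (-44 * x ^ 7 + 246 * x ^ 5 - 176 * x ^ 3 + 14 * x)
        - s * x * (6 * x ^ 8 - 139 * x ^ 6 + 265 * x ^ 4 - 69 * x ^ 2 + 1))
      - 3 * (1 - x ^ 2 + s * x * n) * z1 * z2 + 3 * n ^ 2 * z1 ^ 2
      - (1 - x ^ 2 + 2 * (s * x * n - x ^ 2)) * z1 ^ 3 ∧
    z4 = 24 * ((s * x - 1) * x * (24 * x ^ 11 - 1158 * x ^ 9 + 5552 * x ^ 7 - 5516 * x ^ 5 + 1160 * x ^ 3 - 30 * x)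
        - s * x * (250 * x ^ 10 - 3145 * x ^ 8 + 6664 * x ^ 6 - 3118 * x ^ 4 + 262 * x ^ 2 - 1))
      - (1 - x ^ 2 + s * x * n) * (4 * z1 * z3 + 3 * z2 ^ 2) + 12 * n ^ 2 * z1 * z2
      - 6 * (1 - x ^ 2 + 2 * (s * x * n - x ^ 2)) * z1 ^ 2 * z2
      + n ^ 2 * (12 + 8 * (s * x * n - x ^ 2)) * z1 ^ 3
      - (1 - 3 * x ^ 2 + (s * x * n - x ^ 2) * (3 - x ^ 2)) * z1 ^ 4 := by
  have hn0 : n ≠ 0 := by rw [hn]; positivity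
  rw [← hn] at h0 h1
  -- With u = (sx-1)x and v = sx, the number m = ρv + ωu depends on x and s alone.
  have hm : p 0 * p 3 + p 1 * p 2 = (s * x * n - x ^ 2) / n := by
    rw [h0, h1, h2, h3, hn]; field_simp; ring
  have s1 := eval_sourceCoeff_one (hn ▸ h0) (hn ▸ h1)
  have s2 := eval_sourceCoeff_two (hn ▸ h0) (hn ▸ h1)
  have s3 := eval_sourceCoeff_three (hn ▸ h0) (hn ▸ h1)
  have s4 := eval_sourceCoeff_four (hn ▸ h0) (hn ▸ h1)
  rw [← hn, h2, h3] at s1 s2 s3 s4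
  obtain ⟨z1, hz1⟩ : ∃ z1, z1 = (s * x - 1) * x * (2 * x) - s * x * (1 - x ^ 2) := ⟨_, rfl⟩
  obtain ⟨z2, hz2⟩ : ∃ z2, z2 = 2 * ((s * x - 1) * x * (-2 * x ^ 5 + 16 * x ^ 3 - 6 * x)
        - s * x * (-9 * x ^ 4 + 14 * x ^ 2 - 1))
      - (1 - x ^ 2 + s * x * n) * z1 ^ 2 := ⟨_, rfl⟩
  obtain ⟨z3, hz3⟩ : ∃ z3, z3 = 6 * ((s * x - 1) * x * (-44 * x ^ 7 + 246 * x ^ 5 - 176 * x ^ 3 + 14 * x)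
        - s * x * (6 * x ^ 8 - 139 * x ^ 6 + 265 * x ^ 4 - 69 * x ^ 2 + 1))
      - 3 * (1 - x ^ 2 + s * x * n) * z1 * z2 + 3 * n ^ 2 * z1 ^ 2
      - (1 - x ^ 2 + 2 * (s * x * n - x ^ 2)) * z1 ^ 3 := ⟨_, rfl⟩
  obtain ⟨k1, k2, k3, k4⟩ := eval_correctionCoeff p hm s1 s2 s3 s4 (z1 := z1 / n)
    (z2 := z2 / (2 * n ^ 3)) (z3 := z3 / (6 * n ^ 5)) (by rw [hz1])
    (by rw [h0, hz2]; field_simp; ring) (by rw [h0, h1, hz3]; field_simp; ring) rfl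
  refine ⟨z1, z2, z3, _, k1, k2, k3, ?_, hz1, hz2, hz3, rfl⟩
  rw [k4, h0, h1]
  field_simp
  ring

end ExplicitComparison

/-! ### The displayed rational functions on the circle C² + S² = 1. -/

section ExplicitTilde

variable {x c s D : ℝ}

/-- With D = Sx - C, c = C/D and s = S/D the denominators become powers of 1 + x², and c = sx - 1
leaves s as the only unknown besides x. -/
theorem qTilde2_homogeneous (hD : D ≠ 0) (hsc : s * x - c = 1) : qTilde2 x (c * D) (s * D)
    = x ^ 2 * (s * x ^ 2 + 2 * c * x - s) / (x ^ 2 + 1) ^ 2 := by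
  have hD1 : s * D * x - c * D = D := by linear_combination D * hsc
  have hx : (x ^ 2 + 1) ≠ 0 := by positivity
  rw [qTilde2, hD1]
  field_simp

theorem scale_div_aux (hD : D ≠ 0) (x a n : ℝ) (k : ℕ) {X Y : ℝ} (h : X = D ^ k * Y) :
    x ^ 2 / (a * n * D ^ k) * X = x ^ 2 / (a * n) * Y := by
  rw [h, ← mul_assoc, div_mul_eq_mul_div, mul_div_mul_right _ _ (pow_ne_zero k hD)]

/-- The displayed numerators mix odd degrees in (C, S). On the circle D² q = 1 with q = c² + s², so
lower degrees are lifted to the top one by factors of q and the power of D cancels against the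
denominator. The same device serves for the two higher coefficients. -/
theorem qTilde3_numerator (q : ℝ) (d1 : D = D ^ 3 * q) :
    ((c * D) ^ 3 * x * (5 * x ^ 2 - 9) * (x ^ 2 + 1) ^ 2
      - 2 * (c * D) ^ 2 * (s * D) * (6 * x ^ 2 - 1) * (x ^ 2 + 1) ^ 2)
      + (- (c * D) * x * (5 * x ^ 6 + 9 * x ^ 4 - 49 * x ^ 2 + 3)
      + 8 * (s * D) * x ^ 4 * (2 * x ^ 2 - 3))
      = D ^ 3 * (c ^ 3 * x * (5 * x ^ 2 - 9) * (x ^ 2 + 1) ^ 2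
      - 2 * c ^ 2 * s * (6 * x ^ 2 - 1) * (x ^ 2 + 1) ^ 2
      + q * (- c * x * (5 * x ^ 6 + 9 * x ^ 4 - 49 * x ^ 2 + 3)
      + 8 * s * x ^ 4 * (2 * x ^ 2 - 3))) := by
  have g1 : D ^ 1 = D ^ 3 * q ^ 1 := by
    linear_combination D ^ 0 * q ^ 0 * d1
  linear_combination (- c * x * (5 * x ^ 6 + 9 * x ^ 4 - 49 * x ^ 2 + 3)
      + 8 * s * x ^ 4 * (2 * x ^ 2 - 3)) * g1

theorem qTilde3_homogeneous (hD : D ≠ 0) (hsc : s * x - c = 1)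
    (h : D ^ 2 * (c ^ 2 + s ^ 2) = 1) : qTilde3 x (c * D) (s * D)
      = (x ^ 2 / (2 * (x ^ 2 + 1) ^ 4)) *
      (c ^ 3 * x * (5 * x ^ 2 - 9) * (x ^ 2 + 1) ^ 2
      - 2 * c ^ 2 * s * (6 * x ^ 2 - 1) * (x ^ 2 + 1) ^ 2
      + (c ^ 2 + s ^ 2) * (- c * x * (5 * x ^ 6 + 9 * x ^ 4 - 49 * x ^ 2 + 3)
      + 8 * s * x ^ 4 * (2 * x ^ 2 - 3))) := by
  have hD1 : s * D * x - c * D = D := by linear_combination D * hsc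
  have e := qTilde3_numerator (x := x) (c := c) (s := s) (c ^ 2 + s ^ 2)
    (show D = D ^ 3 * (c ^ 2 + s ^ 2) by linear_combination -D * h)
  rw [qTilde3, hD1]
  refine scale_div_aux hD x _ _ 3 (Eq.trans ?_ e)
  ring

theorem qTilde4_numerator (q : ℝ) (d1 : D = D ^ 3 * q) :
    ((c * D) ^ 5 * x * (151 * x ^ 2 - 69) * (x ^ 2 + 1) ^ 4
      + (c * D) ^ 4 * (s * D) * (47 * x ^ 4 - 167 * x ^ 2 + 6) * (x ^ 2 + 1) ^ 4)
      + (- (c * D) ^ 3 * x * (284 * x ^ 10 + 2445 * x ^ 8 - 4962 * x ^ 6 + 3124 * x ^ 4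
          - 1258 * x ^ 2 + 15)
      - (c * D) ^ 2 * (s * D) * x ^ 2 * (79 * x ^ 10 - 711 * x ^ 8 + 2252 * x ^ 6 - 6460 * x ^ 4
          + 2013 * x ^ 2 - 5))
      + ((c * D) * x ^ 3 * (133 * x ^ 8 + 1862 * x ^ 6 - 5076 * x ^ 4 + 1202 * x ^ 2 + 7)
      + 4 * (s * D) * x ^ 6 * (8 * x ^ 6 - 183 * x ^ 4 + 336 * x ^ 2 - 65))
      = D ^ 5 * (c ^ 5 * x * (151 * x ^ 2 - 69) * (x ^ 2 + 1) ^ 4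
      + c ^ 4 * s * (47 * x ^ 4 - 167 * x ^ 2 + 6) * (x ^ 2 + 1) ^ 4
      + q * (- c ^ 3 * x * (284 * x ^ 10 + 2445 * x ^ 8 - 4962 * x ^ 6 + 3124 * x ^ 4
          - 1258 * x ^ 2 + 15)
      - c ^ 2 * s * x ^ 2 * (79 * x ^ 10 - 711 * x ^ 8 + 2252 * x ^ 6 - 6460 * x ^ 4
          + 2013 * x ^ 2 - 5))
      + q ^ 2 * (c * x ^ 3 * (133 * x ^ 8 + 1862 * x ^ 6 - 5076 * x ^ 4 + 1202 * x ^ 2 + 7)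
      + 4 * s * x ^ 6 * (8 * x ^ 6 - 183 * x ^ 4 + 336 * x ^ 2 - 65))) := by
  have g3 : D ^ 3 = D ^ 5 * q ^ 1 := by
    linear_combination D ^ 2 * q ^ 0 * d1
  have g1 : D ^ 1 = D ^ 5 * q ^ 2 := by
    linear_combination D ^ 0 * q ^ 0 * d1 + D ^ 2 * q ^ 1 * d1
  linear_combination (- c ^ 3 * x * (284 * x ^ 10 + 2445 * x ^ 8 - 4962 * x ^ 6 + 3124 * x ^ 4
          - 1258 * x ^ 2 + 15)
      - c ^ 2 * s * x ^ 2 * (79 * x ^ 10 - 711 * x ^ 8 + 2252 * x ^ 6 - 6460 * x ^ 4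
          + 2013 * x ^ 2 - 5)) * g3 + (c * x ^ 3 * (133 * x ^ 8 + 1862 * x ^ 6 - 5076 * x ^ 4 + 1202 * x ^ 2 + 7)
      + 4 * s * x ^ 6 * (8 * x ^ 6 - 183 * x ^ 4 + 336 * x ^ 2 - 65)) * g1

theorem qTilde4_homogeneous (hD : D ≠ 0) (hsc : s * x - c = 1)
    (h : D ^ 2 * (c ^ 2 + s ^ 2) = 1) : qTilde4 x (c * D) (s * D)
      = -(x ^ 2 / (6 * (x ^ 2 + 1) ^ 6)) *
      (c ^ 5 * x * (151 * x ^ 2 - 69) * (x ^ 2 + 1) ^ 4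
      + c ^ 4 * s * (47 * x ^ 4 - 167 * x ^ 2 + 6) * (x ^ 2 + 1) ^ 4
      + (c ^ 2 + s ^ 2) * (- c ^ 3 * x * (284 * x ^ 10 + 2445 * x ^ 8 - 4962 * x ^ 6 + 3124 * x ^ 4
          - 1258 * x ^ 2 + 15)
      - c ^ 2 * s * x ^ 2 * (79 * x ^ 10 - 711 * x ^ 8 + 2252 * x ^ 6 - 6460 * x ^ 4
          + 2013 * x ^ 2 - 5))
      + (c ^ 2 + s ^ 2) ^ 2 * (c * x ^ 3 * (133 * x ^ 8 + 1862 * x ^ 6 - 5076 * x ^ 4 + 1202 * x ^ 2 + 7)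
      + 4 * s * x ^ 6 * (8 * x ^ 6 - 183 * x ^ 4 + 336 * x ^ 2 - 65))) := by
  have hD1 : s * D * x - c * D = D := by linear_combination D * hsc
  have e := qTilde4_numerator (x := x) (c := c) (s := s) (c ^ 2 + s ^ 2)
    (show D = D ^ 3 * (c ^ 2 + s ^ 2) by linear_combination -D * h)
  rw [qTilde4, hD1, neg_mul, neg_mul, neg_inj]
  refine scale_div_aux hD x _ _ 5 (Eq.trans ?_ e)
  ring

theorem qTilde5_numerator (q : ℝ) (d1 : D = D ^ 3 * q) :
    (2 * (c * D) ^ 7 * x * (379 * x ^ 4 - 2365 * x ^ 2 + 318) * (x ^ 2 + 1) ^ 6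
      - 4 * (c * D) ^ 6 * (s * D) * (802 * x ^ 4 - 723 * x ^ 2 + 6) * (x ^ 2 + 1) ^ 6)
      + (- (c * D) ^ 5 * x * (2139 * x ^ 16 + 6650 * x ^ 14 - 352255 * x ^ 12 + 1102732 * x ^ 10
          - 2195479 * x ^ 8 + 1221754 * x ^ 6 - 255889 * x ^ 4 + 28256 * x ^ 2 - 84)
      + 4 * (c * D) ^ 4 * (s * D) * x ^ 2 * (2944 * x ^ 14 - 12111 * x ^ 12 + 171062 * x ^ 10
          - 479729 * x ^ 8 + 418084 * x ^ 6 - 187793 * x ^ 4 + 18502 * x ^ 2 - 15))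
      + (2 * (c * D) ^ 3 * x ^ 3 * (1002 * x ^ 14 + 6707 * x ^ 12 - 318554 * x ^ 10 + 955395 * x ^ 8
          - 1211026 * x ^ 6 + 568777 * x ^ 4 - 46366 * x ^ 2 - 31)
      - 16 * (c * D) ^ 2 * (s * D) * x ^ 4 * (875 * x ^ 12 - 8242 * x ^ 10 + 48471 * x ^ 8
          - 110732 * x ^ 6 + 54721 * x ^ 4 - 3906 * x ^ 2 - 3))
      + (- (c * D) * x ^ 5 * (623 * x ^ 12 + 6582 * x ^ 10 - 301803 * x ^ 8 + 762660 * x ^ 6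
          - 350055 * x ^ 4 + 22566 * x ^ 2 - 29)
      + 8 * (s * D) * x ^ 8 * (679 * x ^ 8 - 8384 * x ^ 6 + 17226 * x ^ 4 - 7168 * x ^ 2 + 431))
      = D ^ 7 * (2 * c ^ 7 * x * (379 * x ^ 4 - 2365 * x ^ 2 + 318) * (x ^ 2 + 1) ^ 6
      - 4 * c ^ 6 * s * (802 * x ^ 4 - 723 * x ^ 2 + 6) * (x ^ 2 + 1) ^ 6
      + q * (- c ^ 5 * x * (2139 * x ^ 16 + 6650 * x ^ 14 - 352255 * x ^ 12 + 1102732 * x ^ 10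
          - 2195479 * x ^ 8 + 1221754 * x ^ 6 - 255889 * x ^ 4 + 28256 * x ^ 2 - 84)
      + 4 * c ^ 4 * s * x ^ 2 * (2944 * x ^ 14 - 12111 * x ^ 12 + 171062 * x ^ 10
          - 479729 * x ^ 8 + 418084 * x ^ 6 - 187793 * x ^ 4 + 18502 * x ^ 2 - 15))
      + q ^ 2 * (2 * c ^ 3 * x ^ 3 * (1002 * x ^ 14 + 6707 * x ^ 12 - 318554 * x ^ 10 + 955395 * x ^ 8
          - 1211026 * x ^ 6 + 568777 * x ^ 4 - 46366 * x ^ 2 - 31)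
      - 16 * c ^ 2 * s * x ^ 4 * (875 * x ^ 12 - 8242 * x ^ 10 + 48471 * x ^ 8
          - 110732 * x ^ 6 + 54721 * x ^ 4 - 3906 * x ^ 2 - 3))
      + q ^ 3 * (- c * x ^ 5 * (623 * x ^ 12 + 6582 * x ^ 10 - 301803 * x ^ 8 + 762660 * x ^ 6
          - 350055 * x ^ 4 + 22566 * x ^ 2 - 29)
      + 8 * s * x ^ 8 * (679 * x ^ 8 - 8384 * x ^ 6 + 17226 * x ^ 4 - 7168 * x ^ 2 + 431))) := by
  have g5 : D ^ 5 = D ^ 7 * q ^ 1 := by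
    linear_combination D ^ 4 * q ^ 0 * d1
  have g3 : D ^ 3 = D ^ 7 * q ^ 2 := by
    linear_combination D ^ 2 * q ^ 0 * d1 + D ^ 4 * q ^ 1 * d1
  have g1 : D ^ 1 = D ^ 7 * q ^ 3 := by
    linear_combination D ^ 0 * q ^ 0 * d1 + D ^ 2 * q ^ 1 * d1 + D ^ 4 * q ^ 2 * d1
  linear_combination (- c ^ 5 * x * (2139 * x ^ 16 + 6650 * x ^ 14 - 352255 * x ^ 12 + 1102732 * x ^ 10
          - 2195479 * x ^ 8 + 1221754 * x ^ 6 - 255889 * x ^ 4 + 28256 * x ^ 2 - 84)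
      + 4 * c ^ 4 * s * x ^ 2 * (2944 * x ^ 14 - 12111 * x ^ 12 + 171062 * x ^ 10
          - 479729 * x ^ 8 + 418084 * x ^ 6 - 187793 * x ^ 4 + 18502 * x ^ 2 - 15)) * g5 + (2 * c ^ 3 * x ^ 3 * (1002 * x ^ 14 + 6707 * x ^ 12 - 318554 * x ^ 10 + 955395 * x ^ 8
          - 1211026 * x ^ 6 + 568777 * x ^ 4 - 46366 * x ^ 2 - 31)
      - 16 * c ^ 2 * s * x ^ 4 * (875 * x ^ 12 - 8242 * x ^ 10 + 48471 * x ^ 8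
          - 110732 * x ^ 6 + 54721 * x ^ 4 - 3906 * x ^ 2 - 3)) * g3 + (- c * x ^ 5 * (623 * x ^ 12 + 6582 * x ^ 10 - 301803 * x ^ 8 + 762660 * x ^ 6
          - 350055 * x ^ 4 + 22566 * x ^ 2 - 29)
      + 8 * s * x ^ 8 * (679 * x ^ 8 - 8384 * x ^ 6 + 17226 * x ^ 4 - 7168 * x ^ 2 + 431)) * g1

theorem qTilde5_homogeneous (hD : D ≠ 0) (hsc : s * x - c = 1)
    (h : D ^ 2 * (c ^ 2 + s ^ 2) = 1) : qTilde5 x (c * D) (s * D)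
      = -(x ^ 2 / (24 * (x ^ 2 + 1) ^ 8)) *
      (2 * c ^ 7 * x * (379 * x ^ 4 - 2365 * x ^ 2 + 318) * (x ^ 2 + 1) ^ 6
      - 4 * c ^ 6 * s * (802 * x ^ 4 - 723 * x ^ 2 + 6) * (x ^ 2 + 1) ^ 6
      + (c ^ 2 + s ^ 2) * (- c ^ 5 * x * (2139 * x ^ 16 + 6650 * x ^ 14 - 352255 * x ^ 12 + 1102732 * x ^ 10
          - 2195479 * x ^ 8 + 1221754 * x ^ 6 - 255889 * x ^ 4 + 28256 * x ^ 2 - 84)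
      + 4 * c ^ 4 * s * x ^ 2 * (2944 * x ^ 14 - 12111 * x ^ 12 + 171062 * x ^ 10
          - 479729 * x ^ 8 + 418084 * x ^ 6 - 187793 * x ^ 4 + 18502 * x ^ 2 - 15))
      + (c ^ 2 + s ^ 2) ^ 2 * (2 * c ^ 3 * x ^ 3 * (1002 * x ^ 14 + 6707 * x ^ 12 - 318554 * x ^ 10 + 955395 * x ^ 8
          - 1211026 * x ^ 6 + 568777 * x ^ 4 - 46366 * x ^ 2 - 31)
      - 16 * c ^ 2 * s * x ^ 4 * (875 * x ^ 12 - 8242 * x ^ 10 + 48471 * x ^ 8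
          - 110732 * x ^ 6 + 54721 * x ^ 4 - 3906 * x ^ 2 - 3))
      + (c ^ 2 + s ^ 2) ^ 3 * (- c * x ^ 5 * (623 * x ^ 12 + 6582 * x ^ 10 - 301803 * x ^ 8 + 762660 * x ^ 6
          - 350055 * x ^ 4 + 22566 * x ^ 2 - 29)
      + 8 * s * x ^ 8 * (679 * x ^ 8 - 8384 * x ^ 6 + 17226 * x ^ 4 - 7168 * x ^ 2 + 431))) := by
  have hD1 : s * D * x - c * D = D := by linear_combination D * hsc
  have e := qTilde5_numerator (x := x) (c := c) (s := s) (c ^ 2 + s ^ 2)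
    (show D = D ^ 3 * (c ^ 2 + s ^ 2) by linear_combination -D * h)
  rw [qTilde5, hD1, neg_mul, neg_mul, neg_inj]
  refine scale_div_aux hD x _ _ 7 (Eq.trans ?_ e)
  ring


/-- On the circle `C² + S² = 1` the correction coefficients are the given rational functions. -/
theorem correctionCoeff_eq_qTilde {x C S : ℝ} (hx : 0 < x) (hD : S * x - C ≠ 0)
    (h : C ^ 2 + S ^ 2 = 1) :
    x / (1 + x ^ 2) * MvPolynomial.eval (zeroParam x C S) (correctionCoeff 1) = qTilde2 x C S ∧
    x / (1 + x ^ 2) * MvPolynomial.eval (zeroParam x C S) (correctionCoeff 2) = qTilde3 x C S ∧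
    x / (1 + x ^ 2) * MvPolynomial.eval (zeroParam x C S) (correctionCoeff 3) = qTilde4 x C S ∧
    x / (1 + x ^ 2) * MvPolynomial.eval (zeroParam x C S) (correctionCoeff 4) = qTilde5 x C S := by
  obtain ⟨D, hDdef⟩ : ∃ D, D = S * x - C := ⟨_, rfl⟩
  obtain ⟨s, hs⟩ : ∃ s, s = S / D := ⟨_, rfl⟩
  rw [← hDdef] at hD
  have hS : S = s * D := by rw [hs]; field_simp
  have hC : C = (s * x - 1) * D := by
    have : (s * x - 1) * D = S * x - D := by rw [hS]; ring
    rw [this, hDdef]; ring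
  obtain ⟨n, hn⟩ : ∃ n, n = 1 + x ^ 2 := ⟨_, rfl⟩
  have hn0 : n ≠ 0 := by rw [hn]; positivity
  obtain ⟨z1, z2, z3, z4, k1, k2, k3, k4, e1, e2, e3, e4⟩ :=
    eval_correctionCoeff_explicit x (s := s) (p := zeroParam x C S) hn rfl rfl
      (by change C * x / (S * x - C) = _; rw [← hDdef, hC]; field_simp)
      (by change S * x / (S * x - C) = _; rw [← hDdef, hS]; field_simp)
  have hsc : s * x - (s * x - 1) = 1 := by ring
  -- The only place where the circle relation enters: off the circle the two expressions are
  -- different rational functions.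
  have hc : D ^ 2 * ((s * x - 1) ^ 2 + s ^ 2) = 1 := by
    rw [hC, hS] at h
    linear_combination h
  have t2 := qTilde2_homogeneous hD hsc
  have t3 := qTilde3_homogeneous hD hsc hc
  have t4 := qTilde4_homogeneous hD hsc hc
  have t5 := qTilde5_homogeneous hD hsc hc
  rw [k1, k2, k3, k4, hS, hC, t2, t3, t4, t5, add_comm (x ^ 2) 1, ← hn]
  clear k1 k2 k3 k4 t2 t3 t4 t5
  have f3 : z2 = x * ((s * x - 1) ^ 3 * x * (5 * x ^ 2 - 9) * n ^ 2
      - 2 * (s * x - 1) ^ 2 * s * (6 * x ^ 2 - 1) * n ^ 2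
      + ((s * x - 1) ^ 2 + s ^ 2) * (- (s * x - 1) * x * (5 * x ^ 6 + 9 * x ^ 4 - 49 * x ^ 2 + 3)
      + 8 * s * x ^ 4 * (2 * x ^ 2 - 3))) := by
    simp only [e1, e2, hn]; ring
  have f4 : z3 = -x * ((s * x - 1) ^ 5 * x * (151 * x ^ 2 - 69) * n ^ 4
      + (s * x - 1) ^ 4 * s * (47 * x ^ 4 - 167 * x ^ 2 + 6) * n ^ 4
      + ((s * x - 1) ^ 2 + s ^ 2) * (- (s * x - 1) ^ 3 * x * (284 * x ^ 10 + 2445 * x ^ 8 - 4962 * x ^ 6 + 3124 * x ^ 4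
          - 1258 * x ^ 2 + 15)
      - (s * x - 1) ^ 2 * s * x ^ 2 * (79 * x ^ 10 - 711 * x ^ 8 + 2252 * x ^ 6 - 6460 * x ^ 4
          + 2013 * x ^ 2 - 5))
      + ((s * x - 1) ^ 2 + s ^ 2) ^ 2 * ((s * x - 1) * x ^ 3 * (133 * x ^ 8 + 1862 * x ^ 6 - 5076 * x ^ 4 + 1202 * x ^ 2 + 7)
      + 4 * s * x ^ 6 * (8 * x ^ 6 - 183 * x ^ 4 + 336 * x ^ 2 - 65))) := by
    simp only [e1, e2, e3, hn]; ring
  have f5 : z4 = -x * (2 * (s * x - 1) ^ 7 * x * (379 * x ^ 4 - 2365 * x ^ 2 + 318) * n ^ 6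
      - 4 * (s * x - 1) ^ 6 * s * (802 * x ^ 4 - 723 * x ^ 2 + 6) * n ^ 6
      + ((s * x - 1) ^ 2 + s ^ 2) * (- (s * x - 1) ^ 5 * x * (2139 * x ^ 16 + 6650 * x ^ 14 - 352255 * x ^ 12 + 1102732 * x ^ 10
          - 2195479 * x ^ 8 + 1221754 * x ^ 6 - 255889 * x ^ 4 + 28256 * x ^ 2 - 84)
      + 4 * (s * x - 1) ^ 4 * s * x ^ 2 * (2944 * x ^ 14 - 12111 * x ^ 12 + 171062 * x ^ 10
          - 479729 * x ^ 8 + 418084 * x ^ 6 - 187793 * x ^ 4 + 18502 * x ^ 2 - 15))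
      + ((s * x - 1) ^ 2 + s ^ 2) ^ 2 * (2 * (s * x - 1) ^ 3 * x ^ 3 * (1002 * x ^ 14 + 6707 * x ^ 12 - 318554 * x ^ 10 + 955395 * x ^ 8
          - 1211026 * x ^ 6 + 568777 * x ^ 4 - 46366 * x ^ 2 - 31)
      - 16 * (s * x - 1) ^ 2 * s * x ^ 4 * (875 * x ^ 12 - 8242 * x ^ 10 + 48471 * x ^ 8
          - 110732 * x ^ 6 + 54721 * x ^ 4 - 3906 * x ^ 2 - 3))
      + ((s * x - 1) ^ 2 + s ^ 2) ^ 3 * (- (s * x - 1) * x ^ 5 * (623 * x ^ 12 + 6582 * x ^ 10 - 301803 * x ^ 8 + 762660 * x ^ 6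
          - 350055 * x ^ 4 + 22566 * x ^ 2 - 29)
      + 8 * s * x ^ 8 * (679 * x ^ 8 - 8384 * x ^ 6 + 17226 * x ^ 4 - 7168 * x ^ 2 + 431))) := by
    simp only [e1, e2, e3, e4, hn]; ring
  refine ⟨?_, ?_, ?_, ?_⟩
  · rw [e1]; field_simp; ring
  · rw [f3]; field_simp
  · rw [f4]; field_simp
  · rw [f5]; field_simp

end ExplicitTilde

/-! ### Rationality of the coefficients and the location of their poles. -/

section RationalCoefficients

namespace IsRationalCoeff

variable {f g : ℝ → ℝ → ℝ → ℝ}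

theorem const (r : ℝ) : IsRationalCoeff fun _ _ _ => r :=
  ⟨MvPolynomial.C r, 0, fun x C S _ _ => by simp⟩

theorem x_coord : IsRationalCoeff fun x _ _ => x :=
  ⟨MvPolynomial.X 0, 0, fun x C S _ _ => by simp⟩

theorem c_coord : IsRationalCoeff fun _ C _ => C :=
  ⟨MvPolynomial.X 1, 0, fun x C S _ _ => by simp⟩

theorem s_coord : IsRationalCoeff fun _ _ S => S :=
  ⟨MvPolynomial.X 2, 0, fun x C S _ _ => by simp⟩

theorem add (hf : IsRationalCoeff f) (hg : IsRationalCoeff g) :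
    IsRationalCoeff fun x C S => f x C S + g x C S := by
  obtain ⟨P, n, hP⟩ := hf
  obtain ⟨Q, m, hQ⟩ := hg
  let W : MvPolynomial (Fin 3) ℝ := MvPolynomial.X 0 * (MvPolynomial.X 0 ^ 2 + 1)
    * (MvPolynomial.X 2 * MvPolynomial.X 0 - MvPolynomial.X 1)
  refine ⟨P * W ^ m + Q * W ^ n, n + m, fun x C S hx hD => ?_⟩
  have hW : MvPolynomial.eval ![x, C, S] W = x * (x ^ 2 + 1) * (S * x - C) := by simp [W]
  have hW0 : x * (x ^ 2 + 1) * (S * x - C) ≠ 0 := by positivity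
  beta_reduce
  rw [hP x C S hx hD, hQ x C S hx hD, map_add, map_mul, map_mul, map_pow, map_pow, hW,
    div_add_div _ _ (pow_ne_zero _ hW0) (pow_ne_zero _ hW0), pow_add]
  ring

theorem mul (hf : IsRationalCoeff f) (hg : IsRationalCoeff g) :
    IsRationalCoeff fun x C S => f x C S * g x C S := by
  obtain ⟨P, n, hP⟩ := hf
  obtain ⟨Q, m, hQ⟩ := hg
  refine ⟨P * Q, n + m, fun x C S hx hD => ?_⟩
  beta_reduce
  rw [hP x C S hx hD, hQ x C S hx hD, map_mul, div_mul_div_comm, pow_add]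

theorem neg (hf : IsRationalCoeff f) : IsRationalCoeff fun x C S => -f x C S := by
  simpa using (const (-1)).mul hf

theorem sub (hf : IsRationalCoeff f) (hg : IsRationalCoeff g) :
    IsRationalCoeff fun x C S => f x C S - g x C S := by
  simpa [sub_eq_add_neg] using hf.add hg.neg

theorem pow (hf : IsRationalCoeff f) (n : ℕ) : IsRationalCoeff fun x C S => f x C S ^ n := by
  induction n with
  | zero => simpa using const 1
  | succ n ih => simpa [pow_succ] using ih.mul hf

theorem inv_sq_add_one : IsRationalCoeff fun x _ _ => (x ^ 2 + 1)⁻¹ := by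
  refine ⟨MvPolynomial.X 0 * (MvPolynomial.X 2 * MvPolynomial.X 0 - MvPolynomial.X 1), 1,
    fun x C S hx hD => ?_⟩
  obtain ⟨D, hDdef⟩ : ∃ D, D = S * x - C := ⟨_, rfl⟩
  rw [← hDdef] at hD
  simp [← hDdef]
  field_simp

theorem inv_sub : IsRationalCoeff fun x C S => (S * x - C)⁻¹ := by
  refine ⟨MvPolynomial.X 0 * (MvPolynomial.X 0 ^ 2 + 1), 1, fun x C S hx hD => ?_⟩
  simp
  field_simp

/-- The four parameters are themselves rational with poles only at the admitted places. -/
theorem eval_param (P : ParamRing) :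
    IsRationalCoeff fun x C S => MvPolynomial.eval (zeroParam x C S) P := by
  induction P using MvPolynomial.induction_on with
  | C a => simpa using const a
  | add p q hp hq => simpa using hp.add hq
  | mul_X p i hp =>
    simp only [map_mul, MvPolynomial.eval_X]
    refine hp.mul ?_
    fin_cases i
    · convert inv_sq_add_one using 4
      simp [zeroParam, add_comm]
    · convert x_coord.mul inv_sq_add_one using 4
      simp [zeroParam, add_comm, div_eq_mul_inv]
    · exact (c_coord.mul x_coord).mul inv_sub
    · exact (s_coord.mul x_coord).mul inv_sub

theorem qTilde_aux {N : ℝ → ℝ → ℝ → ℝ} (hN : IsRationalCoeff N) (a : ℝ) (n m : ℕ) :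
    IsRationalCoeff fun x C S => x ^ 2 / (a * (x ^ 2 + 1) ^ n * (S * x - C) ^ m) * N x C S := by
  have h := ((((const a⁻¹).mul (x_coord.pow 2)).mul (inv_sq_add_one.pow n)).mul (inv_sub.pow m)).mul hN
  convert h using 4
  rw [div_eq_mul_inv, mul_inv, mul_inv, inv_pow, inv_pow]
  ring

end IsRationalCoeff

open IsRationalCoeff in
theorem isRationalCoeff_qTilde2 : IsRationalCoeff qTilde2 := by
  have h : IsRationalCoeff fun x C S => (S * x ^ 2 + 2 * C * x - S) := by
    repeat' first
      | exact const _ | exact x_coord | exact c_coord | exact s_coord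
      | apply IsRationalCoeff.pow | apply IsRationalCoeff.sub | apply IsRationalCoeff.add
      | apply IsRationalCoeff.mul
  have h' := qTilde_aux h 1 2 1
  simp only [one_mul, pow_one] at h'
  convert h' using 4
  simp only [qTilde2]
  ring

open IsRationalCoeff in
theorem isRationalCoeff_qTilde3 : IsRationalCoeff qTilde3 := by
  refine qTilde_aux ?_ 2 4 3
  repeat' first
    | exact const _ | exact x_coord | exact c_coord | exact s_coord
    | apply IsRationalCoeff.pow | apply IsRationalCoeff.sub | apply IsRationalCoeff.add
    | apply IsRationalCoeff.mul

open IsRationalCoeff in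
theorem isRationalCoeff_qTilde4 : IsRationalCoeff qTilde4 := by
  unfold qTilde4
  simp only [neg_mul]
  refine IsRationalCoeff.neg (qTilde_aux ?_ 6 6 5)
  repeat' first
    | exact const _ | exact x_coord | exact c_coord | exact s_coord
    | apply IsRationalCoeff.pow | apply IsRationalCoeff.sub | apply IsRationalCoeff.add
    | apply IsRationalCoeff.mul

open IsRationalCoeff in
theorem isRationalCoeff_qTilde5 : IsRationalCoeff qTilde5 := by
  unfold qTilde5
  simp only [neg_mul]
  refine IsRationalCoeff.neg (qTilde_aux ?_ 24 8 7)
  repeat' first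
    | exact const _ | exact x_coord | exact c_coord | exact s_coord
    | apply IsRationalCoeff.pow | apply IsRationalCoeff.sub | apply IsRationalCoeff.add
    | apply IsRationalCoeff.mul

/-- The coefficient functions of the expansion. -/
noncomputable def expansionCoeff : ℕ → ℝ → ℝ → ℝ → ℝ
  | 2 => qTilde2
  | 3 => qTilde3
  | 4 => qTilde4
  | 5 => qTilde5
  | k => fun x C S => x / (1 + x ^ 2) * MvPolynomial.eval (zeroParam x C S) (correctionCoeff (k - 1))

theorem isRationalCoeff_expansionCoeff (k : ℕ) : IsRationalCoeff (expansionCoeff k) := by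
  unfold expansionCoeff
  split
  · exact isRationalCoeff_qTilde2
  · exact isRationalCoeff_qTilde3
  · exact isRationalCoeff_qTilde4
  · exact isRationalCoeff_qTilde5
  · have h := (IsRationalCoeff.x_coord.mul IsRationalCoeff.inv_sq_add_one).mul
      (IsRationalCoeff.eval_param (correctionCoeff (k - 1)))
    convert h using 4
    rw [div_eq_mul_inv, add_comm]

/-- The first four coefficients are prescribed as explicit functions and agree with those of the
formal inversion only on the circle, which suffices because (C, S) is always a cosine and sine pair.
-/
theorem expansionCoeff_eq {x C S : ℝ} (hx : 0 < x) (hD : S * x - C ≠ 0) (h : C ^ 2 + S ^ 2 = 1)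
    (k : ℕ) : expansionCoeff k x C S
      = x / (1 + x ^ 2) * MvPolynomial.eval (zeroParam x C S) (correctionCoeff (k - 1)) := by
  obtain ⟨h2, h3, h4, h5⟩ := correctionCoeff_eq_qTilde hx hD h
  unfold expansionCoeff
  split
  · exact h2.symm
  · exact h3.symm
  · exact h4.symm
  · exact h5.symm
  · rfl

end RationalCoefficients

/-! ### Taylor bounds for the rescaled integrand, uniform in ρ, ω and a. -/

section TaylorBounds

/-- Mean value inequality on the segment from 0 to τ; the gain of a factor 1/(n+1) from integration
is not needed. -/
theorem abs_le_of_abs_deriv_le {f f' : ℝ → ℝ} {K τ : ℝ} {n : ℕ} (h0 : f 0 = 0)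
    (hd : ∀ t ∈ Set.uIcc 0 τ, HasDerivAt f (f' t) t) (hK : ∀ t ∈ Set.uIcc 0 τ, |f' t| ≤ K * |t| ^ n)
    (hK0 : 0 ≤ K) : |f τ| ≤ K * |τ| ^ (n + 1) := by
  have h := Convex.norm_image_sub_le_of_norm_hasDerivWithin_le (f := f) (f' := f')
    (s := Set.uIcc 0 τ) (C := K * |τ| ^ n) (x := 0) (y := τ)
    (fun t ht => (hd t ht).hasDerivWithinAt) (fun t ht => ?_) (convex_uIcc _ _)
    Set.left_mem_uIcc Set.right_mem_uIcc
  · rw [h0, sub_zero, sub_zero, Real.norm_eq_abs, Real.norm_eq_abs] at h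
    rw [pow_succ, ← mul_assoc]
    exact h
  · rw [Real.norm_eq_abs]
    refine (hK t ht).trans (mul_le_mul_of_nonneg_left (pow_le_pow_left₀ (abs_nonneg _) ?_ _) hK0)
    have := Set.abs_sub_left_of_mem_uIcc ht
    simpa using this

theorem hasDerivAt_sum_range_succ_pow (c : ℕ → ℝ) (n : ℕ) (t : ℝ) :
    HasDerivAt (fun τ => ∑ i ∈ Finset.range (n + 1), c i * τ ^ i)
      (∑ i ∈ Finset.range n, ((i : ℝ) + 1) * c (i + 1) * t ^ i) t := by
  have h : HasDerivAt (fun τ => ∑ i ∈ Finset.range (n + 1), c i * τ ^ i)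
      (∑ i ∈ Finset.range (n + 1), c i * ((i : ℝ) * t ^ (i - 1))) t :=
    HasDerivAt.fun_sum fun i _ => (hasDerivAt_pow i t).const_mul (c i)
  convert h using 1
  rw [Finset.sum_range_succ']
  simp only [Nat.cast_zero, zero_mul, mul_zero, add_zero, Nat.add_sub_cancel]
  exact Finset.sum_congr rfl fun i _ => by push_cast; ring

/-- `(1+ρτ/a)^(a-1-k) cos ωτ`. -/
noncomputable def cosKernel (ρ ω a : ℝ) (k : ℕ) (τ : ℝ) : ℝ :=
  (1 + ρ * a⁻¹ * τ) ^ (a - 1 - k) * Real.cos (ω * τ)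

/-- `(1+ρτ/a)^(a-1-k) sin(ωτ)/ω`. -/
noncomputable def sinKernel (ρ ω a : ℝ) (k : ℕ) (τ : ℝ) : ℝ :=
  (1 + ρ * a⁻¹ * τ) ^ (a - 1 - k) * (Real.sin (ω * τ) / ω)

variable {ρ ω a τ : ℝ} {k : ℕ}

theorem kernel_base_pos (hρ0 : 0 < ρ) (hρ : ρ ≤ 1) (ha : 1 ≤ a) (hτ : |τ| ≤ 1 / 2) :
    0 < 1 + ρ * a⁻¹ * τ ∧ 1 + ρ * a⁻¹ * τ ≤ 1 + a⁻¹ * (1 / 2) := by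
  have h1 : 0 < a⁻¹ := by positivity
  have h2 : a⁻¹ ≤ 1 := inv_le_one_of_one_le₀ ha
  have h3 : |ρ * a⁻¹ * τ| ≤ a⁻¹ * (1 / 2) := by
    rw [abs_mul, abs_of_pos (by positivity)]
    refine mul_le_mul ?_ hτ (abs_nonneg _) h1.le
    nlinarith
  have h4 := abs_le.1 h3
  constructor <;> linarith [h4.1, h4.2]

/-- The exponent a - 1 - k is nonnegative and at most a, so the power is at most (1 + 1/(2a))^a ≤
e^{1/2} ≤ 2. -/
theorem kernel_rpow_le (hρ0 : 0 < ρ) (hρ : ρ ≤ 1) (ha : (k : ℝ) + 1 ≤ a) (hτ : |τ| ≤ 1 / 2) :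
    |(1 + ρ * a⁻¹ * τ) ^ (a - 1 - k)| ≤ 2 := by
  have hk : (0 : ℝ) ≤ k := k.cast_nonneg
  have ha1 : 1 ≤ a := by linarith
  have ha0 : 0 < a := by linarith
  obtain ⟨h1, h2⟩ := kernel_base_pos hρ0 hρ ha1 hτ
  rw [abs_of_nonneg (Real.rpow_nonneg h1.le _)]
  calc (1 + ρ * a⁻¹ * τ) ^ (a - 1 - k) ≤ (1 + a⁻¹ * (1 / 2)) ^ (a - 1 - k) :=
        Real.rpow_le_rpow h1.le h2 (by linarith)
    _ ≤ (1 + a⁻¹ * (1 / 2)) ^ a :=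
        Real.rpow_le_rpow_of_exponent_le (by have : 0 < a⁻¹ := by positivity
                                             linarith) (by linarith)
    _ ≤ (Real.exp (a⁻¹ * (1 / 2))) ^ a := by
        refine Real.rpow_le_rpow (by positivity) ?_ ha0.le
        linarith [Real.add_one_le_exp (a⁻¹ * (1 / 2))]
    _ = Real.exp (1 / 2) := by
        rw [← Real.exp_mul]; congr 1; field_simp
    _ ≤ 2 := by
        have h := Real.exp_one_lt_d9
        have h' : Real.exp (1 / 2) * Real.exp (1 / 2) = Real.exp 1 := by
          rw [← Real.exp_add]; norm_num
        nlinarith [Real.exp_pos (1 / 2)]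

theorem abs_sin_mul_div_le (hω : 0 < ω) (τ : ℝ) : |Real.sin (ω * τ) / ω| ≤ |τ| := by
  rw [abs_div, abs_of_pos hω, div_le_iff₀ hω]
  calc |Real.sin (ω * τ)| ≤ |ω * τ| := Real.abs_sin_le_abs
    _ = |τ| * ω := by rw [abs_mul, abs_of_pos hω, mul_comm]

theorem hasDerivAt_kernel_rpow (ha : 0 < a) (h : 0 < 1 + ρ * a⁻¹ * τ) :
    HasDerivAt (fun t => (1 + ρ * a⁻¹ * t) ^ (a - 1 - k))
      (ρ * (1 - (k + 1) * a⁻¹) * (1 + ρ * a⁻¹ * τ) ^ (a - 1 - (k + 1 : ℕ))) τ := by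
  have h1 : HasDerivAt (fun t => 1 + ρ * a⁻¹ * t) (ρ * a⁻¹) τ := by
    simpa using ((hasDerivAt_id τ).const_mul (ρ * a⁻¹)).const_add 1
  convert h1.rpow_const (p := a - 1 - k) (Or.inl h.ne') using 1
  have e : a - 1 - ((k + 1 : ℕ) : ℝ) = a - 1 - k - 1 := by push_cast; ring
  rw [e]
  field_simp
  ring

theorem hasDerivAt_cosKernel (ha : 0 < a) (h : 0 < 1 + ρ * a⁻¹ * τ) :
    HasDerivAt (cosKernel ρ ω a k) (ρ * (1 - (k + 1) * a⁻¹) * cosKernel ρ ω a (k + 1) τ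
      - ω ^ 2 * sinKernel ρ ω a k τ) τ := by
  have h1 : HasDerivAt (fun t => ω * t) ω τ := by simpa using (hasDerivAt_id τ).const_mul ω
  refine HasDerivAt.congr_deriv (f := cosKernel ρ ω a k)
    ((hasDerivAt_kernel_rpow (k := k) ha h).mul h1.cos) ?_
  simp only [cosKernel, sinKernel]
  field_simp
  ring

theorem hasDerivAt_sinKernel (hω : ω ≠ 0) (ha : 0 < a) (h : 0 < 1 + ρ * a⁻¹ * τ) :
    HasDerivAt (sinKernel ρ ω a k) (ρ * (1 - (k + 1) * a⁻¹) * sinKernel ρ ω a (k + 1) τ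
      + cosKernel ρ ω a k τ) τ := by
  have h1 : HasDerivAt (fun t => ω * t) ω τ := by simpa using (hasDerivAt_id τ).const_mul ω
  refine HasDerivAt.congr_deriv (f := sinKernel ρ ω a k)
    ((hasDerivAt_kernel_rpow (k := k) ha h).mul (h1.sin.div_const ω)) ?_
  simp only [cosKernel, sinKernel]
  field_simp

theorem paramEval_taylorPair_succ (p : Fin 4 → ℝ) (ε : ℝ) (k i : ℕ) :
    ((i : ℝ) + 1) * paramEval p ε (taylorPair k (i + 1)).1
        = p 0 * (1 - (k + 1) * ε) * paramEval p ε (taylorPair (k + 1) i).1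
          - p 1 ^ 2 * paramEval p ε (taylorPair k i).2 ∧
    ((i : ℝ) + 1) * paramEval p ε (taylorPair k (i + 1)).2
        = p 0 * (1 - (k + 1) * ε) * paramEval p ε (taylorPair (k + 1) i).2
          + paramEval p ε (taylorPair k i).1 := by
  have hi : (i : ℝ) + 1 ≠ 0 := by positivity
  constructor
  · simp [taylorPair, rateCoeff]
    field_simp
  · simp [taylorPair, rateCoeff]
    field_simp

/-- Induction on the order, for all k at once: differentiation maps the two kernels to combinations
of kernels with index k or k + 1 and coefficients at most 1 in size, and the recursion for
`taylorPair` is the same rule. Two error terms per step double the constant. Dividing the sine by ω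
keeps everything bounded as ω → 0. -/
theorem kernel_taylor_bound {p : Fin 4 → ℝ} (h0 : p 0 = ρ) (h1 : p 1 = ω) (hρ0 : 0 < ρ) (hρ : ρ ≤ 1)
    (hω0 : 0 < ω) (hω : ω ≤ 1) (n : ℕ) : ∀ (k : ℕ) (τ : ℝ), (n : ℝ) + k + 1 ≤ a → |τ| ≤ 1 / 2 →
    |cosKernel ρ ω a k τ - ∑ i ∈ Finset.range n, paramEval p a⁻¹ (taylorPair k i).1 * τ ^ i|
      ≤ 2 * 2 ^ n * |τ| ^ n ∧
    |sinKernel ρ ω a k τ - ∑ i ∈ Finset.range n, paramEval p a⁻¹ (taylorPair k i).2 * τ ^ i|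
      ≤ 2 * 2 ^ n * |τ| ^ n := by
  induction n with
  | zero =>
    intro k τ ha hτ
    have hr := kernel_rpow_le (τ := τ) (k := k) hρ0 hρ (by simpa using ha) hτ
    simp only [Finset.range_zero, Finset.sum_empty, sub_zero, pow_zero, mul_one]
    constructor
    · rw [cosKernel, abs_mul]
      nlinarith [Real.abs_cos_le_one (ω * τ), abs_nonneg (Real.cos (ω * τ))]
    · rw [sinKernel, abs_mul]
      nlinarith [abs_sin_mul_div_le hω0 τ, abs_nonneg (Real.sin (ω * τ) / ω)]
  | succ n ih =>
    intro k τ ha hτ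
    push_cast at ha
    have hn0 : (0 : ℝ) ≤ n := n.cast_nonneg
    have hk0 : (0 : ℝ) ≤ k := k.cast_nonneg
    have ha0 : 0 < a := by linarith
    have hseg : ∀ t ∈ Set.uIcc 0 τ, |t| ≤ 1 / 2 := by
      intro t ht
      have := Set.abs_sub_left_of_mem_uIcc ht
      simp only [sub_zero] at this
      exact this.trans hτ
    have hb : ∀ t ∈ Set.uIcc 0 τ, 0 < 1 + ρ * a⁻¹ * t := fun t ht =>
      (kernel_base_pos hρ0 hρ (by linarith) (hseg t ht)).1
    have hck : |ρ * (1 - (k + 1) * a⁻¹)| ≤ 1 := by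
      have e : (k + 1) * a⁻¹ ≤ 1 := by
        rw [← div_eq_mul_inv, div_le_one ha0]; linarith
      have e' : 0 ≤ (k + 1) * a⁻¹ := by positivity
      rw [abs_of_nonneg (mul_nonneg hρ0.le (by linarith))]
      nlinarith
    have hω2 : |ω ^ 2| ≤ 1 := by
      rw [abs_of_nonneg (by positivity)]; nlinarith
    have hsum0 : ∀ c : ℕ → ℝ, ∑ i ∈ Finset.range (n + 1), c i * (0 : ℝ) ^ i = c 0 := by
      intro c
      rw [Finset.sum_range_succ']
      simp
    constructor
    · have hd : ∀ t ∈ Set.uIcc 0 τ, HasDerivAt (fun t => cosKernel ρ ω a k t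
          - ∑ i ∈ Finset.range (n + 1), paramEval p a⁻¹ (taylorPair k i).1 * t ^ i)
          (ρ * (1 - (k + 1) * a⁻¹) * (cosKernel ρ ω a (k + 1) t
            - ∑ i ∈ Finset.range n, paramEval p a⁻¹ (taylorPair (k + 1) i).1 * t ^ i)
          - ω ^ 2 * (sinKernel ρ ω a k t
            - ∑ i ∈ Finset.range n, paramEval p a⁻¹ (taylorPair k i).2 * t ^ i)) t := by
        intro t ht
        refine ((hasDerivAt_cosKernel (k := k) ha0 (hb t ht)).sub
          (hasDerivAt_sum_range_succ_pow _ n t)).congr_deriv ?_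
        simp only [fun i => (paramEval_taylorPair_succ p a⁻¹ k i).1, sub_mul, Finset.sum_sub_distrib, mul_sub,
          Finset.mul_sum, h0, h1, mul_assoc]
        ring
      have := abs_le_of_abs_deriv_le (n := n) (K := 2 * 2 ^ (n + 1)) ?_ hd ?_ (by positivity)
      · exact this
      · rw [hsum0]; simp [cosKernel, taylorPair]
      · intro t ht
        have i1 := (ih (k + 1) t (by push_cast; linarith) (hseg t ht)).1
        have i2 := (ih k t (by linarith) (hseg t ht)).2
        refine (abs_sub _ _).trans ?_
        rw [abs_mul (ρ * _), abs_mul (ω ^ 2)]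
        have hpos : 0 ≤ 2 * (2 : ℝ) ^ n * |t| ^ n := by positivity
        calc _ ≤ 1 * (2 * 2 ^ n * |t| ^ n) + 1 * (2 * 2 ^ n * |t| ^ n) :=
              add_le_add (mul_le_mul hck i1 (abs_nonneg _) zero_le_one)
                (mul_le_mul hω2 i2 (abs_nonneg _) zero_le_one)
          _ = _ := by ring
    · have hd : ∀ t ∈ Set.uIcc 0 τ, HasDerivAt (fun t => sinKernel ρ ω a k t
          - ∑ i ∈ Finset.range (n + 1), paramEval p a⁻¹ (taylorPair k i).2 * t ^ i)
          (ρ * (1 - (k + 1) * a⁻¹) * (sinKernel ρ ω a (k + 1) t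
            - ∑ i ∈ Finset.range n, paramEval p a⁻¹ (taylorPair (k + 1) i).2 * t ^ i)
          + (cosKernel ρ ω a k t
            - ∑ i ∈ Finset.range n, paramEval p a⁻¹ (taylorPair k i).1 * t ^ i)) t := by
        intro t ht
        refine ((hasDerivAt_sinKernel (k := k) hω0.ne' ha0 (hb t ht)).sub
          (hasDerivAt_sum_range_succ_pow _ n t)).congr_deriv ?_
        simp only [fun i => (paramEval_taylorPair_succ p a⁻¹ k i).2, add_mul, Finset.sum_add_distrib, mul_sub,
          Finset.mul_sum, h0, mul_assoc]
        ring
      have := abs_le_of_abs_deriv_le (n := n) (K := 2 * 2 ^ (n + 1)) ?_ hd ?_ (by positivity)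
      · exact this
      · rw [hsum0]; simp [sinKernel, taylorPair]
      · intro t ht
        have i1 := (ih (k + 1) t (by push_cast; linarith) (hseg t ht)).2
        have i2 := (ih k t (by linarith) (hseg t ht)).1
        refine (abs_add_le _ _).trans ?_
        rw [abs_mul (ρ * _)]
        calc _ ≤ 1 * (2 * 2 ^ n * |t| ^ n) + (2 * 2 ^ n * |t| ^ n) :=
              add_le_add (mul_le_mul hck i1 (abs_nonneg _) zero_le_one) i2
          _ = _ := by ring

/-- Taylor bound for a primitive of `(1+ρτ/a)^(a-1) (cos ωτ + m sin(ωτ)/ω)`. -/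
theorem phase_taylor_bound {p : Fin 4 → ℝ} (h0 : p 0 = ρ) (h1 : p 1 = ω) (hρ0 : 0 < ρ) (hρ : ρ ≤ 1)
    (hω0 : 0 < ω) (hω : ω ≤ 1) {n : ℕ} (ha : (n : ℝ) + 1 ≤ a) {m : ℝ}
    (hm : MvPolynomial.eval p sineCoeff = m) {F : ℝ → ℝ} (hF0 : F 0 = 0)
    (hF : ∀ t, |t| ≤ 1 / 2 → HasDerivAt F (cosKernel ρ ω a 0 t + m * sinKernel ρ ω a 0 t) t)
    {ζ : ℝ} (hζ : |ζ| ≤ 1 / 2) :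
    |F ζ - ∑ i ∈ Finset.Icc 1 n, paramEval p a⁻¹ (phaseCoeff i) * ζ ^ i|
      ≤ (1 + |m|) * (2 * 2 ^ n) * |ζ| ^ (n + 1) := by
  have hseg : ∀ t ∈ Set.uIcc 0 ζ, |t| ≤ 1 / 2 := by
    intro t ht
    have := Set.abs_sub_left_of_mem_uIcc ht
    simp only [sub_zero] at this
    exact this.trans hζ
  have hsum : ∀ t : ℝ, ∑ i ∈ Finset.Icc 1 n, paramEval p a⁻¹ (phaseCoeff i) * t ^ i
      = ∑ i ∈ Finset.range (n + 1), paramEval p a⁻¹ (phaseCoeff i) * t ^ i := by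
    intro t
    rw [Finset.sum_range_succ', Finset.range_eq_Ico, Finset.sum_Ico_add'
      (fun i => paramEval p a⁻¹ (phaseCoeff i) * t ^ i) 0 n 1, show phaseCoeff 0 = 0 from rfl,
      map_zero, zero_mul, add_zero]
    rfl
  have hd : ∀ t ∈ Set.uIcc 0 ζ, HasDerivAt (fun t => F t
      - ∑ i ∈ Finset.Icc 1 n, paramEval p a⁻¹ (phaseCoeff i) * t ^ i)
      ((cosKernel ρ ω a 0 t - ∑ i ∈ Finset.range n, paramEval p a⁻¹ (taylorPair 0 i).1 * t ^ i)
        + m * (sinKernel ρ ω a 0 t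
          - ∑ i ∈ Finset.range n, paramEval p a⁻¹ (taylorPair 0 i).2 * t ^ i)) t := by
    intro t ht
    simp only [hsum]
    refine ((hF t (hseg t ht)).sub (hasDerivAt_sum_range_succ_pow _ n t)).congr_deriv ?_
    have e : ∀ i : ℕ, ((i : ℝ) + 1) * paramEval p a⁻¹ (phaseCoeff (i + 1)) * t ^ i
        = paramEval p a⁻¹ (taylorPair 0 i).1 * t ^ i
          + m * (paramEval p a⁻¹ (taylorPair 0 i).2 * t ^ i) := by
      intro i
      have hi : (i : ℝ) + 1 ≠ 0 := by positivity
      simp [phaseCoeff, hm]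
      field_simp
    simp only [e, Finset.sum_add_distrib, mul_sub, Finset.mul_sum]
    ring
  refine abs_le_of_abs_deriv_le ?_ hd ?_ (by positivity)
  · rw [hF0, hsum, Finset.sum_range_succ', show phaseCoeff 0 = 0 from rfl]
    simp
  · intro t ht
    obtain ⟨i1, i2⟩ := kernel_taylor_bound h0 h1 hρ0 hρ hω0 hω n 0 t (by simpa using ha) (hseg t ht)
    refine (abs_add_le _ _).trans ?_
    rw [abs_mul]
    nlinarith [abs_nonneg m, mul_le_mul_of_nonneg_left i2 (abs_nonneg m)]

end TaylorBounds

/-! ### The oscillatory integral with phase shift β. -/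

section OscillatoryIntegral

/-- `∫₀ᶻ t^(a-1) cos(t-β) dt`. -/
noncomputable def oscIntegral (a β z : ℝ) : ℝ := ∫ t in (0 : ℝ)..z, t ^ (a - 1) * Real.cos (t - β)

theorem hasDerivAt_oscIntegral {a : ℝ} (ha : 1 < a) (β z : ℝ) :
    HasDerivAt (oscIntegral a β) (z ^ (a - 1) * Real.cos (z - β)) z := by
  have hc : Continuous fun t : ℝ => t ^ (a - 1) * Real.cos (t - β) :=
    (Real.continuous_rpow_const (by linarith)).mul (by fun_prop)
  exact (hc.integral_hasStrictDerivAt 0 z).hasDerivAt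

@[simp] theorem oscIntegral_zero (a β : ℝ) : oscIntegral a β 0 = 0 := by simp [oscIntegral]

theorem continuous_oscIntegral {a : ℝ} (ha : 1 < a) (β : ℝ) : Continuous (oscIntegral a β) :=
  continuous_iff_continuousAt.2 fun z => (hasDerivAt_oscIntegral ha β z).continuousAt

end OscillatoryIntegral

/-! ### Repeated integration by parts in the variable w = 1/(1+ix). -/

section GammaExpansion

open Polynomial

/-- Coefficients of the large parameter expansion of the incomplete gamma function, as polynomials
in `w = 1/(1+ix)`. -/
noncomputable def gammaTerm : ℕ → ℂ[X]
  | 0 => 1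
  | k + 1 => X * (1 - X) * gammaPoly k

theorem gammaTerm_succ (k : ℕ) :
    gammaTerm (k + 1) = X * (1 - X) * derivative (X * gammaTerm k) := by
  cases k with
  | zero => simp [gammaTerm, gammaPoly]
  | succ k =>
    have e : (X : ℂ[X]) * gammaTerm (k + 1) = X ^ 2 * (1 - X) * gammaPoly k := by
      rw [gammaTerm]; ring
    rw [e]
    rfl

/-- Since |w| = (1+x²)^(-1/2), powers of w in the coefficients give decay for large x. -/
theorem X_pow_dvd_gammaPoly (k : ℕ) : X ^ k ∣ gammaPoly k := by
  induction k with
  | zero => simp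
  | succ k ih =>
    obtain ⟨g, hg⟩ := ih
    have e : (X : ℂ[X]) ^ 2 * (1 - X) * gammaPoly k = X ^ (k + 2) * ((1 - X) * g) := by
      rw [hg]; ring
    rw [gammaPoly, e, derivative_mul, derivative_X_pow]
    refine dvd_add ?_ ?_
    · exact Dvd.dvd.mul_right (Dvd.dvd.mul_left (pow_dvd_pow _ (by omega)) _) _
    · exact Dvd.dvd.mul_right (pow_dvd_pow _ (by omega)) _

theorem exists_norm_eval_le (P : ℂ[X]) : ∃ K : ℝ, 0 ≤ K ∧ ∀ w : ℂ, ‖w‖ ≤ 1 → ‖P.eval w‖ ≤ K := by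
  obtain ⟨K, hK⟩ := (isCompact_closedBall (0 : ℂ) 1).exists_bound_of_continuousOn
    (f := fun w => P.eval w) P.continuous.continuousOn
  exact ⟨K, (norm_nonneg _).trans (hK 0 (by simp)), fun w hw => hK w (by simpa using hw)⟩

/-- `1/(1+ix)`. -/
noncomputable def cayley (x : ℝ) : ℂ := (1 + x * Complex.I)⁻¹

theorem one_add_mul_I_ne_zero (x : ℝ) : (1 + x * Complex.I : ℂ) ≠ 0 := by
  intro h
  have := congrArg Complex.re h
  simp at this

theorem cayley_eq (x : ℝ) :
    cayley x = ((1 / (1 + x ^ 2) : ℝ) : ℂ) - ((x / (1 + x ^ 2) : ℝ) : ℂ) * Complex.I := by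
  have h := one_add_sq_ofReal_ne_zero x
  rw [cayley, inv_eq_iff_eq_inv, eq_comm, inv_eq_iff_eq_inv, ← one_div, eq_div_iff (one_add_mul_I_ne_zero x)]
  push_cast
  field_simp
  linear_combination -(x : ℂ) ^ 2 * Complex.I_sq

theorem norm_cayley_sq (x : ℝ) : ‖cayley x‖ ^ 2 = 1 / (1 + x ^ 2) := by
  rw [← Complex.normSq_eq_norm_sq, cayley, Complex.normSq_inv, Complex.normSq_apply]
  simp
  ring

theorem norm_cayley_le_one (x : ℝ) : ‖cayley x‖ ≤ 1 := by
  have h := norm_cayley_sq x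
  have h2 : 1 / (1 + x ^ 2) ≤ 1 := by
    rw [div_le_one (by positivity)]; nlinarith [sq_nonneg x]
  nlinarith [norm_nonneg (cayley x)]

theorem one_sub_cayley (x : ℝ) : 1 - cayley x = x * Complex.I * cayley x := by
  have h := one_add_mul_I_ne_zero x
  rw [cayley]
  field_simp
  ring

/-- The term w(1-w)·(multiple of w^(n+2)) contains i x w⁴, and |w|⁴ = (1+x²)^(-2). This decay is the
reason for the offset 3 in the orders below. -/
theorem exists_norm_gammaTerm_le (n : ℕ) : ∃ K : ℝ, 0 ≤ K ∧ ∀ x : ℝ, 0 ≤ x →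
    ‖(gammaTerm (n + 3)).eval (cayley x)‖ ≤ K * (x / (1 + x ^ 2) ^ 2) := by
  obtain ⟨g, hg⟩ := X_pow_dvd_gammaPoly (n + 2)
  obtain ⟨K, hK0, hK⟩ := exists_norm_eval_le (X ^ n * g)
  refine ⟨K, hK0, fun x hx => ?_⟩
  have e : (gammaTerm (n + 3)).eval (cayley x)
      = cayley x ^ 4 * (x * Complex.I) * (X ^ n * g).eval (cayley x) := by
    rw [gammaTerm, hg]
    simp only [eval_mul, eval_sub, eval_one, eval_X, eval_pow]
    rw [one_sub_cayley]
    ring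
  rw [e, norm_mul, norm_mul, norm_pow, norm_mul, Complex.norm_I, Complex.norm_real,
    Real.norm_of_nonneg hx, show ‖cayley x‖ ^ 4 = (‖cayley x‖ ^ 2) ^ 2 by ring, norm_cayley_sq]
  have := hK _ (norm_cayley_le_one x)
  calc _ ≤ (1 / (1 + x ^ 2)) ^ 2 * (x * 1) * K := by gcongr
    _ = _ := by field_simp

theorem hasDerivAt_cayley (a z : ℝ) :
    HasDerivAt (fun t : ℝ => cayley (t / a)) (-(Complex.I / a) * cayley (z / a) ^ 2) z := by
  have h1 : HasDerivAt (fun t : ℝ => (1 + ((t / a : ℝ) : ℂ) * Complex.I)) (((1 / a : ℝ) : ℂ) * Complex.I) z := by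
    exact ((((hasDerivAt_id z).div_const a).ofReal_comp).mul_const Complex.I).const_add 1
  have h2 := h1.fun_inv (one_add_mul_I_ne_zero (z / a))
  refine h2.congr_deriv ?_
  rw [cayley]
  push_cast
  field_simp

/-- The partial sums of the expansion of `∫₀ᶻ t^(a-1) e^{i(t-β)} dt`. -/
noncomputable def gammaPartial (a β : ℝ) (n : ℕ) (z : ℝ) : ℂ :=
  ((z ^ a : ℝ) : ℂ) * Complex.exp (Complex.I * (z - β)) *
    (∑ k ∈ Finset.range n, C ((a⁻¹ : ℂ) ^ (k + 1)) * (X * gammaTerm k)).eval (cayley (z / a))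

/-- For x = z/a one has (a + iz)w = a and z dw/dz = -w(1-w). Hence the k-th summand contributes
a^(-k) T_k - a^(-k-1) T_{k+1}, and the sum telescopes to 1 - a^(-n) T_n. -/
theorem hasDerivAt_gammaPartial {a : ℝ} (ha : 1 < a) (β : ℝ) (n : ℕ) {z : ℝ} (hz : 0 ≤ z) :
    HasDerivAt (gammaPartial a β n) (((z ^ (a - 1) : ℝ) : ℂ) * Complex.exp (Complex.I * (z - β)) *
      (1 - (a⁻¹ : ℂ) ^ n * (gammaTerm n).eval (cayley (z / a)))) z := by
  have ha0 : (a : ℂ) ≠ 0 := by exact_mod_cast (by linarith : a ≠ 0)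
  set Q : ℂ[X] := ∑ k ∈ Finset.range n, C ((a⁻¹ : ℂ) ^ (k + 1)) * (X * gammaTerm k) with hQ
  set W := cayley (z / a) with hW
  have h1 : HasDerivAt (fun t : ℝ => ((t ^ a : ℝ) : ℂ)) ((a * z ^ (a - 1) : ℝ) : ℂ) z :=
    (Real.hasDerivAt_rpow_const (Or.inr ha.le)).ofReal_comp
  have h2 : HasDerivAt (fun t : ℝ => Complex.exp (Complex.I * (t - β)))
      (Complex.exp (Complex.I * (z - β)) * (Complex.I * 1)) z :=
    (((hasDerivAt_id z).ofReal_comp.sub_const (β : ℂ)).const_mul Complex.I).cexp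
  have h3 : HasDerivAt (fun t : ℝ => Q.eval (cayley (t / a)))
      ((derivative Q).eval W * (-(Complex.I / a) * W ^ 2)) z :=
    (HasDerivAt.scomp (g₁ := fun w => Q.eval w) z (Q.hasDerivAt W)
      (hasDerivAt_cayley a z)).congr_deriv
      (by rw [smul_eq_mul, mul_comm])
  have h4 := (h1.mul h2).mul h3
  refine h4.congr_deriv ?_
  have hza : z ^ a = z ^ (a - 1) * z := by
    rcases hz.eq_or_lt with rfl | hz
    · rw [Real.zero_rpow (by linarith), mul_zero]
    · rw [← Real.rpow_add_one hz.ne']; ring_nf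
  have hW1 : 1 = W + (z / a) * Complex.I * W := by
    have := one_sub_cayley (z / a)
    rw [← hW] at this
    push_cast at this
    linear_combination this
  -- The telescoping identity, by induction on the number of terms.
  have hT : ∀ m : ℕ, (a + z * Complex.I) * (∑ k ∈ Finset.range m, C ((a⁻¹ : ℂ) ^ (k + 1)) *
        (X * gammaTerm k)).eval W - W * (1 - W) *
        (derivative (∑ k ∈ Finset.range m, C ((a⁻¹ : ℂ) ^ (k + 1)) * (X * gammaTerm k))).eval W
      = 1 - (a⁻¹ : ℂ) ^ m * (gammaTerm m).eval W := by
    intro m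
    induction m with
    | zero => simp [gammaTerm]
    | succ m ih =>
      rw [Finset.sum_range_succ, eval_add, derivative_add, eval_add, derivative_C_mul, gammaTerm_succ]
      simp only [eval_mul, eval_C, eval_X, eval_sub, eval_one] at ih ⊢
      have e : (a + z * Complex.I) * W = a := by
        have : (a + z * Complex.I) * W = a * (W + (z / a) * Complex.I * W) := by field_simp
        rw [this, ← hW1, mul_one]
      have e2 : (a : ℂ) * (a⁻¹ : ℂ) ^ (m + 1) = (a⁻¹ : ℂ) ^ m := by
        rw [pow_succ]; field_simp
      linear_combination ih + (a⁻¹ : ℂ) ^ (m + 1) * (gammaTerm m).eval W * e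
        + (gammaTerm m).eval W * e2
  have hTn := hT n
  rw [← hQ] at hTn
  simp only [Pi.mul_apply]
  rw [← hTn, hza]
  push_cast
  have hW2 : (z : ℂ) * (Complex.I / a) * W ^ 2 = W * (1 - W) := by
    linear_combination -W * hW1
  linear_combination -((z ^ (a - 1) : ℝ) : ℂ) * Complex.exp (Complex.I * (z - β))
    * (derivative Q).eval W * hW2

end GammaExpansion

/-! ### Error bound for the expansion, uniform in x and β. -/

section GammaBound

open Polynomial

/-- In polar form w = e^{-i arctan x}/√(1+x²); this is how arctan enters the phase. -/
theorem exp_I_mul_cayley (x y : ℝ) :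
    Complex.exp (Complex.I * y) * ((Real.sqrt (1 + x ^ 2) : ℝ) * cayley x)
      = Complex.exp (Complex.I * ((y - Real.arctan x : ℝ) : ℂ)) := by
  have hs : 0 < Real.sqrt (1 + x ^ 2) := Real.sqrt_pos.2 (by positivity)
  have hs2 : Real.sqrt (1 + x ^ 2) ^ 2 = 1 + x ^ 2 := Real.sq_sqrt (by positivity)
  have e : ((Real.sqrt (1 + x ^ 2) : ℝ) * cayley x : ℂ)
      = Complex.exp (Complex.I * ((-Real.arctan x : ℝ) : ℂ)) := by
    rw [mul_comm Complex.I, Complex.exp_mul_I, ← Complex.ofReal_cos, ← Complex.ofReal_sin,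
      Real.cos_neg, Real.sin_neg, Real.cos_arctan, Real.sin_arctan, cayley_eq]
    have h1 : Real.sqrt (1 + x ^ 2) * (1 / (1 + x ^ 2)) = 1 / Real.sqrt (1 + x ^ 2) := by
      rw [← hs2]; field_simp; rw [Real.sqrt_sq hs.le]
    have h2 : Real.sqrt (1 + x ^ 2) * (x / (1 + x ^ 2)) = x / Real.sqrt (1 + x ^ 2) := by
      rw [← hs2]; field_simp; rw [Real.sqrt_sq hs.le]
    rw [← h1, ← h2]
    push_cast
    ring
  rw [e, ← Complex.exp_add]
  congr 1
  push_cast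
  ring

/-- The error and the barrier L z^a X/(1+X²)², X = z/a, both vanish at 0, so comparing derivatives
suffices. The barrier's logarithmic derivative is (a + (1-3X²)/(1+X²))/z ≥ (a-3)/z, whence the
factor 1/(a-3) in L. -/
theorem oscIntegral_sub_gammaPartial_bound (n : ℕ) : ∃ K : ℝ, 0 ≤ K ∧ ∀ a β z : ℝ, 4 ≤ a → 0 ≤ z →
    |oscIntegral a β z - (gammaPartial a β (n + 3) z).re|
      ≤ K * a⁻¹ ^ (n + 3) / (a - 3) * (z ^ a * (z / a / (1 + (z / a) ^ 2) ^ 2)) := by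
  obtain ⟨K, hK0, hK⟩ := exists_norm_gammaTerm_le n
  refine ⟨K, hK0, fun a β z ha hz => ?_⟩
  have ha1 : 1 < a := by linarith
  have ha0 : 0 < a := by linarith
  have ha3 : 0 < a - 3 := by linarith
  set f : ℝ → ℝ := fun z => oscIntegral a β z - (gammaPartial a β (n + 3) z).re with hf
  set L := K * a⁻¹ ^ (n + 3) / (a - 3) with hL
  have hL0 : 0 ≤ L := by positivity
  set f' : ℝ → ℝ := fun z => z ^ (a - 1) * Real.cos (z - β) -
    (((z ^ (a - 1) : ℝ) : ℂ) * Complex.exp (Complex.I * (z - β)) *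
      (1 - (a⁻¹ : ℂ) ^ (n + 3) * (gammaTerm (n + 3)).eval (cayley (z / a)))).re with hf'
  have hd : ∀ t, 0 ≤ t → HasDerivAt f (f' t) t := fun t ht =>
    (hasDerivAt_oscIntegral ha1 β t).sub
      (Complex.reCLM.hasFDerivAt.comp_hasDerivAt t (hasDerivAt_gammaPartial ha1 β (n + 3) ht))
  have hB : ∀ t : ℝ, HasDerivAt (fun t => L * (t ^ a * (t / a / (1 + (t / a) ^ 2) ^ 2)))
      (L * (a * t ^ (a - 1) * (t / a / (1 + (t / a) ^ 2) ^ 2)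
        + t ^ a * (1 / a * (1 - 3 * (t / a) ^ 2) / (1 + (t / a) ^ 2) ^ 3))) t := by
    intro t
    have h1 : HasDerivAt (fun t => t ^ a) (a * t ^ (a - 1)) t :=
      Real.hasDerivAt_rpow_const (Or.inr ha1.le)
    have h2 : HasDerivAt (fun t => t / a) (1 / a) t := (hasDerivAt_id t).div_const a
    have h3 : HasDerivAt (fun t => (1 + (t / a) ^ 2) ^ 2)
        (2 * (1 + (t / a) ^ 2) * (2 * (t / a) * (1 / a))) t := by
      have := ((h2.fun_pow 2).const_add 1).fun_pow 2
      simpa using this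
    have hpos : (1 + (t / a) ^ 2) ≠ 0 := by positivity
    refine ((h1.mul (h2.div h3 (by positivity))).const_mul L).congr_deriv ?_
    simp only [Pi.div_apply]
    congr 2
    generalize t / a = X at *
    field_simp
    ring
  have hbound : ∀ t ∈ Set.Ico 0 z, ‖f' t‖ ≤ L * (a * t ^ (a - 1) * (t / a / (1 + (t / a) ^ 2) ^ 2)
        + t ^ a * (1 / a * (1 - 3 * (t / a) ^ 2) / (1 + (t / a) ^ 2) ^ 3)) := by
    intro t ht
    have ht0 := ht.1
    have hta : t ^ a = t ^ (a - 1) * t := by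
      rcases ht0.eq_or_lt with rfl | h
      · rw [Real.zero_rpow (by linarith), mul_zero]
      · rw [← Real.rpow_add_one h.ne']; ring_nf
    have hX : 0 ≤ t / a := by positivity
    have hr : 0 ≤ t ^ (a - 1) := Real.rpow_nonneg ht0 _
    have e1 : f' t = (((t ^ (a - 1) : ℝ) : ℂ) * Complex.exp (Complex.I * ((t - β : ℝ) : ℂ)) *
      ((a⁻¹ : ℂ) ^ (n + 3) * (gammaTerm (n + 3)).eval (cayley (t / a)))).re := by
      have : (((t ^ (a - 1) : ℝ) : ℂ) * Complex.exp (Complex.I * ((t - β : ℝ) : ℂ))).re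
          = t ^ (a - 1) * Real.cos (t - β) := by
        rw [Complex.re_ofReal_mul, mul_comm Complex.I, Complex.exp_ofReal_mul_I_re]
      rw [hf']
      simp only
      rw [← this, ← Complex.sub_re]
      congr 1
      push_cast
      ring
    have e2 : ‖f' t‖ ≤ t ^ (a - 1) * (a⁻¹ ^ (n + 3) * (K * (t / a / (1 + (t / a) ^ 2) ^ 2))) := by
      rw [e1]
      refine (Complex.abs_re_le_norm _).trans ?_
      rw [norm_mul, norm_mul, norm_mul, norm_pow, mul_comm Complex.I, Complex.norm_exp_ofReal_mul_I,
        Complex.norm_real, Real.norm_of_nonneg hr, mul_one, norm_inv, Complex.norm_real,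
        Real.norm_of_nonneg ha0.le]
      have := hK (t / a) hX
      gcongr
    refine e2.trans ?_
    have e3 : a * t ^ (a - 1) * (t / a / (1 + (t / a) ^ 2) ^ 2)
        + t ^ a * (1 / a * (1 - 3 * (t / a) ^ 2) / (1 + (t / a) ^ 2) ^ 3)
        = (t ^ (a - 1) * (t / a / (1 + (t / a) ^ 2) ^ 2))
          * (a + (1 - 3 * (t / a) ^ 2) / (1 + (t / a) ^ 2)) := by
      rw [hta]
      have : t ^ (a - 1) * t * (1 / a * (1 - 3 * (t / a) ^ 2) / (1 + (t / a) ^ 2) ^ 3)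
        = t ^ (a - 1) * (t / a * (1 - 3 * (t / a) ^ 2) / (1 + (t / a) ^ 2) ^ 3) := by ring
      rw [this]
      have hpos : (1 + (t / a) ^ 2) ≠ 0 := by positivity
      generalize t / a = X at *
      field_simp
    have e4 : a - 3 ≤ a + (1 - 3 * (t / a) ^ 2) / (1 + (t / a) ^ 2) := by
      have : -3 ≤ (1 - 3 * (t / a) ^ 2) / (1 + (t / a) ^ 2) := by
        rw [le_div_iff₀ (by positivity)]; linarith
      linarith
    rw [e3]
    calc _ = L * ((t ^ (a - 1) * (t / a / (1 + (t / a) ^ 2) ^ 2)) * (a - 3)) := by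
          rw [hL]; field_simp
      _ ≤ _ := by gcongr
  have h := image_norm_le_of_norm_deriv_right_le_deriv_boundary (a := 0) (b := z) (f := f) (f' := f')
    (fun t ht => (hd t ht.1).continuousAt.continuousWithinAt)
    (fun t ht => (hd t ht.1).hasDerivWithinAt) (by
      simp [hf, gammaPartial, Real.zero_rpow ha0.ne']) hB hbound (Set.right_mem_Icc.2 hz)
  simpa [Real.norm_eq_abs] using h

/-- Uniform expansion of the normalised oscillatory integral. -/
theorem oscIntegral_expansion (n : ℕ) : ∃ K : ℝ, 0 ≤ K ∧ ∀ a β x : ℝ, 4 ≤ a → 0 < x →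
    |Real.sqrt (1 + x ^ 2) * a / (a * x) ^ a * oscIntegral a β (a * x)
      - ∑ k ∈ Finset.range (n + 3), a⁻¹ ^ k *
        (Complex.exp (Complex.I * ((a * x - β - Real.arctan x : ℝ) : ℂ))
          * (gammaTerm k).eval (cayley x)).re| ≤ K * a⁻¹ ^ (n + 3) * (x / (1 + x ^ 2)) := by
  obtain ⟨K, hK0, hK⟩ := oscIntegral_sub_gammaPartial_bound n
  refine ⟨4 * K, by positivity, fun a β x ha hx => ?_⟩
  have ha0 : 0 < a := by linarith
  have ha3 : 0 < a - 3 := by linarith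
  have hz : 0 < a * x := by positivity
  have hza : 0 < (a * x) ^ a := Real.rpow_pos_of_pos hz _
  have hzx : a * x / a = x := by field_simp
  set s := Real.sqrt (1 + x ^ 2) with hs
  have hs0 : 0 < s := Real.sqrt_pos.2 (by positivity)
  have hs2 : s ^ 2 = 1 + x ^ 2 := Real.sq_sqrt (by positivity)
  have key : s * a / (a * x) ^ a * (gammaPartial a β (n + 3) (a * x)).re
      = ∑ k ∈ Finset.range (n + 3), a⁻¹ ^ k *
        (Complex.exp (Complex.I * ((a * x - β - Real.arctan x : ℝ) : ℂ))
          * (gammaTerm k).eval (cayley x)).re := by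
    rw [← Complex.re_ofReal_mul]
    have e : ∀ k : ℕ, a⁻¹ ^ k * (Complex.exp (Complex.I * ((a * x - β - Real.arctan x : ℝ) : ℂ))
          * (gammaTerm k).eval (cayley x)).re
        = (((a⁻¹ ^ k : ℝ) : ℂ) * (Complex.exp (Complex.I * ((a * x - β - Real.arctan x : ℝ) : ℂ))
          * (gammaTerm k).eval (cayley x))).re := fun k => (Complex.re_ofReal_mul _ _).symm
    simp only [e]
    rw [← Complex.re_sum]
    congr 1
    rw [gammaPartial, hzx, eval_finsetSum, Finset.mul_sum, Finset.mul_sum]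
    refine Finset.sum_congr rfl fun k _ => ?_
    rw [← exp_I_mul_cayley, ← hs]
    simp only [eval_mul, eval_C, eval_X]
    have hzc : (((a * x) ^ a : ℝ) : ℂ) ≠ 0 := by exact_mod_cast hza.ne'
    have hac : (a : ℂ) ≠ 0 := by exact_mod_cast ha0.ne'
    push_cast
    rw [pow_succ]
    field_simp
  rw [← key, ← mul_sub, abs_mul, abs_of_pos (by positivity)]
  have h := hK a β (a * x) ha hz.le
  rw [hzx] at h
  calc _ ≤ s * a / (a * x) ^ a * (K * a⁻¹ ^ (n + 3) / (a - 3) * ((a * x) ^ a * (x / (1 + x ^ 2) ^ 2))) := by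
        gcongr
    _ = K * a⁻¹ ^ (n + 3) * (x / (1 + x ^ 2)) * ((a / (a - 3)) * (s / s ^ 2)) := by
        rw [hs2]; field_simp
    _ ≤ K * a⁻¹ ^ (n + 3) * (x / (1 + x ^ 2)) * (4 * 1) := by
        have h1 : a / (a - 3) ≤ 4 := by rw [div_le_iff₀ ha3]; linarith
        have h2 : s / s ^ 2 ≤ 1 := by
          rw [div_le_one (by positivity)]
          have : 1 ≤ s := by nlinarith [sq_nonneg x]
          nlinarith
        gcongr
    _ = _ := by ring

end GammaBound

/-! ### A true zero near each nondegenerate root. -/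

section ZeroNearRoot

open Polynomial

/-- Slope at least 1/2 means that a step of 2r to either side moves F by at least r, which covers
the defect. -/
theorem exists_eq_of_half_le_deriv {F f' : ℝ → ℝ} {z b r η : ℝ}
    (hF : ∀ t, |t| ≤ η → HasDerivAt F (f' t) t) (hf : ∀ t, |t| ≤ η → 1 / 2 ≤ f' t)
    (hr : 0 ≤ r) (hz : |z| + 2 * r ≤ η) (hb : |F z - b| ≤ r) :
    ∃ ζ, |ζ - z| ≤ 2 * r ∧ F ζ = b := by
  have hmem : ∀ t ∈ Set.Icc (z - 2 * r) (z + 2 * r), |t| ≤ η := by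
    intro t ht
    have h1 := neg_abs_le z
    have h2 := le_abs_self z
    rw [abs_le]
    constructor <;> linarith [ht.1, ht.2]
  have hcont : ContinuousOn F (Set.Icc (z - 2 * r) (z + 2 * r)) := fun t ht =>
    (hF t (hmem t ht)).continuousAt.continuousWithinAt
  have hmono : MonotoneOn (fun t => F t - 1 / 2 * t) (Set.Icc (z - 2 * r) (z + 2 * r)) := by
    have hd : ∀ t ∈ Set.Icc (z - 2 * r) (z + 2 * r),
        HasDerivAt (fun t => F t - 1 / 2 * t) (f' t - 1 / 2 * 1) t := fun t ht =>
      (hF t (hmem t ht)).sub ((hasDerivAt_id t).const_mul _)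
    refine monotoneOn_of_deriv_nonneg (convex_Icc _ _)
      (fun t ht => (hd t ht).continuousAt.continuousWithinAt)
      (fun t ht => (hd t (interior_subset ht)).differentiableAt.differentiableWithinAt)
      (fun t ht => ?_)
    rw [(hd t (interior_subset ht)).deriv]
    have := hf t (hmem t (interior_subset ht))
    linarith
  have hl := hmono (a := z - 2 * r) (b := z) ⟨le_rfl, by linarith⟩ ⟨by linarith, by linarith⟩
    (by linarith)
  have hu := hmono (a := z) (b := z + 2 * r) ⟨by linarith, by linarith⟩ ⟨by linarith, le_rfl⟩
    (by linarith)
  simp only at hl hu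
  obtain ⟨hb1, hb2⟩ := abs_le.1 hb
  obtain ⟨ζ, hζ, hζb⟩ := intermediate_value_Icc (by linarith) hcont
    (show b ∈ Set.Icc (F (z - 2 * r)) (F (z + 2 * r)) from ⟨by linarith, by linarith⟩)
  exact ⟨ζ, abs_le.2 ⟨by linarith [hζ.1], by linarith [hζ.2]⟩, hζb⟩

variable {a β x C S : ℝ}

/-- Up to a factor -1/√(1+x²), the quantity Sx - C is cos(ax-β), the oscillating factor of I' at ax.
Nondegeneracy thus bounds this factor away from zero. -/
theorem cos_sin_of_phase (hC : Real.cos (gtiPhase a x - β) = C) (hS : Real.sin (gtiPhase a x - β) = S) :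
    Real.cos (a * x - β) = -(S * x - C) / Real.sqrt (1 + x ^ 2) ∧
    Real.sin (a * x - β) = (S + C * x) / Real.sqrt (1 + x ^ 2) := by
  have e : a * x - β = (gtiPhase a x - β) + Real.arctan x := by rw [gtiPhase]; ring
  rw [e, Real.cos_add, Real.sin_add, Real.cos_arctan, Real.sin_arctan, hC, hS]
  constructor <;> ring

/-- Nondegeneracy in the form δx ≤ |Sx-C| is exactly what bounds Cx/(Sx-C) and Sx/(Sx-C), as |C|,
|S| ≤ 1. -/
theorem abs_zeroParam_le {δ : ℝ} (hδ : 0 < δ) (hx : 0 < x) (hCS : C ^ 2 + S ^ 2 = 1)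
    (hD : δ * x ≤ |S * x - C|) (i : Fin 4) : |zeroParam x C S i| ≤ max 1 (1 / δ) := by
  have hD0 : 0 < |S * x - C| := lt_of_lt_of_le (by positivity) hD
  have hpos : 0 < 1 + x ^ 2 := by positivity
  have aux : ∀ y : ℝ, |y| ≤ 1 → |y * x / (S * x - C)| ≤ max 1 (1 / δ) := by
    intro y hy
    refine le_trans ?_ (le_max_right _ _)
    rw [abs_div, abs_mul, abs_of_pos hx, div_le_div_iff₀ hD0 hδ]
    nlinarith [mul_le_mul_of_nonneg_right hy (mul_pos hδ hx).le]
  fin_cases i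
  · refine le_trans ?_ (le_max_left _ _)
    change |1 / (1 + x ^ 2)| ≤ 1
    rw [abs_of_pos (by positivity), div_le_one hpos]
    nlinarith
  · refine le_trans ?_ (le_max_left _ _)
    change |x / (1 + x ^ 2)| ≤ 1
    rw [abs_of_pos (by positivity), div_le_one hpos]
    nlinarith [sq_nonneg (x - 1)]
  · exact aux C (abs_le_one_iff_mul_self_le_one.2 (by nlinarith))
  · exact aux S (abs_le_one_iff_mul_self_le_one.2 (by nlinarith))

/-- `χ = a c √(x²+1)/(ax)^a`. -/
noncomputable def leadingAmplitude (a c x : ℝ) : ℝ := a * c * Real.sqrt (x ^ 2 + 1) / (a * x) ^ a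

/-- The derivative of the rescaled oscillatory integral. -/
theorem hasDerivAt_scaled_oscIntegral (ha : 1 < a) (hx : 0 < x)
    (hC : Real.cos (gtiPhase a x - β) = C) (hS : Real.sin (gtiPhase a x - β) = S)
    (hD : S * x - C ≠ 0) {t : ℝ} (ht : |t| ≤ 1 / 2) :
    HasDerivAt (fun t => Real.sqrt (1 + x ^ 2) * a / (a * x) ^ a / (-(1 / (1 + x ^ 2) * (S * x - C)))
        * (oscIntegral a β (a * x + x / (1 + x ^ 2) * t) - oscIntegral a β (a * x)))
      (cosKernel (1 / (1 + x ^ 2)) (x / (1 + x ^ 2)) a 0 t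
        + (x / (1 + x ^ 2) * ((S + C * x) / (S * x - C)))
          * sinKernel (1 / (1 + x ^ 2)) (x / (1 + x ^ 2)) a 0 t) t := by
  have ha0 : 0 < a := by linarith
  have hz : 0 < a * x := by positivity
  have hn : 0 < 1 + x ^ 2 := by positivity
  have hs0 : 0 < Real.sqrt (1 + x ^ 2) := Real.sqrt_pos.2 hn
  obtain ⟨hcos, hsin⟩ := cos_sin_of_phase hC hS
  have h1 : HasDerivAt (fun t => a * x + x / (1 + x ^ 2) * t) (x / (1 + x ^ 2) * 1) t :=
    ((hasDerivAt_id t).const_mul _).const_add _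
  have h2 := ((((hasDerivAt_oscIntegral ha β _).comp t h1).sub_const (oscIntegral a β (a * x))).const_mul
    (Real.sqrt (1 + x ^ 2) * a / (a * x) ^ a / (-(1 / (1 + x ^ 2) * (S * x - C)))))
  refine h2.congr_deriv ?_
  obtain ⟨hb, -⟩ := kernel_base_pos (ρ := 1 / (1 + x ^ 2)) (a := a) (τ := t) (by positivity)
    (by rw [div_le_one hn]; nlinarith) ha.le ht
  -- Shifting ax by ωt multiplies it by 1 + ρt/a, because ω = xρ; this produces the kernel base.
  have hmul : a * x + x / (1 + x ^ 2) * t = (a * x) * (1 + 1 / (1 + x ^ 2) * a⁻¹ * t) := by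
    field_simp
  have hcos2 : Real.cos (a * x + x / (1 + x ^ 2) * t - β)
      = (-(S * x - C) * Real.cos (x / (1 + x ^ 2) * t) - (S + C * x) * Real.sin (x / (1 + x ^ 2) * t))
        / Real.sqrt (1 + x ^ 2) := by
    rw [show a * x + x / (1 + x ^ 2) * t - β = (a * x - β) + x / (1 + x ^ 2) * t by ring,
      Real.cos_add, hcos, hsin]
    ring
  rw [hcos2, hmul, Real.mul_rpow hz.le hb.le, Real.rpow_sub_one hz.ne']
  simp only [cosKernel, sinKernel, Nat.cast_zero, sub_zero]
  have hza : 0 < (a * x) ^ a := Real.rpow_pos_of_pos hz _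
  generalize (1 + 1 / (1 + x ^ 2) * a⁻¹ * t) ^ (a - 1) = B
  generalize Real.cos (x / (1 + x ^ 2) * t) = c1
  generalize Real.sin (x / (1 + x ^ 2) * t) = s1
  generalize (a * x) ^ a = Z at *
  generalize Real.sqrt (1 + x ^ 2) = s at *
  obtain ⟨D, hDd⟩ : ∃ D, D = S * x - C := ⟨_, rfl⟩
  rw [← hDd] at hD ⊢
  field_simp
  ring

/-- The source term in complex form. -/
theorem eval_sourceCoeff_zeroParam (hD : S * x - C ≠ 0) (k : ℕ) :
    1 / (1 + x ^ 2) * (S * x - C) * MvPolynomial.eval (zeroParam x C S) (sourceCoeff (k + 1))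
      = (((C : ℂ) + S * Complex.I) * (gammaTerm (k + 1)).eval (cayley x)).re := by
  have hw : cayley x = ((zeroParam x C S 0 : ℝ) : ℂ) - (zeroParam x C S 1 : ℝ) * Complex.I := cayley_eq x
  rw [eval_sourceCoeff, ← hw, ← Complex.re_ofReal_mul]
  congr 1
  rw [gammaTerm]
  simp only [eval_mul, eval_sub, eval_one, eval_X, Nat.add_sub_cancel]
  rw [← mul_assoc, ← mul_assoc, ← mul_assoc]
  congr 1
  rw [one_sub_cayley, cayley_eq]
  change ((1 / (1 + x ^ 2) * (S * x - C) : ℝ) : ℂ) * (((C * x / (S * x - C) : ℝ) : ℂ)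
    + ((S * x / (S * x - C) : ℝ) : ℂ) * Complex.I) * (2 * ((x / (1 + x ^ 2) : ℝ) : ℂ)
    + (2 * ((1 / (1 + x ^ 2) : ℝ) : ℂ) - 1) * Complex.I) = _
  have hn := one_add_sq_ofReal_ne_zero x
  have hDc : (x : ℂ) * S - C ≠ 0 := by rw [mul_comm]; exact_mod_cast hD
  push_cast
  field_simp
  linear_combination (x : ℂ) * (C + S * Complex.I) * (2 * x - x ^ 2 * Complex.I) * Complex.I_sq

/-- The right-hand side of the equation for the scaled correction has the expected expansion. -/
theorem source_expansion (n : ℕ) {δ : ℝ} (hδ : 0 < δ) : ∃ K : ℝ, 0 ≤ K ∧ ∀ a β c x C S : ℝ, 4 ≤ a →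
    0 < x → Real.cos (gtiPhase a x - β) = C → Real.sin (gtiPhase a x - β) = S →
    C = leadingAmplitude a c x → δ * x ≤ |S * x - C| →
    |Real.sqrt (1 + x ^ 2) * a / (a * x) ^ a / (-(1 / (1 + x ^ 2) * (S * x - C)))
        * (c - oscIntegral a β (a * x))
      - ∑ k ∈ Finset.Icc 1 (n + 2), MvPolynomial.eval (zeroParam x C S) (sourceCoeff k) * a⁻¹ ^ k|
      ≤ K * a⁻¹ ^ (n + 3) := by
  obtain ⟨K, hK0, hK⟩ := oscIntegral_expansion n
  refine ⟨K / δ, by positivity, fun a β c x C S ha hx hC hS hroot hD => ?_⟩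
  have hD0 : 0 < |S * x - C| := lt_of_lt_of_le (by positivity) hD
  have hD1 : S * x - C ≠ 0 := abs_pos.1 hD0
  have hn : 0 < 1 + x ^ 2 := by positivity
  have h := hK a β x ha hx
  have hexp : Complex.exp (Complex.I * ((a * x - β - Real.arctan x : ℝ) : ℂ)) = (C : ℂ) + S * Complex.I := by
    rw [mul_comm Complex.I, Complex.exp_mul_I, ← Complex.ofReal_cos, ← Complex.ofReal_sin]
    have : a * x - β - Real.arctan x = gtiPhase a x - β := by rw [gtiPhase]; ring
    rw [this, hC, hS]
  rw [hexp, Finset.sum_range_succ'] at h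
  simp only [← eval_sourceCoeff_zeroParam hD1] at h
  have h0 : a⁻¹ ^ 0 * (((C : ℂ) + S * Complex.I) * (gammaTerm 0).eval (cayley x)).re = C := by
    simp [gammaTerm]
  rw [h0] at h
  set E := 1 / (1 + x ^ 2) * (S * x - C) with hE
  have hE0 : E ≠ 0 := by rw [hE]; positivity
  set K0 := Real.sqrt (1 + x ^ 2) * a / (a * x) ^ a with hK0def
  -- Here x being a root is used: the term of order zero in the normalised integral cancels and the
  -- source starts at order 1/a.
  have hc : K0 * c = C := by
    rw [hroot, leadingAmplitude, hK0def, add_comm (1 : ℝ)]; ring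
  have e : K0 / -E * (c - oscIntegral a β (a * x))
      - ∑ k ∈ Finset.Icc 1 (n + 2), MvPolynomial.eval (zeroParam x C S) (sourceCoeff k) * a⁻¹ ^ k
      = (K0 * oscIntegral a β (a * x) - (∑ k ∈ Finset.range (n + 2), a⁻¹ ^ (k + 1) *
        (E * MvPolynomial.eval (zeroParam x C S) (sourceCoeff (k + 1))) + C)) / E := by
    have e1 : ∑ k ∈ Finset.Icc 1 (n + 2), MvPolynomial.eval (zeroParam x C S) (sourceCoeff k) * a⁻¹ ^ k
        = (∑ k ∈ Finset.range (n + 2), a⁻¹ ^ (k + 1) *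
          (E * MvPolynomial.eval (zeroParam x C S) (sourceCoeff (k + 1)))) / E := by
      rw [Finset.range_eq_Ico, Finset.sum_Ico_add' (fun k => a⁻¹ ^ k *
          (E * MvPolynomial.eval (zeroParam x C S) (sourceCoeff k))) 0 (n + 2) 1, Finset.sum_div]
      refine Finset.sum_congr rfl fun k _ => ?_
      field_simp
    rw [e1, ← hc]
    field_simp
    ring
  rw [e, abs_div, div_le_iff₀ (abs_pos.2 hE0)]
  refine h.trans ?_
  have hEabs : |E| = 1 / (1 + x ^ 2) * |S * x - C| := by
    rw [hE, abs_mul, abs_of_pos (by positivity : 0 < 1 / (1 + x ^ 2))]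
  rw [hEabs]
  -- The factor x/(1+x²) in the error of the expansion compensates the division by ρ(Sx-C), which
  -- may be as small as ρδx.
  calc K * a⁻¹ ^ (n + 3) * (x / (1 + x ^ 2)) = K / δ * a⁻¹ ^ (n + 3) * (1 / (1 + x ^ 2) * (δ * x)) := by
        field_simp
    _ ≤ _ := by gcongr

theorem paramEval_formalSolution (p : Fin 4 → ℝ) (ε : ℝ) (n : ℕ) :
    paramEval p ε (formalSolution phaseCoeff sourceCoeff n)
      = ∑ j ∈ Finset.Icc 1 n, MvPolynomial.eval p (correctionCoeff j) * ε ^ j := by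
  rw [formalSolution_eq_sum, map_sum]
  simp [correctionCoeff]

theorem paramEval_formalResidual (p : Fin 4 → ℝ) (ε : ℝ) (n : ℕ) (Z : ParamRing[X]) :
    paramEval p ε (formalResidual phaseCoeff sourceCoeff n Z)
      = ∑ i ∈ Finset.Icc 1 n, paramEval p ε (phaseCoeff i) * paramEval p ε Z ^ i
        - ∑ k ∈ Finset.Icc 1 n, MvPolynomial.eval p (sourceCoeff k) * ε ^ k := by
  rw [formalResidual, map_sub, map_sum, map_sum]
  simp

set_option maxHeartbeats 400000 in
/-- Near a nondegenerate root of the leading order equation there is a zero of the oscillatory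
integral minus its limit value, with the expected expansion. -/
theorem exists_zero_near_root (n : ℕ) {δ : ℝ} (hδ : 0 < δ) : ∃ A K : ℝ, 4 ≤ A ∧ 0 ≤ K ∧
    ∀ a β c x C S : ℝ, A ≤ a → 0 < x → Real.cos (gtiPhase a x - β) = C →
    Real.sin (gtiPhase a x - β) = S → C = leadingAmplitude a c x → δ * x ≤ |S * x - C| →
    ∃ ζ : ℝ, |ζ| ≤ K * a⁻¹ ∧ oscIntegral a β (a * x + x / (1 + x ^ 2) * ζ) = c ∧
      |ζ - ∑ j ∈ Finset.Icc 1 (n + 2), MvPolynomial.eval (zeroParam x C S) (correctionCoeff j) * a⁻¹ ^ j|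
        ≤ K * a⁻¹ ^ (n + 3) := by
  set M : ℝ := max 1 (1 / δ) with hM
  have hM1 : 1 ≤ M := le_max_left _ _
  obtain ⟨K1, hK10, hK1⟩ := exists_abs_paramEval_le_of_X_pow_dvd
    (X_pow_succ_dvd_formalResidual sourceCoeff phaseCoeff_one (n + 2)) M
  obtain ⟨K2, hK20, hK2⟩ := source_expansion n hδ
  obtain ⟨K3, hK30, hK3⟩ := exists_abs_paramEval_le_of_X_pow_dvd (n := 1)
    (by simpa using X_dvd_formalSolution phaseCoeff sourceCoeff (n + 2)) M
  obtain ⟨Km, hKm0, hKm⟩ := exists_abs_paramEval_le (C sineCoeff) M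
  -- Three defects of the approximate solution: Taylor truncation, residual of the formal solution,
  -- truncation of the source.
  set K4 := (1 + Km) * (2 * 2 ^ (n + 2)) * K3 ^ (n + 3) + K1 + K2 with hK4
  have hK40 : 0 ≤ K4 := by positivity
  -- On |t| ≤ η the derivative differs from 1 by at most 4(1+Km)|t| ≤ 1/2.
  set η : ℝ := 1 / (8 * (1 + Km)) with hη
  have hη0 : 0 < η := by positivity
  have hη2 : η ≤ 1 / 2 := by
    rw [hη, div_le_div_iff₀ (by positivity) (by norm_num)]; linarith
  -- The first threshold keeps the kernel exponents nonnegative, the second keeps the whole search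
  -- interval inside |t| ≤ η.
  refine ⟨max (n + 4) ((K3 + 2 * K4) / η), K3 + 2 * K4, le_max_of_le_left ?_, by positivity,
    fun a β c x C S ha hx hC hS hroot hD => ?_⟩
  · have : (0 : ℝ) ≤ n := n.cast_nonneg
    linarith
  have hn0 : (0 : ℝ) ≤ n := n.cast_nonneg
  have hna : (n : ℝ) + 4 ≤ a := (le_max_left _ _).trans ha
  have ha0 : 0 < a := by linarith
  have hη3 : (K3 + 2 * K4) * a⁻¹ ≤ η := by
    have h := (le_max_right _ _).trans ha
    rw [div_le_iff₀ hη0] at h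
    rw [← div_eq_mul_inv, div_le_iff₀ ha0]
    linarith
  have hD1 : S * x - C ≠ 0 := abs_pos.1 (lt_of_lt_of_le (by positivity) hD)
  have hCS : C ^ 2 + S ^ 2 = 1 := by rw [← hC, ← hS]; exact Real.cos_sq_add_sin_sq _
  have hp := abs_zeroParam_le hδ hx hCS hD
  set p := zeroParam x C S with hpdef
  have hε0 : 0 < a⁻¹ := by positivity
  have hε1 : a⁻¹ ≤ 1 := inv_le_one_of_one_le₀ (by linarith)
  have hεabs : |a⁻¹| = a⁻¹ := abs_of_pos hε0
  have hε : |a⁻¹| ≤ 1 := by rwa [hεabs]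
  have hn : 0 < 1 + x ^ 2 := by positivity
  have hρ0 : 0 < 1 / (1 + x ^ 2) := by positivity
  have hρ : 1 / (1 + x ^ 2) ≤ 1 := by rw [div_le_one hn]; nlinarith
  have hω0 : 0 < x / (1 + x ^ 2) := by positivity
  have hω : x / (1 + x ^ 2) ≤ 1 := by rw [div_le_one hn]; nlinarith [sq_nonneg (x - 1)]
  set m := MvPolynomial.eval p sineCoeff with hm
  have hmK : |m| ≤ Km := by simpa using hKm p a⁻¹ hp hε
  have hme : m = x / (1 + x ^ 2) * ((S + C * x) / (S * x - C)) := by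
    rw [hm, eval_sineCoeff]
    change 1 / (1 + x ^ 2) * (S * x / (S * x - C)) + x / (1 + x ^ 2) * (C * x / (S * x - C)) = _
    ring
  set Z := ∑ j ∈ Finset.Icc 1 (n + 2), MvPolynomial.eval p (correctionCoeff j) * a⁻¹ ^ j with hZ
  have hZe : paramEval p a⁻¹ (formalSolution phaseCoeff sourceCoeff (n + 2)) = Z :=
    paramEval_formalSolution p a⁻¹ (n + 2)
  have hZb : |Z| ≤ K3 * a⁻¹ := by
    have := hK3 p a⁻¹ hp hε
    rwa [hZe, hεabs, pow_one] at this
  set Q := Real.sqrt (1 + x ^ 2) * a / (a * x) ^ a / (-(1 / (1 + x ^ 2) * (S * x - C))) with hQ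
  set F : ℝ → ℝ := fun t => Q * (oscIntegral a β (a * x + x / (1 + x ^ 2) * t) - oscIntegral a β (a * x))
    with hF
  have hF0 : F 0 = 0 := by simp [hF]
  have hFd : ∀ t, |t| ≤ 1 / 2 → HasDerivAt F (cosKernel (1 / (1 + x ^ 2)) (x / (1 + x ^ 2)) a 0 t
        + m * sinKernel (1 / (1 + x ^ 2)) (x / (1 + x ^ 2)) a 0 t) t := by
    intro t ht
    rw [hme]
    exact hasDerivAt_scaled_oscIntegral (by linarith) hx hC hS hD1 ht
  have hZη : |Z| + 2 * (K4 * a⁻¹ ^ (n + 3)) ≤ (K3 + 2 * K4) * a⁻¹ := by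
    have : a⁻¹ ^ (n + 3) ≤ a⁻¹ := by
      simpa using pow_le_pow_of_le_one hε0.le hε1 (show 1 ≤ n + 3 by omega)
    nlinarith [mul_le_mul_of_nonneg_left this hK40]
  have hZ2 : |Z| ≤ 1 / 2 := by
    have : 0 ≤ K4 * a⁻¹ ^ (n + 3) := by positivity
    linarith
  have hb : |F Z - Q * (c - oscIntegral a β (a * x))| ≤ K4 * a⁻¹ ^ (n + 3) := by
    have b1 := phase_taylor_bound (p := p) rfl rfl hρ0 hρ hω0 hω (n := n + 2) (a := a)
      (by push_cast; linarith) hm.symm hF0 hFd hZ2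
    have b2 := hK1 p a⁻¹ hp hε
    rw [paramEval_formalResidual, hZe, hεabs] at b2
    have b3 := hK2 a β c x C S (by linarith) hx hC hS hroot hD
    rw [← hpdef, ← hQ] at b3
    have b4 : (1 + |m|) * (2 * 2 ^ (n + 2)) * |Z| ^ (n + 2 + 1)
        ≤ (1 + Km) * (2 * 2 ^ (n + 2)) * K3 ^ (n + 3) * a⁻¹ ^ (n + 3) := by
      rw [mul_assoc _ (K3 ^ (n + 3)), ← mul_pow]
      exact mul_le_mul (mul_le_mul_of_nonneg_right (add_le_add_right hmK 1) (by positivity))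
        (pow_le_pow_left₀ (abs_nonneg _) hZb (n + 3)) (pow_nonneg (abs_nonneg _) _) (by positivity)
    rw [hK4, add_mul, add_mul]
    have b5 : |F Z - ∑ i ∈ Finset.Icc 1 (n + 2), paramEval p a⁻¹ (phaseCoeff i) * Z ^ i|
        ≤ (1 + Km) * (2 * 2 ^ (n + 2)) * K3 ^ (n + 3) * a⁻¹ ^ (n + 3) := b1.trans b4
    have b6 : |∑ i ∈ Finset.Icc 1 (n + 2), paramEval p a⁻¹ (phaseCoeff i) * Z ^ i
        - ∑ k ∈ Finset.Icc 1 (n + 2), MvPolynomial.eval p (sourceCoeff k) * a⁻¹ ^ k|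
        ≤ K1 * a⁻¹ ^ (n + 3) := b2
    generalize F Z = f at b5 ⊢
    generalize ∑ i ∈ Finset.Icc 1 (n + 2), paramEval p a⁻¹ (phaseCoeff i) * Z ^ i = P at b5 b6
    generalize ∑ k ∈ Finset.Icc 1 (n + 2), MvPolynomial.eval p (sourceCoeff k) * a⁻¹ ^ k = B at b3 b6
    generalize Q * (c - oscIntegral a β (a * x)) = T at b3 ⊢
    have e : f - T = (f - P) + (P - B) - (T - B) := by ring
    rw [e]
    exact (abs_sub _ _).trans (add_le_add ((abs_add_le _ _).trans (add_le_add b5 b6)) b3)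
  have hdl : ∀ t, |t| ≤ η → 1 / 2 ≤ cosKernel (1 / (1 + x ^ 2)) (x / (1 + x ^ 2)) a 0 t
        + m * sinKernel (1 / (1 + x ^ 2)) (x / (1 + x ^ 2)) a 0 t := by
    intro t ht
    obtain ⟨c1, c2⟩ := kernel_taylor_bound (p := p) (a := a)
      (ρ := 1 / (1 + x ^ 2)) (ω := x / (1 + x ^ 2)) rfl rfl hρ0 hρ hω0 hω 1 0 t
      (by push_cast; linarith) (ht.trans hη2)
    simp only [Finset.range_one, Finset.sum_singleton, pow_zero, taylorPair, map_one, map_zero,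
      mul_one, sub_zero, pow_one] at c1 c2
    have c3 : |m * sinKernel (1 / (1 + x ^ 2)) (x / (1 + x ^ 2)) a 0 t| ≤ Km * (2 * 2 * |t|) := by
      rw [abs_mul]
      exact mul_le_mul hmK c2 (abs_nonneg _) hKm0
    have c4 : (1 + Km) * |t| ≤ 1 / 8 := by
      calc (1 + Km) * |t| ≤ (1 + Km) * η := by gcongr
        _ = 1 / 8 := by rw [hη]; field_simp
    linarith [(abs_le.1 c1).1, (abs_le.1 c3).1]
  obtain ⟨ζ, hζ1, hζ2⟩ := exists_eq_of_half_le_deriv (fun t ht => hFd t (ht.trans hη2)) hdl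
    (by positivity) (hZη.trans hη3) hb
  refine ⟨ζ, ?_, ?_, ?_⟩
  · have : |ζ| ≤ |ζ - Z| + |Z| := by
      have := abs_add_le (ζ - Z) Z
      rwa [sub_add_cancel] at this
    linarith
  · have hQ0 : Q ≠ 0 := by
      have hza : 0 < (a * x) ^ a := Real.rpow_pos_of_pos (by positivity) _
      have hs0 : 0 < Real.sqrt (1 + x ^ 2) := Real.sqrt_pos.2 hn
      rw [hQ]
      exact div_ne_zero (by positivity) (neg_ne_zero.2 (mul_ne_zero hρ0.ne' hD1))
    have := mul_left_cancel₀ hQ0 hζ2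
    linarith
  · refine hζ1.trans ?_
    have : 0 ≤ K3 * a⁻¹ ^ (n + 3) := by positivity
    linarith

end ZeroNearRoot

/-! ### Increasing enumeration of locally finite sets. -/

section IncreasingLists

/-- A locally finite set of reals that is bounded below and unbounded above can be listed in
increasing order. -/
theorem exists_isIncreasingList {Z : Set ℝ} (hfin : ∀ B, (Z ∩ Set.Iic B).Finite)
    (hunb : ∀ B, ∃ x ∈ Z, B < x) : ∃ z, IsIncreasingList Z z := by
  classical
  obtain ⟨x₁, hx₁, -⟩ := hunb 0
  obtain ⟨b, hb, hbmin⟩ := Set.exists_min_image (Z ∩ Set.Iic x₁) id (hfin x₁) ⟨x₁, hx₁, Set.mem_Iic.2 le_rfl⟩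
  have hleast : ∀ x ∈ Z, b ≤ x := by
    intro x hx
    rcases le_total x x₁ with h | h
    · exact hbmin x ⟨hx, h⟩
    · exact le_trans hb.2 h
  -- A locally finite linear order with a least element and no greatest one is isomorphic to ℕ.
  let : LocallyFiniteOrder Z := LocallyFiniteOrder.ofFiniteIcc fun x y => by
    refine Set.Finite.of_injOn (f := Subtype.val) (t := Z ∩ Set.Iic (y : ℝ)) ?_
      Subtype.val_injective.injOn (hfin y)
    intro w hw
    exact ⟨w.2, hw.2⟩
  let : OrderBot Z := { bot := ⟨b, hb.1⟩, bot_le := fun x => hleast x x.2 }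
  have : NoMaxOrder Z := ⟨fun x => by
    obtain ⟨y, hy, hxy⟩ := hunb x
    exact ⟨⟨y, hy⟩, hxy⟩⟩
  let : SuccOrder Z := LinearLocallyFiniteOrder.succOrder Z
  let : PredOrder Z := LinearLocallyFiniteOrder.predOrder Z
  let e : Z ≃o ℕ := orderIsoNatOfLinearSuccPredArch
  -- Lists are indexed from 1, hence the shift.
  refine ⟨fun m => (e.symm (m - 1) : Z), ?_, ?_⟩
  · intro m hm n hn hmn
    have hm : 1 ≤ m := hm
    exact e.symm.strictMono (by omega)
  · ext x
    constructor
    · rintro ⟨m, -, rfl⟩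
      exact Subtype.coe_prop _
    · intro hx
      exact ⟨e ⟨x, hx⟩ + 1, by simp, by simp⟩

end IncreasingLists

/-! ### The zeros form an infinite list, at most one per half period. -/

section Zeros

variable {a β c : ℝ}

/-- The positive `θ` with `∫₀^{aθ} t^(a-1) cos(t-β) dt = c`. -/
def zeroSet (a β c : ℝ) : Set ℝ := {θ | 0 < θ ∧ oscIntegral a β (a * θ) = c}

/-- The half period of `cos(aθ-β)` that contains `θ`. -/
noncomputable def halfPeriod (a β θ : ℝ) : ℤ := ⌊(a * θ - β) / Real.pi + 1 / 2⌋

theorem halfPeriod_eq_iff {θ : ℝ} {n : ℤ} : halfPeriod a β θ = n ↔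
    n * Real.pi - Real.pi / 2 ≤ a * θ - β ∧ a * θ - β < n * Real.pi + Real.pi / 2 := by
  have hp := Real.pi_pos
  rw [halfPeriod, Int.floor_eq_iff]
  have e : (a * θ - β) / Real.pi + 1 / 2 = (a * θ - β + Real.pi / 2) / Real.pi := by field_simp
  rw [e, le_div_iff₀ hp, div_lt_iff₀ hp]
  constructor <;> rintro ⟨h1, h2⟩ <;> constructor <;> linarith

theorem halfPeriod_mono (ha : 0 < a) : Monotone (halfPeriod a β) := by
  intro x y h
  apply Int.floor_mono
  have := Real.pi_pos
  gcongr

theorem cos_ne_zero_of_half_period {n : ℤ} {t : ℝ} (h1 : n * Real.pi - Real.pi / 2 < t)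
    (h2 : t < n * Real.pi + Real.pi / 2) : Real.cos t ≠ 0 := by
  have h := Real.cos_pos_of_mem_Ioo (x := t - n * Real.pi) ⟨by linarith, by linarith⟩
  rw [Real.cos_sub_int_mul_pi] at h
  intro h0
  simp [h0] at h

/-- Rolle: between two zeros the integrand vanishes, but cos(t-β) has no zero inside a half period.
-/
theorem injOn_halfPeriod_zeroSet (ha : 1 < a) : Set.InjOn (halfPeriod a β) (zeroSet a β c) := by
  have key : ∀ x ∈ zeroSet a β c, ∀ y ∈ zeroSet a β c, x < y →
      halfPeriod a β x ≠ halfPeriod a β y := by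
    intro x hx y hy hxy h
    have hlt : a * x < a * y := by nlinarith
    obtain ⟨t, ht, h0⟩ := exists_hasDerivAt_eq_zero hlt
      (continuous_oscIntegral ha β).continuousOn (hx.2.trans hy.2.symm)
      (fun t _ => hasDerivAt_oscIntegral ha β t)
    obtain ⟨hx1, hx2⟩ := halfPeriod_eq_iff.1 h
    obtain ⟨hy1, hy2⟩ := halfPeriod_eq_iff.1 (rfl : halfPeriod a β y = _)
    have htpos : 0 < t := lt_trans (mul_pos (by linarith) hx.1) ht.1
    rcases mul_eq_zero.1 h0 with h0 | h0
    · exact (Real.rpow_pos_of_pos htpos _).ne' h0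
    · exact cos_ne_zero_of_half_period (n := halfPeriod a β y) (by linarith [ht.1])
        (by linarith [ht.2]) h0
  intro x hx y hy h
  rcases lt_trichotomy x y with hl | hl | hl
  · exact absurd h (key x hx y hy hl)
  · exact hl
  · exact absurd h.symm (key y hy x hx hl)

theorem exists_sin_sub_eq_neg_one (β B : ℝ) : ∃ z, B < z ∧ Real.sin (z - β) = -1 := by
  obtain ⟨n, hn⟩ := exists_nat_gt (B - β)
  refine ⟨β - Real.pi / 2 + (n + 1 : ℕ) * (2 * Real.pi), ?_, ?_⟩
  · have h3 := Real.pi_gt_three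
    have : (0 : ℝ) ≤ n := n.cast_nonneg
    push_cast
    nlinarith
  · rw [show β - Real.pi / 2 + (n + 1 : ℕ) * (2 * Real.pi) - β
      = -(Real.pi / 2) + (n + 1 : ℕ) * (2 * Real.pi) by ring, Real.sin_add_nat_mul_two_pi,
      Real.sin_neg, Real.sin_pi_div_two]

/-- The oscillations grow like z^(a-1). If I ≥ c from some point on, then g = (I-c) z^(1-a) ≥ 0
satisfies g' = cos(z-β) - (a-1)g/z. So g - sin(z-β) is decreasing, and it is at least 1 because
sin(z-β) = -1 arbitrarily far out. Hence g is at least 1 + sin, of mean 1, and the loss (a-1)∫ g/z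
diverges logarithmically: a contradiction. -/
theorem exists_oscIntegral_lt (ha : 1 < a) (β c B : ℝ) : ∃ z, B < z ∧ oscIntegral a β z < c := by
  by_contra! hcon
  set Z := max B 0 + 1 with hZ
  have hZ1 : 1 ≤ Z := by rw [hZ]; linarith [le_max_right B 0]
  have hZB : B < Z := by rw [hZ]; linarith [le_max_left B 0]
  have hf : ∀ z, Z ≤ z → c ≤ oscIntegral a β z := fun z hz => hcon z (by linarith)
  let g : ℝ → ℝ := fun z => (oscIntegral a β z - c) * z ^ (-(a - 1))
  have hg0 : ∀ z, Z ≤ z → 0 ≤ g z := fun z hz =>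
    mul_nonneg (by linarith [hf z hz]) (Real.rpow_nonneg (by linarith) _)
  have hgd : ∀ z, Z ≤ z → HasDerivAt g (Real.cos (z - β) - (a - 1) * g z / z) z := by
    intro z hz
    have hzp : 0 < z := by linarith
    have h := ((hasDerivAt_oscIntegral ha β z).sub_const c).mul
      (Real.hasDerivAt_rpow_const (x := z) (p := -(a - 1)) (Or.inl hzp.ne'))
    refine h.congr_deriv ?_
    simp only [g]
    rw [Real.rpow_sub_one hzp.ne' (-(a - 1)), Real.rpow_neg hzp.le (a - 1)]
    have := (Real.rpow_pos_of_pos hzp (a - 1)).ne'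
    generalize z ^ (a - 1) = w at *
    field_simp
    ring
  have hs : ∀ z, HasDerivAt (fun z => Real.sin (z - β)) (Real.cos (z - β)) z := fun z => by
    simpa using ((hasDerivAt_id z).sub_const β).sin
  have hc : ∀ z, HasDerivAt (fun z => Real.cos (z - β)) (-Real.sin (z - β)) z := fun z => by
    simpa using ((hasDerivAt_id z).sub_const β).cos
  have anti : ∀ (k k' : ℝ → ℝ), (∀ z, Z ≤ z → HasDerivAt k (k' z) z) → (∀ z, Z ≤ z → k' z ≤ 0) →
      AntitoneOn k (Set.Ici Z) := by
    intro k k' hk hk'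
    refine antitoneOn_of_deriv_nonpos (convex_Ici Z)
      (fun z hz => (hk z hz).continuousAt.continuousWithinAt)
      (fun z hz => (hk z (interior_subset hz)).differentiableAt.differentiableWithinAt)
      (fun z hz => ?_)
    rw [(hk z (interior_subset hz)).deriv]
    exact hk' z (interior_subset hz)
  have hk := anti (fun z => g z - Real.sin (z - β)) (fun z => -((a - 1) * g z / z))
    (fun z hz => ((hgd z hz).sub (hs z)).congr_deriv (by ring))
    (fun z hz => by
      have := hg0 z hz
      have : 0 ≤ (a - 1) * g z / z := div_nonneg (mul_nonneg (by linarith) this) (by linarith)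
      linarith)
  have hk1 : ∀ z, Z ≤ z → 1 ≤ g z - Real.sin (z - β) := by
    intro z hz
    obtain ⟨w, hw, hw1⟩ := exists_sin_sub_eq_neg_one β z
    have h1 : g w - Real.sin (w - β) ≤ g z - Real.sin (z - β) :=
      hk (Set.mem_Ici.2 hz) (Set.mem_Ici.2 (hz.trans hw.le)) hw.le
    have := hg0 w (hz.trans hw.le)
    linarith
  -- Adding (a-1) log z with the correction (1 - cos(z-β))/z, which absorbs the oscillating part of
  -- ∫ sin(z-β)/z, leaves a function that is still decreasing, although it is at least 1 + (a-1) log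
  -- z.
  have hL := anti (fun z => g z - Real.sin (z - β)
      + (a - 1) * (Real.log z - Real.cos (z - β) * z⁻¹ + z⁻¹))
    (fun z => (a - 1) * ((1 - (g z - Real.sin (z - β))) / z + (Real.cos (z - β) - 1) / z ^ 2))
    (fun z hz => by
      have hzp : z ≠ 0 := by linarith
      refine (((hgd z hz).sub (hs z)).add ((((Real.hasDerivAt_log hzp).sub
        ((hc z).mul (hasDerivAt_inv hzp))).add (hasDerivAt_inv hzp)).const_mul (a - 1))).congr_deriv ?_
      field_simp
      ring)
    (fun z hz => by
      have hzp : 0 < z := by linarith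
      have h1 := hk1 z hz
      have h2 : (1 - (g z - Real.sin (z - β))) / z ≤ 0 := div_nonpos_of_nonpos_of_nonneg (by linarith) hzp.le
      have h3 : (Real.cos (z - β) - 1) / z ^ 2 ≤ 0 :=
        div_nonpos_of_nonpos_of_nonneg (by linarith [Real.cos_le_one (z - β)]) (by positivity)
      exact mul_nonpos_of_nonneg_of_nonpos (by linarith) (by linarith))
  obtain ⟨w, hw, hwZ⟩ := ((Real.tendsto_log_atTop.eventually_gt_atTop
    ((g Z - Real.sin (Z - β) + (a - 1) * (Real.log Z - Real.cos (Z - β) * Z⁻¹ + Z⁻¹)) / (a - 1))).and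
      (Filter.eventually_ge_atTop Z)).exists
  have h1 := hL (Set.mem_Ici.2 le_rfl) (Set.mem_Ici.2 hwZ) hwZ
  simp only at h1
  rw [div_lt_iff₀ (by linarith)] at hw
  have h2 := hk1 w hwZ
  have h3 : 0 ≤ (1 - Real.cos (w - β)) * w⁻¹ :=
    mul_nonneg (by linarith [Real.cos_le_one (w - β)]) (inv_nonneg.2 (by linarith))
  nlinarith [mul_nonneg (show 0 ≤ a - 1 by linarith) h3]

theorem oscIntegral_add_pi (a β z : ℝ) : oscIntegral a (β + Real.pi) z = -oscIntegral a β z := by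
  rw [oscIntegral, oscIntegral, ← intervalIntegral.integral_neg]
  congr 1
  ext t
  rw [← sub_sub, Real.cos_sub_pi]
  ring

theorem zeroSet_add_pi (a β c : ℝ) : zeroSet a (β + Real.pi) (-c) = zeroSet a β c := by
  simp [zeroSet, oscIntegral_add_pi]

/-- Replacing (β, c) by (β+π, -c) changes signs only, so I also exceeds c arbitrarily far out; a
zero lies in between. -/
theorem exists_mem_zeroSet_gt (ha : 1 < a) (β c B : ℝ) : ∃ x ∈ zeroSet a β c, B < x := by
  have ha0 : 0 < a := by linarith
  obtain ⟨z₁, h1, h1c⟩ := exists_oscIntegral_lt ha β c (a * max B 0)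
  obtain ⟨z₂, h2, h2c⟩ := exists_oscIntegral_lt ha (β + Real.pi) (-c) (a * max B 0)
  rw [oscIntegral_add_pi] at h2c
  obtain ⟨z, hz, hzc⟩ := intermediate_value_uIcc (a := z₁) (b := z₂)
    (continuous_oscIntegral ha β).continuousOn (show c ∈ _ from
      ⟨(min_le_left _ _).trans h1c.le, le_trans (by linarith) (le_max_right _ _)⟩)
  have hz1 : a * max B 0 < z := lt_of_lt_of_le (lt_min h1 h2) hz.1
  have hz2 : max B 0 < z / a := by rw [lt_div_iff₀ ha0]; linarith
  refine ⟨z / a, ⟨lt_of_le_of_lt (le_max_right _ _) hz2, ?_⟩, lt_of_le_of_lt (le_max_left _ _) hz2⟩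
  rw [mul_div_cancel₀ _ ha0.ne']
  exact hzc

theorem exists_isIncreasingList_zeroSet (ha : 1 < a) (β c : ℝ) :
    ∃ z, IsIncreasingList (zeroSet a β c) z := by
  refine exists_isIncreasingList (fun B => ?_) (exists_mem_zeroSet_gt ha β c)
  refine Set.Finite.of_injOn (f := halfPeriod a β)
    (t := Set.Icc (halfPeriod a β 0) (halfPeriod a β B)) ?_
    ((injOn_halfPeriod_zeroSet ha).mono Set.inter_subset_left) (Set.finite_Icc _ _)
  rintro x ⟨hx, hxB⟩
  exact ⟨halfPeriod_mono (by linarith) hx.1.le, halfPeriod_mono (by linarith) hxB⟩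

end Zeros

/-! ### The roots of the leading equation and their phase intervals. -/

section Roots

variable {a β c x y : ℝ}

/-- The positive roots of `cos(aθ - arctan θ - β) = χ(θ)`. -/
def rootSet (a β c : ℝ) : Set ℝ :=
  {θ | 0 < θ ∧ Real.cos (gtiPhase a θ - β) = leadingAmplitude a c θ}

theorem rootSet_add_pi (a β c : ℝ) : rootSet a (β + Real.pi) (-c) = rootSet a β c := by
  have h : ∀ θ, leadingAmplitude a (-c) θ = -leadingAmplitude a c θ := fun θ => by
    rw [leadingAmplitude, leadingAmplitude]; ring
  ext θ
  simp [rootSet, h, ← sub_sub, Real.cos_sub_pi]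

theorem hasDerivAt_gtiPhase (a x : ℝ) : HasDerivAt (gtiPhase a) (a - 1 / (1 + x ^ 2)) x := by
  have h := ((hasDerivAt_id x).const_mul a).sub (Real.hasDerivAt_arctan x)
  exact h.congr_deriv (by ring)

theorem continuous_gtiPhase (a : ℝ) : Continuous (gtiPhase a) :=
  continuous_iff_continuousAt.2 fun x => (hasDerivAt_gtiPhase a x).continuousAt

theorem phase_deriv_pos (ha : 1 < a) (x : ℝ) : 0 < a - 1 / (1 + x ^ 2) := by
  have : 1 / (1 + x ^ 2) ≤ 1 := by rw [div_le_one (by positivity)]; nlinarith [sq_nonneg x]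
  linarith

theorem strictMono_gtiPhase (ha : 1 < a) : StrictMono (gtiPhase a) :=
  strictMono_of_deriv_pos fun x => by
    rw [(hasDerivAt_gtiPhase a x).deriv]; exact phase_deriv_pos ha x

theorem gtiPhase_pos (ha : 1 < a) (hx : 0 < x) : 0 < gtiPhase a x := by
  have := strictMono_gtiPhase ha hx
  simpa [gtiPhase] using this

theorem exists_gtiPhase_eq (ha : 1 < a) {t : ℝ} (h : gtiPhase a x ≤ t) :
    ∃ y, x ≤ y ∧ gtiPhase a y = t := by
  set w := max x ((t + Real.pi) / a) with hw
  have ha0 : 0 < a := by linarith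
  have h1 : t ≤ gtiPhase a w := by
    have h2 : (t + Real.pi) / a ≤ w := le_max_right _ _
    rw [div_le_iff₀ ha0] at h2
    have := Real.arctan_lt_pi_div_two w
    have := Real.pi_pos
    rw [gtiPhase]
    linarith
  obtain ⟨y, hy, hyt⟩ := intermediate_value_Icc (le_max_left x ((t + Real.pi) / a))
    (continuous_gtiPhase a).continuousOn (show t ∈ _ from ⟨h, h1⟩)
  exact ⟨y, hy.1, hyt⟩

theorem hasDerivAt_leadingAmplitude (ha : 0 < a) (c : ℝ) (hx : 0 < x) :
    HasDerivAt (leadingAmplitude a c)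
      (-(leadingAmplitude a c x * (a / x - x / (1 + x ^ 2)))) x := by
  have hn : 0 < x ^ 2 + 1 := by positivity
  have hz : 0 < a * x := by positivity
  have hza : 0 < (a * x) ^ a := Real.rpow_pos_of_pos hz _
  have h1 := (((hasDerivAt_pow 2 x).add_const 1).sqrt hn.ne').const_mul (a * c)
  have h2 := ((hasDerivAt_id x).const_mul a).rpow_const (p := a) (Or.inl hz.ne')
  refine (h1.div h2 hza.ne').congr_deriv ?_
  simp only [leadingAmplitude, id]
  rw [Real.rpow_sub_one hz.ne']
  have hs := Real.sq_sqrt hn.le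
  have hs0 := Real.sqrt_pos.2 hn
  generalize (a * x) ^ a = Z at *
  generalize Real.sqrt (x ^ 2 + 1) = s at *
  rw [add_comm 1 (x ^ 2), ← hs]
  field_simp
  push_cast
  ring

/-- The logarithmic decay rate -χ'/χ; in this form it is visibly positive and decreasing when a > 1.
-/
theorem amplitude_rate_eq (hx : 0 < x) :
    a / x - x / (1 + x ^ 2) = (a - 1) / x + 1 / (x * (1 + x ^ 2)) := by
  have : 0 < 1 + x ^ 2 := by positivity
  field_simp
  ring

theorem amplitude_rate_pos (ha : 1 < a) (hx : 0 < x) : 0 < a / x - x / (1 + x ^ 2) := by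
  rw [amplitude_rate_eq hx]
  have : 0 < a - 1 := by linarith
  positivity

theorem amplitude_rate_anti (ha : 1 < a) (hx : 0 < x) (hxy : x ≤ y) :
    a / y - y / (1 + y ^ 2) ≤ a / x - x / (1 + x ^ 2) := by
  rw [amplitude_rate_eq hx, amplitude_rate_eq (hx.trans_le hxy)]
  have : 0 < a - 1 := by linarith
  have := hx.trans_le hxy
  gcongr

theorem leadingAmplitude_pos (ha : 0 < a) (hc : 0 < c) (hx : 0 < x) : 0 < leadingAmplitude a c x := by
  have : 0 < Real.sqrt (x ^ 2 + 1) := Real.sqrt_pos.2 (by positivity)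
  have := Real.rpow_pos_of_pos (mul_pos ha hx) a
  rw [leadingAmplitude]
  positivity

theorem continuousOn_leadingAmplitude (ha : 0 < a) (c : ℝ) :
    ContinuousOn (leadingAmplitude a c) (Set.Ioi 0) := fun _ hx =>
  (hasDerivAt_leadingAmplitude ha c hx).continuousAt.continuousWithinAt

theorem strictAntiOn_leadingAmplitude (ha : 1 < a) (hc : 0 < c) :
    StrictAntiOn (leadingAmplitude a c) (Set.Ioi 0) := by
  refine strictAntiOn_of_deriv_neg (convex_Ioi 0) (continuousOn_leadingAmplitude (by linarith) c) ?_
  intro x hx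
  rw [interior_Ioi] at hx
  rw [(hasDerivAt_leadingAmplitude (by linarith) c hx).deriv]
  have := mul_pos (leadingAmplitude_pos (a := a) (by linarith) hc hx) (amplitude_rate_pos ha hx)
  linarith

theorem cos_sub_lt_cos_sub_of_even {n : ℤ} (hn : Even n) {s t : ℝ} (h1 : (n - 1) * Real.pi ≤ s) (h2 : s < t)
    (h3 : t ≤ n * Real.pi) : Real.cos s < Real.cos t := by
  obtain ⟨j, rfl⟩ := hn
  push_cast at h1 h3
  have h := Real.cos_lt_cos_of_nonneg_of_le_pi (x := j * (2 * Real.pi) - t) (y := j * (2 * Real.pi) - s)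
    (by linarith) (by linarith) (by linarith)
  rwa [Real.cos_int_mul_two_pi_sub, Real.cos_int_mul_two_pi_sub] at h

/-- The index of the interval `((n-1)π, nπ]` that contains the phase. -/
noncomputable def phaseLabel (a β θ : ℝ) : ℤ := ⌈(gtiPhase a θ - β) / Real.pi⌉

theorem phaseLabel_eq_iff {n : ℤ} : phaseLabel a β x = n ↔
    (n - 1) * Real.pi < gtiPhase a x - β ∧ gtiPhase a x - β ≤ n * Real.pi := by
  have hp := Real.pi_pos
  rw [phaseLabel, Int.ceil_eq_iff, lt_div_iff₀ hp, div_le_iff₀ hp]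

theorem phaseLabel_mono (ha : 1 < a) : Monotone (phaseLabel a β) := by
  intro x y h
  apply Int.ceil_mono
  have := (strictMono_gtiPhase ha).monotone h
  have := Real.pi_pos
  gcongr

/-- The quantity is the logarithmic derivative of cos(φ-β)/χ multiplied by the cosine. For phases
between t and t + π/2 the cosine and the decay rate decrease while the sine and φ' increase, so it
falls strictly and cos/χ has a single hump. -/
theorem hump_rate_lt (ha : 1 < a) {t : ℝ} (hx : 0 < x) (hxy : x < y)
    (h1 : t ≤ gtiPhase a x - β) (h2 : gtiPhase a y - β ≤ t + Real.pi / 2) (ht : ∃ j : ℤ, t = j * (2 * Real.pi)) :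
    Real.cos (gtiPhase a y - β) * (a / y - y / (1 + y ^ 2))
        - Real.sin (gtiPhase a y - β) * (a - 1 / (1 + y ^ 2))
      < Real.cos (gtiPhase a x - β) * (a / x - x / (1 + x ^ 2))
        - Real.sin (gtiPhase a x - β) * (a - 1 / (1 + x ^ 2)) := by
  obtain ⟨j, rfl⟩ := ht
  have hψ := strictMono_gtiPhase ha hxy
  rw [← Real.cos_sub_int_mul_two_pi (gtiPhase a y - β) j, ← Real.sin_sub_int_mul_two_pi (gtiPhase a y - β) j,
    ← Real.cos_sub_int_mul_two_pi (gtiPhase a x - β) j, ← Real.sin_sub_int_mul_two_pi (gtiPhase a x - β) j]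
  set s := gtiPhase a x - β - j * (2 * Real.pi) with hs
  set w := gtiPhase a y - β - j * (2 * Real.pi) with hw
  have hs0 : 0 ≤ s := by linarith
  have hw1 : w ≤ Real.pi / 2 := by linarith
  have hsw : s < w := by linarith
  have hp := Real.pi_pos
  have hcos : Real.cos w ≤ Real.cos s := Real.cos_le_cos_of_nonneg_of_le_pi hs0 (by linarith) hsw.le
  have hcos0 : 0 ≤ Real.cos w := Real.cos_nonneg_of_mem_Icc ⟨by linarith, hw1⟩
  have hsin : Real.sin s < Real.sin w := Real.sin_lt_sin_of_lt_of_le_pi_div_two (by linarith) hw1 hsw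
  have hsin0 : 0 ≤ Real.sin s := Real.sin_nonneg_of_nonneg_of_le_pi hs0 (by linarith)
  have hα := amplitude_rate_anti ha hx hxy.le
  have hα0 := amplitude_rate_pos ha (hx.trans hxy)
  have hγ : a - 1 / (1 + x ^ 2) ≤ a - 1 / (1 + y ^ 2) := by gcongr
  have hγ0 := phase_deriv_pos ha x
  have h3 := mul_le_mul hcos hα hα0.le (hcos0.trans hcos)
  have h4 := mul_lt_mul hsin hγ hγ0 (hsin0.trans hsin.le)
  linarith

theorem hasDerivAt_cos_phase_div (ha : 1 < a) (hc : 0 < c) (hx : 0 < x) :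
    HasDerivAt (fun x => Real.cos (gtiPhase a x - β) / leadingAmplitude a c x)
      ((Real.cos (gtiPhase a x - β) * (a / x - x / (1 + x ^ 2))
        - Real.sin (gtiPhase a x - β) * (a - 1 / (1 + x ^ 2))) / leadingAmplitude a c x) x := by
  have hχ := (leadingAmplitude_pos (by linarith) hc hx (a := a)).ne'
  refine (((hasDerivAt_gtiPhase a x).sub_const β).cos.div
    (hasDerivAt_leadingAmplitude (by linarith) c hx) hχ).congr_deriv ?_
  field_simp
  ring

/-- On an even interval cos increases and χ decreases, so they meet at most once. On an odd interval
roots lie in the first half, where cos/χ has one hump. The earlier root x₀ guarantees that cos/χ ≥ 1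
somewhere before x, so x and y cannot both be at level 1. Without x₀ the hump may cross that level
twice. -/
theorem phaseLabel_ne_of_lt (ha : 1 < a) (hc : 0 < c) {x₀ : ℝ} (h0 : x₀ ∈ rootSet a β c)
    (hx : x ∈ rootSet a β c) (hy : y ∈ rootSet a β c) (h0x : x₀ < x) (hxy : x < y) :
    phaseLabel a β x ≠ phaseLabel a β y := by
  intro h
  have ha0 : 0 < a := by linarith
  have hp := Real.pi_pos
  obtain ⟨hx1, hx2⟩ := phaseLabel_eq_iff.1 h
  obtain ⟨hy1, hy2⟩ := phaseLabel_eq_iff.1 (rfl : phaseLabel a β y = _)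
  set n := phaseLabel a β y
  have hψ := strictMono_gtiPhase ha hxy
  have hψ0 := strictMono_gtiPhase ha h0x
  rcases Int.even_or_odd n with hn | ⟨j, hj⟩
  · have h1 := cos_sub_lt_cos_sub_of_even hn (s := gtiPhase a x - β) (t := gtiPhase a y - β)
      hx1.le (by linarith) hy2
    have h2 := strictAntiOn_leadingAmplitude ha hc hx.1 hy.1 hxy
    rw [hx.2, hy.2] at h1
    linarith
  · rw [hj] at hx1 hy2
    push_cast at hx1 hy2
    have hyhalf : gtiPhase a y - β ≤ j * (2 * Real.pi) + Real.pi / 2 := by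
      by_contra! hcon
      have h1 := Real.cos_neg_of_pi_div_two_lt_of_lt (x := gtiPhase a y - β - j * (2 * Real.pi))
        (by linarith) (by linarith)
      rw [Real.cos_sub_int_mul_two_pi, hy.2] at h1
      linarith [leadingAmplitude_pos ha0 hc hy.1]
    -- Take x₀ itself if its phase is already past 2πj; otherwise the point of phase exactly 2πj,
    -- where cos = 1 while χ ≤ χ(x₀) ≤ 1.
    obtain ⟨w, hw0, hwx, hwψ, hwr⟩ : ∃ w, 0 < w ∧ w < x ∧ j * (2 * Real.pi) ≤ gtiPhase a w - β ∧
        1 ≤ Real.cos (gtiPhase a w - β) / leadingAmplitude a c w := by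
      rcases le_total (j * (2 * Real.pi)) (gtiPhase a x₀ - β) with hl | hl
      · exact ⟨x₀, h0.1, h0x, hl, by rw [h0.2, div_self (leadingAmplitude_pos ha0 hc h0.1).ne']⟩
      · obtain ⟨w, hw, hwe⟩ := exists_gtiPhase_eq ha (x := x₀) (t := j * (2 * Real.pi) + β) (by linarith)
        have hw0 : 0 < w := lt_of_lt_of_le h0.1 hw
        refine ⟨w, hw0, (strictMono_gtiPhase ha).lt_iff_lt.1 (by linarith), by linarith, ?_⟩
        rw [hwe, add_sub_cancel_right, Real.cos_int_mul_two_pi, le_div_iff₀ (leadingAmplitude_pos ha0 hc hw0),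
          one_mul]
        have := (strictAntiOn_leadingAmplitude ha hc).antitoneOn h0.1 hw0 hw
        have := h0.2 ▸ Real.cos_le_one (gtiPhase a x₀ - β)
        linarith
    have hd : ∀ t : ℝ, 0 < t → _ := fun t ht => hasDerivAt_cos_phase_div (β := β) ha hc (x := t) ht
    have hr : ∀ z ∈ rootSet a β c, Real.cos (gtiPhase a z - β) / leadingAmplitude a c z = 1 :=
      fun z hz => by rw [hz.2, div_self (leadingAmplitude_pos ha0 hc hz.1).ne']
    -- The slope of cos/χ is at most 0 on average over (w, x) and 0 on average over (x, y), against
    -- the strict decrease of its sign-determining factor.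
    obtain ⟨s, hs, hse⟩ := exists_hasDerivAt_eq_slope _ _ hwx
      (fun t ht => (hd t (hw0.trans_le ht.1)).continuousAt.continuousWithinAt)
      (fun t ht => hd t (hw0.trans ht.1))
    obtain ⟨t, ht, hte⟩ := exists_hasDerivAt_eq_slope _ _ hxy
      (fun t ht => (hd t (hx.1.trans_le ht.1)).continuousAt.continuousWithinAt)
      (fun t ht => hd t (hx.1.trans ht.1))
    rw [hr x hx] at hse
    rw [hr x hx, hr y hy, sub_self, zero_div] at hte
    have hs0 : 0 < s := hw0.trans hs.1
    have hχs := leadingAmplitude_pos ha0 hc hs0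
    have hχt := leadingAmplitude_pos ha0 hc (hx.1.trans ht.1)
    have hle : (1 - Real.cos (gtiPhase a w - β) / leadingAmplitude a c w) / (x - w) ≤ 0 :=
      div_nonpos_of_nonpos_of_nonneg (by linarith) (by linarith)
    rw [← hse, div_le_iff₀ hχs, zero_mul] at hle
    rw [div_eq_iff hχt.ne', zero_mul] at hte
    have hsψ := strictMono_gtiPhase ha hs.1
    have htψ := strictMono_gtiPhase ha ht.2
    have := hump_rate_lt ha hs0 (hs.2.trans ht.1) (β := β) (t := j * (2 * Real.pi))
      (by linarith) (by linarith) ⟨j, rfl⟩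
    linarith

theorem HasDerivAt.exists_gt_of_pos {f : ℝ → ℝ} {f' x b : ℝ} (hf : HasDerivAt f f' x) (h : 0 < f')
    (hb : x < b) : ∃ y, x < y ∧ y < b ∧ f x < f y := by
  have h1 := hf.tendsto_slope.eventually (lt_mem_nhds h)
  have h2 := h1.filter_mono (nhdsWithin_mono x (fun y (hy : y ∈ Set.Ioi x) => (ne_of_gt hy)))
  obtain ⟨y, hy, hyx, hyb⟩ := (h2.and (Ioo_mem_nhdsGT hb)).exists
  refine ⟨y, hyx, hyb, ?_⟩
  rw [slope_def_field] at hy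
  have := (div_pos_iff_of_pos_right (sub_pos.2 hyx)).1 hy
  linarith

/-- Once χ ≤ 1, the difference cos - χ changes sign over each phase interval of length π. -/
theorem exists_mem_rootSet_of_label (ha : 1 < a) (hc : 0 < c) {x₀ : ℝ} (hx₀ : 0 < x₀)
    (h1 : leadingAmplitude a c x₀ ≤ 1) {n : ℤ} (hn : gtiPhase a x₀ - β ≤ (n - 1) * Real.pi) :
    ∃ x ∈ rootSet a β c, x₀ ≤ x ∧ phaseLabel a β x = n := by
  have ha0 : 0 < a := by linarith
  have hp := Real.pi_pos
  obtain ⟨l, hl, hle⟩ := exists_gtiPhase_eq ha (x := x₀) (t := (n - 1) * Real.pi + β) (by linarith)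
  obtain ⟨r, hr, hre⟩ := exists_gtiPhase_eq ha (x := l) (t := n * Real.pi + β) (by linarith)
  have hl0 : 0 < l := hx₀.trans_le hl
  have hlr : l < r := (strictMono_gtiPhase ha).lt_iff_lt.1 (by linarith)
  have hr0 : 0 < r := hl0.trans hlr
  have hcont : ∀ w, 0 < w → ContinuousOn (fun x => Real.cos (gtiPhase a x - β) - leadingAmplitude a c x)
      (Set.Icc w r) := fun w hw =>
    ContinuousOn.sub (Real.continuous_cos.comp ((continuous_gtiPhase a).sub continuous_const)).continuousOn
      ((continuousOn_leadingAmplitude ha0 c).mono fun t ht => hw.trans_le ht.1)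
  have fin : ∀ x, l < x → x ≤ r → Real.cos (gtiPhase a x - β) - leadingAmplitude a c x = 0 →
      ∃ x ∈ rootSet a β c, x₀ ≤ x ∧ phaseLabel a β x = n := by
    intro x hlx hxr hx
    refine ⟨x, ⟨hl0.trans hlx, sub_eq_zero.1 hx⟩, hl.trans hlx.le, phaseLabel_eq_iff.2 ⟨?_, ?_⟩⟩
    · have := strictMono_gtiPhase ha hlx
      linarith
    · have := (strictMono_gtiPhase ha).monotone hxr
      linarith
  have hχl := (strictAntiOn_leadingAmplitude ha hc).antitoneOn hx₀ hl0 hl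
  have hχr := strictAntiOn_leadingAmplitude ha hc hl0 hr0 hlr
  have hχl0 := leadingAmplitude_pos ha0 hc hl0
  have hχr0 := leadingAmplitude_pos ha0 hc hr0
  have hψl : gtiPhase a l - β = n * Real.pi - Real.pi := by linarith
  have hψr : gtiPhase a r - β = n * Real.pi := by linarith
  rcases Int.even_or_odd n with hn2 | hn2
  · have hcr : Real.cos (gtiPhase a r - β) = 1 := by
      rw [hψr, Real.cos_int_mul_pi, hn2.neg_one_zpow]
    have hcl : Real.cos (gtiPhase a l - β) = -1 := by
      rw [hψl, Real.cos_sub_pi, Real.cos_int_mul_pi, hn2.neg_one_zpow]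
    obtain ⟨x, hx, hx0⟩ := intermediate_value_Ioc hlr.le (hcont l hl0)
      (show (0 : ℝ) ∈ _ by rw [hcr, hcl]; constructor <;> linarith)
    exact fin x hx.1 hx.2 hx0
  · have hcr : Real.cos (gtiPhase a r - β) = -1 := by
      rw [hψr, Real.cos_int_mul_pi, hn2.neg_one_zpow]
    have hcl : Real.cos (gtiPhase a l - β) = 1 := by
      rw [hψl, Real.cos_sub_pi, Real.cos_int_mul_pi, hn2.neg_one_zpow, neg_neg]
    obtain ⟨w, hlw, hwr, hw⟩ : ∃ w, l ≤ w ∧ w < r ∧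
        0 < Real.cos (gtiPhase a w - β) - leadingAmplitude a c w := by
      -- If χ = 1 at the left end, the difference vanishes there, but that end does not belong to
      -- the interval. There cos is stationary and χ strictly decreasing, so the difference is
      -- positive at some point further right.
      rcases (hχl.trans h1).eq_or_lt with he | hlt
      · have hd := ((hasDerivAt_gtiPhase a l).sub_const β).cos.sub
          (hasDerivAt_leadingAmplitude ha0 c hl0)
        obtain ⟨w, hw1, hw2, hw3⟩ := hd.exists_gt_of_pos (b := r) (by
          have hsl : Real.sin (gtiPhase a l - β) = 0 := by
            rw [hψl, Real.sin_sub_pi, Real.sin_int_mul_pi, neg_zero]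
          rw [hsl, he]
          have := amplitude_rate_pos ha hl0
          linarith) hlr
        simp only [Pi.sub_apply, hcl, he] at hw3
        exact ⟨w, hw1.le, hw2, by linarith⟩
      · exact ⟨l, le_rfl, hlr, by rw [hcl]; linarith⟩
    obtain ⟨x, hx, hx0⟩ := intermediate_value_Ioo' hwr.le (hcont w (hl0.trans_le hlw))
      (show (0 : ℝ) ∈ _ from ⟨by rw [hcr]; linarith, hw⟩)
    exact fin x (hlw.trans_lt hx.1) hx.2.le hx0

theorem finite_rootSet_inter_Iic (ha : 1 < a) (hc : 0 < c) (B : ℝ) :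
    (rootSet a β c ∩ Set.Iic B).Finite := by
  refine Set.Finite.of_finite_fibers (phaseLabel a β)
    ((Set.finite_Icc (phaseLabel a β 0) (phaseLabel a β B)).subset ?_) ?_
  · rintro _ ⟨x, ⟨hx, hxB⟩, rfl⟩
    exact ⟨phaseLabel_mono ha hx.1.le, phaseLabel_mono ha hxB⟩
  · intro n _
    rcases Set.eq_empty_or_nonempty (rootSet a β c ∩ Set.Iic B ∩ phaseLabel a β ⁻¹' {n}) with h | ⟨x₀, h0⟩
    · rw [h]; exact Set.finite_empty
    set F := rootSet a β c ∩ Set.Iic B ∩ phaseLabel a β ⁻¹' {n}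
    -- A phase interval cannot hold three roots: the smallest would serve as the earlier root for
    -- the other two.
    have key : ∀ x ∈ F, ∀ y ∈ F, ∀ z ∈ F, x < y → y < z → False := fun x hx y hy z hz hxy hyz =>
      phaseLabel_ne_of_lt ha hc hx.1.1 hy.1.1 hz.1.1 hxy hyz
        ((Set.mem_singleton_iff.1 hy.2).trans (Set.mem_singleton_iff.1 hz.2).symm)
    have h1 : (F ∩ Set.Iio x₀).Subsingleton := fun x hx y hy => by
      rcases lt_trichotomy x y with h | h | h
      · exact (key x hx.1 y hy.1 x₀ h0 h hy.2).elim
      · exact h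
      · exact (key y hy.1 x hx.1 x₀ h0 h hx.2).elim
    have h2 : (F ∩ Set.Ioi x₀).Subsingleton := fun x hx y hy => by
      rcases lt_trichotomy x y with h | h | h
      · exact (key x₀ h0 x hx.1 y hy.1 hx.2 h).elim
      · exact h
      · exact (key x₀ h0 y hy.1 x hx.1 hy.2 h).elim
    refine ((h1.finite.union h2.finite).union (Set.finite_singleton x₀)).subset fun x hx => ?_
    rcases lt_trichotomy x x₀ with h | h | h
    · exact Or.inl (Or.inl ⟨hx, h⟩)
    · exact Or.inr h
    · exact Or.inl (Or.inr ⟨hx, h⟩)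

/-- For a > 1 the power (ax)^a outgrows the linear numerator. -/
theorem exists_leadingAmplitude_le_one (ha : 1 < a) (hc : 0 < c) :
    ∃ x, 0 < x ∧ leadingAmplitude a c x ≤ 1 := by
  have ha0 : 0 < a := by linarith
  obtain ⟨y, hy, hy1⟩ := ((tendsto_rpow_atTop (show 0 < a - 1 by linarith)).eventually_ge_atTop
    (a * c * (2 / a)) |>.and (Filter.eventually_ge_atTop a)).exists
  have hy0 : 0 < y := by linarith
  have hx1 : 1 ≤ y / a := by rw [le_div_iff₀ ha0]; linarith
  refine ⟨y / a, by positivity, ?_⟩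
  rw [leadingAmplitude, mul_div_cancel₀ _ ha0.ne', div_le_one (Real.rpow_pos_of_pos hy0 _)]
  have hs : Real.sqrt ((y / a) ^ 2 + 1) ≤ 2 * (y / a) := by
    rw [Real.sqrt_le_left (by positivity)]
    nlinarith
  calc a * c * Real.sqrt ((y / a) ^ 2 + 1) ≤ a * c * (2 * (y / a)) := by gcongr
    _ = (a * c * (2 / a)) * y := by ring
    _ ≤ y ^ (a - 1) * y := by gcongr
    _ = y ^ a := by rw [← Real.rpow_add_one hy0.ne']; ring_nf

theorem exists_mem_rootSet_gt (ha : 1 < a) (hc : 0 < c) (β B : ℝ) : ∃ x ∈ rootSet a β c, B < x := by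
  have hp := Real.pi_pos
  obtain ⟨x₁, hx₁, h1⟩ := exists_leadingAmplitude_le_one ha hc
  set x₀ := max x₁ (B + 1)
  have hx₀ : 0 < x₀ := lt_of_lt_of_le hx₁ (le_max_left _ _)
  obtain ⟨n, hn⟩ := exists_int_gt ((gtiPhase a x₀ - β) / Real.pi)
  rw [div_lt_iff₀ hp] at hn
  obtain ⟨x, hx, hx0, -⟩ := exists_mem_rootSet_of_label (β := β) ha hc hx₀
    (((strictAntiOn_leadingAmplitude ha hc).antitoneOn hx₁ hx₀ (le_max_left _ _)).trans h1)
    (n := n + 1) (by push_cast; linarith)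
  exact ⟨x, hx, by linarith [le_max_right x₁ (B + 1)]⟩

theorem exists_isIncreasingList_rootSet (ha : 1 < a) (hc : 0 < c) (β : ℝ) :
    ∃ r, IsIncreasingList (rootSet a β c) r :=
  exists_isIncreasingList (finite_rootSet_inter_Iic ha hc) (exists_mem_rootSet_gt ha hc β)

/-- At a root χ = cos ≤ 1, so the next phase interval contains a root and no interval can be
skipped. -/
theorem phaseLabel_succ_le (ha : 1 < a) (hc : 0 < c) {r : ℕ → ℝ}
    (hr : IsIncreasingList (rootSet a β c) r) {m : ℕ} (hm : 1 ≤ m) :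
    phaseLabel a β (r m) ≤ phaseLabel a β (r (m + 1)) ∧
      phaseLabel a β (r (m + 1)) ≤ phaseLabel a β (r m) + 1 := by
  have hmem : ∀ m, 1 ≤ m → r m ∈ rootSet a β c := fun m hm => hr.2 ▸ Set.mem_image_of_mem r hm
  have hlt := hr.1 (show m ∈ Set.Ici 1 from hm) (show m + 1 ∈ Set.Ici 1 by simp) (Nat.lt_succ_self m)
  refine ⟨phaseLabel_mono ha hlt.le, ?_⟩
  by_contra! hcon
  have h1 := hmem m hm
  obtain ⟨-, h2⟩ := phaseLabel_eq_iff.1 (rfl : phaseLabel a β (r m) = _)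
  obtain ⟨x, hx, hxm, hxl⟩ := exists_mem_rootSet_of_label (β := β) ha hc h1.1
    (h1.2 ▸ Real.cos_le_one _) (n := phaseLabel a β (r m) + 1) (by push_cast; linarith)
  obtain ⟨k, hk, rfl⟩ := hr.2.symm ▸ hx
  have hk1 : m ≤ k := (hr.1.le_iff_le hm hk).1 hxm
  have hk2 : k < m + 1 := by
    by_contra! h
    have := phaseLabel_mono (β := β) ha ((hr.1.le_iff_le (show m + 1 ∈ Set.Ici 1 by simp) hk).2 h)
    omega
  have : k = m := by omega
  subst this
  omega

theorem phaseLabel_succ (ha : 1 < a) (hc : 0 < c) {r : ℕ → ℝ}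
    (hr : IsIncreasingList (rootSet a β c) r) {m : ℕ} (hm : 2 ≤ m) :
    phaseLabel a β (r (m + 1)) = phaseLabel a β (r m) + 1 := by
  have hmem : ∀ m, 1 ≤ m → r m ∈ rootSet a β c := fun m hm => hr.2 ▸ Set.mem_image_of_mem r hm
  obtain ⟨h1, h2⟩ := phaseLabel_succ_le ha hc hr (show 1 ≤ m by omega)
  have h3 := phaseLabel_ne_of_lt ha hc (hmem 1 le_rfl) (hmem m (by omega)) (hmem (m + 1) (by omega))
    (hr.1 (show 1 ∈ Set.Ici 1 by simp) (show m ∈ Set.Ici 1 from (by omega : 1 ≤ m)) (by omega))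
    (hr.1 (show m ∈ Set.Ici 1 from (by omega : 1 ≤ m)) (show m + 1 ∈ Set.Ici 1 by simp) (by omega))
  omega

end Roots

/-! ### Branch numbers and the arccos and arcsin forms of the phase. -/

section Branches

variable {a c : ℝ}

theorem eq_arccos_branch {t : ℝ} {p : ℕ} (hp : 1 ≤ p) (h1 : ((p : ℝ) - 1) * Real.pi < t)
    (h2 : t ≤ p * Real.pi) :
    t = (-1) ^ (p - 1) * Real.arccos (Real.cos t) + 2 * ((p / 2 : ℕ) : ℝ) * Real.pi := by
  rcases Nat.even_or_odd' p with ⟨j, rfl | rfl⟩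
  · have hj : 2 * j / 2 = j := by omega
    have hodd : Odd (2 * j - 1) := ⟨j - 1, by omega⟩
    push_cast at h1 h2
    rw [hj, hodd.neg_one_pow, ← Real.cos_nat_mul_two_pi_sub t j,
      Real.arccos_cos (by linarith) (by linarith)]
    ring
  · have hj : (2 * j + 1) / 2 = j := by omega
    push_cast at h1 h2
    rw [hj, Nat.add_sub_cancel, (even_two_mul j).neg_one_pow, ← Real.cos_sub_nat_mul_two_pi t j,
      Real.arccos_cos (by linarith) (by linarith)]
    ring

theorem eq_arcsin_branch {t : ℝ} {p l : ℕ} (hp : 1 ≤ p)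
    (h1 : -(Real.pi / 2) ≤ t - ((l : ℝ) + p - 1) * Real.pi)
    (h2 : t - ((l : ℝ) + p - 1) * Real.pi ≤ Real.pi / 2) (hs : 0 < (-1) ^ l * Real.sin t) :
    t = (-1) ^ (p - 1) * |Real.arcsin (Real.sin t)| + ((l : ℝ) + p - 1) * Real.pi := by
  obtain ⟨k, rfl⟩ : ∃ k, p = k + 1 := ⟨p - 1, by omega⟩
  simp only [Nat.add_sub_cancel]
  have e : ((l : ℝ) + ((k + 1 : ℕ) : ℝ) - 1) = ((l + k : ℕ) : ℝ) := by push_cast; ring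
  rw [e] at h1 h2 ⊢
  set y := t - ((l + k : ℕ) : ℝ) * Real.pi with hy
  have ht : t = y + ((l + k : ℕ) : ℝ) * Real.pi := by rw [hy]; ring
  have hsin : Real.sin t = (-1) ^ (l + k) * Real.sin y := by
    rw [ht, Real.sin_add_nat_mul_pi]
  have hll : ((-1 : ℝ)) ^ l * (-1) ^ (l + k) = (-1) ^ k := by
    rw [pow_add, ← mul_assoc, ← mul_pow]; norm_num
  rw [hsin, ← mul_assoc, hll] at hs
  have harc : |Real.arcsin (Real.sin t)| = |y| := by
    rw [hsin]
    rcases neg_one_pow_eq_or ℝ (l + k) with h | h <;>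
    simp [h, Real.arcsin_sin h1 h2]
  rw [harc]
  have hpi := Real.pi_pos
  rcases neg_one_pow_eq_or ℝ k with h | h
  · rw [h, one_mul] at hs
    have : 0 < y := by
      by_contra! hcon
      have := Real.sin_nonpos_of_nonpos_of_neg_pi_le hcon (by linarith)
      linarith
    rw [h, abs_of_pos this, one_mul]
    exact ht
  · rw [h] at hs
    have : y < 0 := by
      by_contra! hcon
      have := Real.sin_nonneg_of_nonneg_of_le_pi hcon (by linarith)
      linarith
    rw [h, abs_of_neg this, neg_mul_neg, one_mul]
    exact ht

/-- The branch numbers of the roots, read off from the labels of their phases. -/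
theorem isBranchNumbering_phaseLabel {β : ℝ} (ha : 1 < a) (hc : 0 < c) {r : ℕ → ℝ}
    (hr : IsIncreasingList (rootSet a β c) r) (s : ℤ)
    (hs : ∀ m, 1 ≤ m → 1 ≤ phaseLabel a β (r m) + s) :
    IsBranchNumbering fun m => (phaseLabel a β (r m) + s).toNat := by
  refine ⟨?_, ?_, fun m hm => ?_⟩
  · have := hs 1 le_rfl
    simp only
    omega
  · have h1 := phaseLabel_succ_le ha hc hr (le_refl 1)
    have := hs 1 le_rfl
    have := hs 2 (by omega)
    simp only [Nat.reduceAdd] at h1 ⊢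
    omega
  · have h1 := phaseLabel_succ ha hc hr hm
    have := hs m (by omega)
    simp only [h1]
    omega

theorem mem_of_isIncreasingList {Z : Set ℝ} {z : ℕ → ℝ} (hz : IsIncreasingList Z z) {m : ℕ}
    (hm : 1 ≤ m) : z m ∈ Z := hz.2 ▸ Set.mem_image_of_mem z hm

theorem exists_branches_cos (ha : 1 < a) (hc : c ≠ 0) :
    ∃ r, IsIncreasingList (rootSet a 0 c) r ∧ ∃ p, IsBranchNumbering p ∧ ∀ m, 1 ≤ m →
      |leadingAmplitude a c (r m)| ≤ 1 ∧
      gtiPhase a (r m) = (-1) ^ (p m - 1) * Real.arccos (leadingAmplitude a c (r m))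
        + 2 * ((p m / 2 : ℕ) : ℝ) * Real.pi := by
  have hpi := Real.pi_pos
  -- A negative c is made positive by the shift of β by π; the branch number is then the phase label
  -- plus s.
  obtain ⟨s, d, hd, hset⟩ : ∃ (s : ℕ) (d : ℝ), 0 < d ∧ rootSet a (s * Real.pi) d = rootSet a 0 c := by
    rcases hc.lt_or_gt with h | h
    · exact ⟨1, -c, by linarith, by rw [← rootSet_add_pi a 0 c]; simp⟩
    · exact ⟨0, c, h, by simp⟩
  obtain ⟨r, hr⟩ := exists_isIncreasingList_rootSet ha hd (s * Real.pi)
  have hr' := hset ▸ hr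
  have hlab : ∀ m, 1 ≤ m → 1 ≤ phaseLabel a (s * Real.pi) (r m) + s := by
    intro m hm
    obtain ⟨-, h2⟩ := phaseLabel_eq_iff.1 (rfl : phaseLabel a (s * Real.pi) (r m) = _)
    have h0 := gtiPhase_pos ha (mem_of_isIncreasingList hr hm).1
    have : (0 : ℝ) < ((phaseLabel a (s * Real.pi) (r m) + s : ℤ) : ℝ) := by
      by_contra! hcon
      push_cast at hcon
      nlinarith
    have := Int.cast_pos.1 this
    omega
  refine ⟨r, hr', _, isBranchNumbering_phaseLabel ha hd hr s hlab, fun m hm => ?_⟩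
  have hroot := (mem_of_isIncreasingList hr' hm).2
  rw [sub_zero] at hroot
  rw [← hroot]
  refine ⟨Real.abs_cos_le_one _, ?_⟩
  have hl := hlab m hm
  obtain ⟨h1, h2⟩ := phaseLabel_eq_iff.1 (rfl : phaseLabel a (s * Real.pi) (r m) = _)
  have hcast : (((phaseLabel a (s * Real.pi) (r m) + s).toNat : ℕ) : ℝ)
      = phaseLabel a (s * Real.pi) (r m) + s := by
    have : (((phaseLabel a (s * Real.pi) (r m) + s).toNat : ℕ) : ℤ)
      = phaseLabel a (s * Real.pi) (r m) + s := by omega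
    exact_mod_cast this
  exact eq_arccos_branch (by omega) (by rw [hcast]; linarith) (by rw [hcast]; linarith)

theorem exists_branches_sin (ha : 1 < a) (hc : c ≠ 0) :
    ∃ r, IsIncreasingList (rootSet a (Real.pi / 2) c) r ∧ ∃ (l : ℕ) (p : ℕ → ℕ),
      ((0 < Real.arcsin (leadingAmplitude a c (r 1)) ∧ l = 0) ∨
        (Real.arcsin (leadingAmplitude a c (r 1)) ≤ 0 ∧ l = 1)) ∧
      IsBranchNumbering p ∧ ∀ m, 1 ≤ m →
      |leadingAmplitude a c (r m)| ≤ 1 ∧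
      gtiPhase a (r m) = (-1) ^ (p m - 1) * |Real.arcsin (leadingAmplitude a c (r m))|
        + ((l : ℝ) + (p m : ℝ) - 1) * Real.pi := by
  have hpi := Real.pi_pos
  have ha0 : 0 < a := by linarith
  -- Again l = 1 absorbs a negative c. With β = π/2 + lπ, label n means that the phase minus (l +
  -- n)π lies in (-π/2, π/2], so p = n + 1.
  obtain ⟨l, d, hd, hset, hcd, hl⟩ : ∃ (l : ℕ) (d : ℝ), 0 < d ∧
      rootSet a (Real.pi / 2 + l * Real.pi) d = rootSet a (Real.pi / 2) c ∧ c = (-1) ^ l * d ∧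
      ((0 < c ∧ l = 0) ∨ (c ≤ 0 ∧ l = 1)) := by
    rcases hc.lt_or_gt with h | h
    · exact ⟨1, -c, by linarith, by rw [← rootSet_add_pi a (Real.pi / 2) c]; simp, by simp, by simp [h.le]⟩
    · exact ⟨0, c, h, by simp, by simp, by simp [h]⟩
  obtain ⟨r, hr⟩ := exists_isIncreasingList_rootSet ha hd (Real.pi / 2 + l * Real.pi)
  have hr' := hset ▸ hr
  set β := Real.pi / 2 + l * Real.pi with hβ
  have hsgn : ((-1 : ℝ)) ^ l * (-1) ^ l = 1 := by rw [← mul_pow]; norm_num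
  have hamp : ∀ m, 1 ≤ m → leadingAmplitude a c (r m) = Real.sin (gtiPhase a (r m)) := by
    intro m hm
    have := (mem_of_isIncreasingList hr' hm).2
    rw [Real.cos_sub_pi_div_two] at this
    exact this.symm
  have hsin : ∀ m, 1 ≤ m → 0 < (-1) ^ l * Real.sin (gtiPhase a (r m)) := by
    intro m hm
    rw [← hamp m hm]
    have := leadingAmplitude_pos ha0 hd (mem_of_isIncreasingList hr hm).1
    have e : (-1) ^ l * leadingAmplitude a c (r m)
        = ((-1 : ℝ) ^ l * (-1) ^ l) * leadingAmplitude a d (r m) := by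
      rw [hcd, leadingAmplitude, leadingAmplitude]; ring
    rw [e, hsgn, one_mul]
    exact this
  have hlab : ∀ m, 1 ≤ m → 1 ≤ phaseLabel a β (r m) + 1 := by
    intro m hm
    obtain ⟨-, h2⟩ := phaseLabel_eq_iff.1 (rfl : phaseLabel a β (r m) = _)
    have h0 := gtiPhase_pos ha (mem_of_isIncreasingList hr hm).1
    by_contra! hcon
    have hu : phaseLabel a β (r m) ≤ -1 := by omega
    have hu' : (phaseLabel a β (r m) : ℝ) ≤ -1 := by exact_mod_cast hu
    have h3 : gtiPhase a (r m) ≤ l * Real.pi - Real.pi / 2 := by nlinarith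
    -- A label below 0 would make the phase negative when l = 0. When l = 1 it would put the phase
    -- in (0, π/2], where the sine has the wrong sign.
    rcases hl with ⟨-, rfl⟩ | ⟨-, rfl⟩
    · push_cast at h3
      linarith
    · push_cast at h3
      have h4 := Real.sin_pos_of_pos_of_lt_pi h0 (by linarith)
      have := hsin m hm
      linarith
  refine ⟨r, hr', l, _, ?_, isBranchNumbering_phaseLabel ha hd hr 1 hlab, fun m hm => ?_⟩
  · rw [Real.arcsin_pos, Real.arcsin_nonpos, hamp 1 le_rfl]
    have := hsin 1 le_rfl
    rcases hl with ⟨-, rfl⟩ | ⟨-, rfl⟩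
    · exact Or.inl ⟨by linarith, rfl⟩
    · exact Or.inr ⟨by linarith, rfl⟩
  · rw [hamp m hm]
    refine ⟨Real.abs_sin_le_one _, ?_⟩
    have hl := hlab m hm
    obtain ⟨h1, h2⟩ := phaseLabel_eq_iff.1 (rfl : phaseLabel a β (r m) = _)
    have hcast : (((phaseLabel a β (r m) + 1).toNat : ℕ) : ℝ) = phaseLabel a β (r m) + 1 := by
      have : (((phaseLabel a β (r m) + 1).toNat : ℕ) : ℤ) = phaseLabel a β (r m) + 1 := by omega
      exact_mod_cast this
    exact eq_arcsin_branch (by omega) (by rw [hcast]; linarith) (by rw [hcast]; linarith) (hsin m hm)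

end Branches

/-! ### Crude Stirling bound and smallness of χ away from 0. -/

section AmplitudeBound

/-- The function t^a e^{-st} is largest at t = a/s; this is log y ≤ y - 1 at y = st/a. -/
theorem Real.rpow_le_exp_mul {a s t : ℝ} (ha : 0 < a) (hs : 0 < s) (ht : 0 < t) :
    t ^ a ≤ (a / (s * Real.exp 1)) ^ a * Real.exp (s * t) := by
  have he := Real.exp_pos 1
  rw [Real.rpow_def_of_pos ht, Real.rpow_def_of_pos (by positivity), ← Real.exp_add, Real.exp_le_exp]
  have h := Real.log_le_sub_one_of_pos (show 0 < s * t / a by positivity)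
  rw [Real.log_div (by positivity) ha.ne', Real.log_mul hs.ne' ht.ne'] at h
  rw [Real.log_div ha.ne' (by positivity), Real.log_mul hs.ne' he.ne', Real.log_exp]
  have h2 := mul_le_mul_of_nonneg_right h ha.le
  have e : (s * t / a - 1) * a = s * t - a := by field_simp
  rw [e] at h2
  linarith

/-- Taking s = 9/10 in the preceding bound leaves e^{-t/10}, whose integral is the factor 10. -/
theorem Real.Gamma_add_one_le {a : ℝ} (ha : 0 < a) :
    Real.Gamma (a + 1) ≤ 10 * (a / (9 / 10 * Real.exp 1)) ^ a := by
  set M := (a / (9 / 10 * Real.exp 1)) ^ a with hM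
  rw [Real.Gamma_eq_integral (by linarith)]
  have h10 : (-(1 / 10) : ℝ) < 0 := by norm_num
  have hi : ∫ t in Set.Ioi (0 : ℝ), M * Real.exp (-(1 / 10) * t) = 10 * M := by
    rw [MeasureTheory.integral_const_mul, integral_exp_mul_Ioi h10]
    simp
    ring
  rw [← hi]
  refine MeasureTheory.setIntegral_mono_on (Real.GammaIntegral_convergent (by linarith))
    ((integrableOn_exp_mul_Ioi h10 0).const_mul M) measurableSet_Ioi fun t ht => ?_
  rw [add_sub_cancel_right]
  calc Real.exp (-t) * t ^ a ≤ Real.exp (-t) * (M * Real.exp (9 / 10 * t)) := by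
        gcongr; exact Real.rpow_le_exp_mul ha (by norm_num) ht
    _ = M * (Real.exp (-t) * Real.exp (9 / 10 * t)) := by ring
    _ = M * Real.exp (-(1 / 10) * t) := by rw [← Real.exp_add]; congr 2; ring

theorem leadingAmplitude_half_le {a : ℝ} (ha : 1 < a) :
    leadingAmplitude a (Real.Gamma a) (1 / 2) ≤ 20 * (9 / 10 : ℝ) ^ a := by
  have ha0 : 0 < a := by linarith
  rw [leadingAmplitude, ← Real.Gamma_add_one ha0.ne']
  have hs : Real.sqrt ((1 / 2 : ℝ) ^ 2 + 1) ≤ 2 := by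
    rw [Real.sqrt_le_left (by norm_num)]; norm_num
  have hz : 0 < (a * (1 / 2)) ^ a := Real.rpow_pos_of_pos (by positivity) _
  rw [div_le_iff₀ hz, mul_assoc, ← Real.mul_rpow (by norm_num) (by positivity)]
  have h1 := Real.Gamma_add_one_le ha0
  -- Amounts to (81/200) e ≥ 1, which e > 2.7 gives.
  have h2 : (a / (9 / 10 * Real.exp 1)) ^ a ≤ (9 / 10 * (a * (1 / 2))) ^ a := by
    refine Real.rpow_le_rpow (by positivity) ?_ ha0.le
    rw [div_le_iff₀ (by positivity)]
    have := Real.exp_one_gt_d9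
    nlinarith
  have h3 : 0 < Real.Gamma (a + 1) := Real.Gamma_pos_of_pos (by linarith)
  nlinarith [Real.sqrt_nonneg ((1 / 2 : ℝ) ^ 2 + 1)]

/-- For large parameters the leading amplitude is small on `[1/2, ∞)`. -/
theorem exists_abs_leadingAmplitude_le : ∃ A : ℝ, ∀ a c x : ℝ, A ≤ a → 1 < a → |c| ≤ Real.Gamma a →
    1 / 2 ≤ x → |leadingAmplitude a c x| ≤ 1 / 4 := by
  have h := tendsto_rpow_atTop_of_base_lt_one (9 / 10) (by norm_num) (by norm_num)
  obtain ⟨A, hA⟩ := Filter.eventually_atTop.1 (h.eventually_le_const (show (0 : ℝ) < 1 / 80 by norm_num))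
  refine ⟨A, fun a c x hAa ha hc hx => ?_⟩
  have ha0 : 0 < a := by linarith
  have hΓ := Real.Gamma_pos_of_pos ha0
  have hx0 : 0 < x := by linarith
  -- Only c = Γ(a) at x = 1/2 matters, as the amplitude scales with |c| and decreases in x.
  have h1 : |leadingAmplitude a c x| ≤ leadingAmplitude a (Real.Gamma a) x := by
    have := Real.rpow_pos_of_pos (mul_pos ha0 hx0) a
    rw [leadingAmplitude, leadingAmplitude, abs_div, abs_mul, abs_mul, abs_of_pos ha0, abs_of_pos this,
      abs_of_nonneg (Real.sqrt_nonneg _)]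
    gcongr
  have h2 := (strictAntiOn_leadingAmplitude ha hΓ).antitoneOn (show (1 / 2 : ℝ) ∈ Set.Ioi 0 by norm_num)
    hx0 hx
  have h3 := leadingAmplitude_half_le ha
  have h4 := hA a hAa
  linarith

end AmplitudeBound

/-! ### Uniform nondegeneracy and truncation of the expansion. -/

section NearZero

variable {a β c x : ℝ}

/-- The distance of ax - β to the ends of its half period is at least |cos(ax-β)|, because sin y ≤
y. -/
theorem halfPeriod_eq_of_abs_lt {θ : ℝ} (h : |a * θ - a * x| < |Real.cos (a * x - β)|) :
    halfPeriod a β θ = halfPeriod a β x := by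
  obtain ⟨h1, h2⟩ := halfPeriod_eq_iff.1 (rfl : halfPeriod a β x = _)
  set n := halfPeriod a β x
  have hb : |Real.cos (a * x - β)| = Real.cos (a * x - β - n * Real.pi) := by
    have h0 : 0 ≤ Real.cos (a * x - β - n * Real.pi) :=
      Real.cos_nonneg_of_mem_Icc ⟨by linarith, by linarith⟩
    rw [← abs_of_nonneg h0, Real.cos_sub_int_mul_pi]
    rcases Int.even_or_odd n with hn | hn <;> simp [hn.neg_one_zpow]
  set y := a * x - β - n * Real.pi
  have hl : Real.cos y ≤ y + Real.pi / 2 := by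
    rw [← Real.sin_add_pi_div_two]
    exact Real.sin_le (by linarith)
  have hr : Real.cos y ≤ Real.pi / 2 - y := by
    rw [← Real.sin_pi_div_two_sub]
    exact Real.sin_le (by linarith)
  rw [hb, abs_lt] at h
  exact halfPeriod_eq_iff.2 ⟨by linarith, by linarith⟩

theorem four_mul_abs_le_of_one_le {C S : ℝ} (hCS : C ^ 2 + S ^ 2 = 1) (hC : |C| ≤ 1 / 4) (hx : 1 ≤ x) :
    1 / 4 * x ≤ |S * x - C| := by
  have hS : 3 / 4 ≤ |S| := by
    rw [← sq_abs C, ← sq_abs S] at hCS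
    nlinarith [abs_nonneg C, abs_nonneg S]
  have h1 : |S * x| - |C| ≤ |S * x - C| := abs_sub_abs_le_abs_sub _ _
  rw [abs_mul, abs_of_pos (by linarith : 0 < x)] at h1
  nlinarith

/-- For x ≥ 1 nondegeneracy is automatic in the stronger form |Sx-C| ≥ x/4, so min(1, x) may be
replaced by x. -/
theorem nondegenerate_mul_le {δ : ℝ} (hx : x ∈ rootSet a β c)
    (hχ : 1 / 2 ≤ x → |leadingAmplitude a c x| ≤ 1 / 4)
    (hD : δ * min 1 x ≤ |Real.sin (gtiPhase a x - β) * x - leadingAmplitude a c x|) :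
    min δ (1 / 4) * x ≤ |Real.sin (gtiPhase a x - β) * x - leadingAmplitude a c x| := by
  have hx0 := hx.1
  rcases le_total x 1 with h | h
  · rw [min_eq_right h] at hD
    exact (mul_le_mul_of_nonneg_right (min_le_left _ _) hx0.le).trans hD
  · refine (mul_le_mul_of_nonneg_right (min_le_right _ _) hx0.le).trans
      (four_mul_abs_le_of_one_le ?_ (hχ (by linarith)) h)
    rw [← hx.2, Real.cos_sq_add_sin_sq]

/-- Truncation of the expansion, expressed through the coefficients `expansionCoeff`. -/
theorem abs_sub_zeroApprox_le {C S K ζ : ℝ} {N : ℕ} {M : ℕ → ℝ} {e : ℕ → ℝ → ℝ → ℝ} (hN : 1 ≤ N)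
    (hx0 : 0 < x) (hCS : C ^ 2 + S ^ 2 = 1) (hD0 : S * x - C ≠ 0) (ha1' : 1 ≤ a) (hK0 : 0 ≤ K)
    (hM : ∀ k, |MvPolynomial.eval (zeroParam x C S) (correctionCoeff k)| ≤ M k)
    (hζ3 : |ζ - ∑ j ∈ Finset.Icc 1 (N + 2),
      MvPolynomial.eval (zeroParam x C S) (correctionCoeff j) * a⁻¹ ^ j| ≤ K * a⁻¹ ^ (N + 3))
    (he : ∀ k, e k a x = expansionCoeff k x C S) :
    |x + x / (1 + x ^ 2) * ζ * a⁻¹ - zeroApprox e N a x|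
      ≤ (K + ∑ k ∈ Finset.Ioc N (N + 3), |M (k - 1)|) / a ^ (N + 1) := by
  have hn : 0 < 1 + x ^ 2 := by positivity
  have hinv : 0 < a⁻¹ := inv_pos.2 (by linarith)
  have hω : x / (1 + x ^ 2) ≤ 1 := by rw [div_le_one hn]; nlinarith [sq_nonneg (x - 1)]
  have hω0 : 0 < x / (1 + x ^ 2) := by positivity
  have hq : ∀ k, expansionCoeff k x C S
      = x / (1 + x ^ 2) * MvPolynomial.eval (zeroParam x C S) (correctionCoeff (k - 1)) :=
    expansionCoeff_eq hx0 hD0 hCS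
  have hsplit : zeroApprox e N a x = x + x / (1 + x ^ 2) * a⁻¹ *
        ∑ j ∈ Finset.Icc 1 (N + 2), MvPolynomial.eval (zeroParam x C S) (correctionCoeff j) * a⁻¹ ^ j
      - ∑ k ∈ Finset.Ioc N (N + 3), expansionCoeff k x C S / a ^ k := by
    -- The correction is known to order N + 2 in ζ, that is N + 3 in θ; the terms beyond N are
    -- bounded and go into the constant.
    have h1 : ∑ k ∈ Finset.Icc 2 (N + 3), expansionCoeff k x C S / a ^ k
        = x / (1 + x ^ 2) * a⁻¹ *
        ∑ j ∈ Finset.Icc 1 (N + 2), MvPolynomial.eval (zeroParam x C S) (correctionCoeff j) * a⁻¹ ^ j := by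
      have := Finset.sum_image (f := fun k => expansionCoeff k x C S / a ^ k)
        (s := Finset.Icc 1 (N + 2)) (g := (· + 1)) (by simp)
      rw [Finset.image_add_right_Icc] at this
      rw [this, Finset.mul_sum]
      refine Finset.sum_congr rfl fun j _ => ?_
      rw [hq, Nat.add_sub_cancel, inv_pow, pow_succ]
      field_simp
      ring
    have h2 : ∑ k ∈ Finset.Icc 2 (N + 3), expansionCoeff k x C S / a ^ k
        = ∑ k ∈ Finset.Icc 2 N, expansionCoeff k x C S / a ^ k
          + ∑ k ∈ Finset.Ioc N (N + 3), expansionCoeff k x C S / a ^ k := by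
      rw [← Finset.sum_union (Finset.disjoint_left.2 fun k h h' => by
        rw [Finset.mem_Icc] at h; rw [Finset.mem_Ioc] at h'; omega)]
      congr 1
      ext k
      simp only [Finset.mem_union, Finset.mem_Icc, Finset.mem_Ioc]
      omega
    rw [← h1, h2, zeroApprox]
    simp only [he]
    ring
  rw [hsplit, add_div, Finset.sum_div]
  have hrw : ∀ P T : ℝ, x + x / (1 + x ^ 2) * ζ * a⁻¹ - (x + x / (1 + x ^ 2) * a⁻¹ * P - T)
      = x / (1 + x ^ 2) * a⁻¹ * (ζ - P) + T := fun P T => by ring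
  rw [hrw]
  refine (abs_add_le _ _).trans (add_le_add ?_ ((Finset.abs_sum_le_sum_abs _ _).trans
    (Finset.sum_le_sum fun k hk => ?_)))
  · rw [abs_mul, abs_mul, abs_of_pos hω0, abs_of_pos hinv]
    have h3 : a⁻¹ ^ (N + 3) ≤ a⁻¹ ^ N :=
      pow_le_pow_of_le_one hinv.le (inv_le_one_of_one_le₀ ha1') (by omega)
    calc _ ≤ 1 * a⁻¹ * (K * a⁻¹ ^ N) := by
          gcongr
          exact hζ3.trans (by gcongr)
      _ = K / a ^ (N + 1) := by rw [inv_pow, pow_succ]; field_simp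
  · rw [abs_div, abs_of_pos (show 0 < a ^ k by positivity), hq, abs_mul, abs_of_pos hω0]
    rw [Finset.mem_Ioc] at hk
    have h5 : x / (1 + x ^ 2) * |MvPolynomial.eval (zeroParam x C S) (correctionCoeff (k - 1))|
        ≤ 1 * |M (k - 1)| :=
      mul_le_mul hω ((hM (k - 1)).trans (le_abs_self _)) (abs_nonneg _) zero_le_one
    rw [one_mul] at h5
    have h6 : a ^ (N + 1) ≤ a ^ k := pow_le_pow_right₀ ha1' (by omega)
    gcongr

/-- Near every nondegenerate root, in the same half period, there is a zero with the asserted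
expansion. -/
theorem exists_zero_near_root_of_nondegenerate {δ : ℝ} (hδ : 0 < δ) {N : ℕ} (hN : 1 ≤ N) :
    ∃ A K : ℝ, ∀ a β c x : ℝ, A ≤ a → |c| ≤ Real.Gamma a → x ∈ rootSet a β c →
      δ * min 1 x ≤ |Real.sin (gtiPhase a x - β) * x - leadingAmplitude a c x| →
      ∃ θ ∈ zeroSet a β c, halfPeriod a β θ = halfPeriod a β x ∧
        |θ - zeroApprox (fun k a x => expansionCoeff k x (leadingAmplitude a c x)
          (Real.sin (gtiPhase a x - β))) N a x| ≤ K / a ^ (N + 1) := by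
  set δ' := min δ (1 / 4) with hδ'
  have hδ0 : 0 < δ' := lt_min hδ (by norm_num)
  obtain ⟨A₁, hA₁⟩ := exists_abs_leadingAmplitude_le
  obtain ⟨A₂, K, hA4, hK0, hK⟩ := exists_zero_near_root N hδ0
  choose M hM using fun k => MvPolynomial.exists_abs_eval_le (correctionCoeff k) (max 1 (1 / δ'))
  -- The last two thresholds give K/a ≤ 1/2, which keeps θ positive, and K/a < δ', which keeps it in
  -- the half period of x.
  refine ⟨max (max A₁ A₂) (max (2 * K) (K / δ' + 1)),
    K + ∑ k ∈ Finset.Ioc N (N + 3), |M (k - 1)|, fun a β c x ha hc hx hD => ?_⟩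
  have ha1 : A₁ ≤ a := (le_max_left _ _).trans ((le_max_left _ _).trans ha)
  have ha2 : A₂ ≤ a := (le_max_right _ _).trans ((le_max_left _ _).trans ha)
  have ha3 : 2 * K ≤ a := (le_max_left _ _).trans ((le_max_right _ _).trans ha)
  have ha4 : K / δ' + 1 ≤ a := (le_max_right _ _).trans ((le_max_right _ _).trans ha)
  have ha0 : 4 ≤ a := hA4.trans ha2
  have hD' := nondegenerate_mul_le hx (hA₁ a c x ha1 (by linarith) hc) hD
  obtain ⟨hx0, hroot⟩ := hx
  set C := leadingAmplitude a c x
  set S := Real.sin (gtiPhase a x - β) with hSdef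
  have hCS : C ^ 2 + S ^ 2 = 1 := by rw [← hroot, hSdef, Real.cos_sq_add_sin_sq]
  have hD0 : S * x - C ≠ 0 := by
    intro h0
    rw [h0, abs_zero] at hD'
    nlinarith
  obtain ⟨ζ, hζ1, hζ2, hζ3⟩ := hK a β c x C S ha2 hx0 hroot rfl rfl hD'
  have hn : 0 < 1 + x ^ 2 := by positivity
  have hinv : 0 < a⁻¹ := inv_pos.2 (by linarith)
  have hω0 : 0 < x / (1 + x ^ 2) := by positivity
  set θ := x + x / (1 + x ^ 2) * ζ * a⁻¹ with hθ
  have haθ : a * θ = a * x + x / (1 + x ^ 2) * ζ := by rw [hθ]; field_simp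
  have hKa : K * a⁻¹ ≤ 1 / 2 := by
    rw [← div_eq_mul_inv, div_le_iff₀ (by linarith)]; linarith
  refine ⟨θ, ⟨?_, by rw [haθ]; exact hζ2⟩, halfPeriod_eq_of_abs_lt ?_, ?_⟩
  · have h1 : |x / (1 + x ^ 2) * ζ * a⁻¹| ≤ x * (1 / 2) := by
      rw [abs_mul, abs_mul, abs_of_pos hω0, abs_of_pos hinv, mul_assoc]
      have : x / (1 + x ^ 2) ≤ x := div_le_self hx0.le (by nlinarith)
      have h2 : |ζ| * a⁻¹ ≤ 1 / 2 * 1 := by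
        gcongr
        · linarith
        · exact inv_le_one_of_one_le₀ (by linarith)
      rw [mul_one] at h2
      gcongr
    have := neg_abs_le (x / (1 + x ^ 2) * ζ * a⁻¹)
    rw [hθ]
    linarith
  · obtain ⟨hcos, -⟩ := cos_sin_of_phase hroot hSdef.symm
    have hs1 : 1 ≤ Real.sqrt (1 + x ^ 2) := Real.one_le_sqrt.2 (by nlinarith)
    rw [haθ, add_sub_cancel_left, hcos, abs_div, abs_neg, abs_of_pos (by linarith : 0 < Real.sqrt (1 + x ^ 2)),
      abs_mul, abs_of_pos hω0]
    have h1 : |ζ| < δ' := by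
      refine hζ1.trans_lt ?_
      rw [← div_eq_mul_inv, div_lt_comm₀ (by linarith) hδ0]
      linarith
    -- The shift ω|ζ| of aθ stays below |Sx-C|/√(1+x²) = |cos(ax-β)|.
    calc x / (1 + x ^ 2) * |ζ| < x / (1 + x ^ 2) * δ' := by gcongr
      _ ≤ x / Real.sqrt (1 + x ^ 2) * δ' := by
          gcongr
          rw [Real.sqrt_le_left hn.le]
          nlinarith [sq_nonneg x]
      _ = δ' * x / Real.sqrt (1 + x ^ 2) := by ring
      _ ≤ _ := by gcongr
  · exact abs_sub_zeroApprox_le hN hx0 hCS hD0 (by linarith) hK0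
      (fun k => hM k _ (abs_zeroParam_le hδ0 hx0 hCS hD')) hζ3 (fun k => rfl)

end NearZero

/-! ### Zeros and roots share the same half periods. -/

section Matching

variable {a β c x : ℝ}

theorem cayley_cube_re (θ : ℝ) :
    (cayley θ ^ 3).re = (1 / (1 + θ ^ 2)) ^ 3 * (1 - 3 * θ ^ 2) := by
  rw [cayley_eq]
  have hn : 0 < 1 + θ ^ 2 := by positivity
  rw [show θ / (1 + θ ^ 2) = θ * (1 / (1 + θ ^ 2)) by ring]
  generalize 1 / (1 + θ ^ 2) = ρ
  simp only [pow_succ, pow_zero, one_mul, Complex.mul_re, Complex.mul_im, Complex.sub_re,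
    Complex.sub_im, Complex.ofReal_re, Complex.ofReal_im, Complex.I_re, Complex.I_im]
  ring

/-- At the small maxima of the phase, the rescaled oscillatory integral lies strictly below its
leading term. -/
theorem exists_scaled_oscIntegral_lt : ∃ A : ℝ, ∀ a β θ : ℝ, A ≤ a → 0 < θ → θ ≤ 1 / 2 →
    Real.cos (a * θ - β) = 0 → Real.sin (a * θ - β) = 1 →
    Real.sqrt (1 + θ ^ 2) * a / (a * θ) ^ a * oscIntegral a β (a * θ) < θ / Real.sqrt (1 + θ ^ 2) := by
  obtain ⟨K, hK0, hK⟩ := oscIntegral_expansion 0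
  obtain ⟨L, hL0, hL⟩ := exists_norm_eval_le (gammaPoly 1)
  refine ⟨max 4 (8 * (K + L) + 1), fun a β θ ha hθ hθ2 hcos hsin => ?_⟩
  have ha4 : 4 ≤ a := (le_max_left _ _).trans ha
  have haK : 8 * (K + L) + 1 ≤ a := (le_max_right _ _).trans ha
  have hinv : 0 < a⁻¹ := inv_pos.2 (by linarith)
  have hmain := hK a β θ ha4 hθ
  have hn : 0 < 1 + θ ^ 2 := by positivity
  have hs1 : 1 ≤ Real.sqrt (1 + θ ^ 2) := Real.one_le_sqrt.2 (by nlinarith)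
  have h0 : (Complex.exp (Complex.I * ((a * θ - β - Real.arctan θ : ℝ) : ℂ))
      * (gammaTerm 0).eval (cayley θ)).re = θ / Real.sqrt (1 + θ ^ 2) := by
    rw [gammaTerm, Polynomial.eval_one, mul_one, mul_comm, Complex.exp_mul_I, ← Complex.ofReal_cos,
      ← Complex.ofReal_sin, Complex.add_re, Complex.ofReal_re, Complex.re_ofReal_mul, Complex.I_re,
      Real.cos_sub, hcos, hsin, Real.sin_arctan]
    ring
  -- At such a point e^{i(aθ-β)} = i.
  have hexp : Complex.exp (Complex.I * ((a * θ - β - Real.arctan θ : ℝ) : ℂ))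
      = Complex.I * ((Real.sqrt (1 + θ ^ 2) : ℝ) * cayley θ) := by
    rw [← exp_I_mul_cayley, mul_comm Complex.I ((a * θ - β : ℝ) : ℂ), Complex.exp_mul_I,
      ← Complex.ofReal_cos, ← Complex.ofReal_sin, hcos, hsin]
    simp
  -- The first correction is -√(1+θ²) θ Re w³, and Re w³ = ρ³(1-3θ²) ≥ (4/5)³/4 > 1/8 for θ ≤ 1/2.
  -- All later errors are O(θ/a²), so this negative term of order θ/a dominates uniformly down to θ
  -- = 0.
  have h1 : (Complex.exp (Complex.I * ((a * θ - β - Real.arctan θ : ℝ) : ℂ))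
      * (gammaTerm 1).eval (cayley θ)).re ≤ -(θ / 8) := by
    have e : Complex.exp (Complex.I * ((a * θ - β - Real.arctan θ : ℝ) : ℂ))
        * (gammaTerm 1).eval (cayley θ)
        = ((-(Real.sqrt (1 + θ ^ 2) * θ) : ℝ) : ℂ) * cayley θ ^ 3 := by
      rw [hexp, gammaTerm, gammaPoly]
      simp only [Polynomial.eval_mul, Polynomial.eval_sub, Polynomial.eval_one, Polynomial.eval_X, mul_one]
      rw [one_sub_cayley]
      push_cast
      linear_combination (Real.sqrt (1 + θ ^ 2) * cayley θ ^ 3 * θ : ℂ) * Complex.I_sq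
    rw [e, Complex.re_ofReal_mul, cayley_cube_re]
    have h2 : 4 / 5 ≤ 1 / (1 + θ ^ 2) := by
      rw [div_le_div_iff₀ (by norm_num) hn]; nlinarith
    have h3 : (4 / 5 : ℝ) ^ 3 * (1 / 4) ≤ (1 / (1 + θ ^ 2)) ^ 3 * (1 - 3 * θ ^ 2) := by
      gcongr
      nlinarith
    have h4 : 1 * θ * (1 / 8) ≤ Real.sqrt (1 + θ ^ 2) * θ * ((1 / (1 + θ ^ 2)) ^ 3 * (1 - 3 * θ ^ 2)) := by
      have : (1 / 8 : ℝ) ≤ (1 / (1 + θ ^ 2)) ^ 3 * (1 - 3 * θ ^ 2) := by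
        refine le_trans (by norm_num) h3
      gcongr
    linarith
  have h2 : (Complex.exp (Complex.I * ((a * θ - β - Real.arctan θ : ℝ) : ℂ))
      * (gammaTerm 2).eval (cayley θ)).re ≤ L * θ := by
    refine (Complex.re_le_norm _).trans ?_
    have hW : ‖cayley θ‖ ≤ 1 := norm_cayley_le_one θ
    rw [norm_mul, mul_comm Complex.I, Complex.norm_exp_ofReal_mul_I, one_mul, gammaTerm]
    simp only [Polynomial.eval_mul, Polynomial.eval_sub, Polynomial.eval_one, Polynomial.eval_X]
    rw [one_sub_cayley, norm_mul, norm_mul, norm_mul, norm_mul, Complex.norm_I, Complex.norm_real,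
      Real.norm_of_nonneg hθ.le]
    have := hL _ hW
    calc _ ≤ 1 * (θ * 1 * 1) * L := by gcongr
      _ = L * θ := by ring
  have h3 : K * a⁻¹ ^ (0 + 3) * (θ / (1 + θ ^ 2)) ≤ K * a⁻¹ ^ 2 * θ := by
    have e1 : a⁻¹ ^ (0 + 3) ≤ a⁻¹ ^ 2 :=
      pow_le_pow_of_le_one hinv.le (inv_le_one_of_one_le₀ (by linarith)) (by norm_num)
    have e2 : θ / (1 + θ ^ 2) ≤ θ := div_le_self hθ.le (by nlinarith)
    gcongr
  rw [Finset.sum_range_succ, Finset.sum_range_succ, Finset.sum_range_one, h0] at hmain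
  have h4 := (abs_le.1 hmain).2
  have h5 := mul_le_mul_of_nonneg_left h1 hinv.le
  have h6 := mul_le_mul_of_nonneg_left h2 (sq_nonneg a⁻¹)
  have h7 : a⁻¹ * (K + L) < 1 / 8 := by
    rw [inv_mul_lt_iff₀ (by linarith)]; linarith
  have h8 := mul_lt_mul_of_pos_left h7 (mul_pos hinv hθ)
  simp only [pow_zero, pow_one, one_mul] at h4
  nlinarith

/-- At a zero of `cos(aθ-β)` the equation for the roots inherits its sign from the equation for the
zeros. -/
theorem exists_sign_of_cos_eq_zero : ∃ A : ℝ, ∀ a β c θ : ℝ, A ≤ a → 1 < a → 0 < c → c ≤ Real.Gamma a →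
    0 < θ → Real.cos (a * θ - β) = 0 → Real.sin (a * θ - β) * (c - oscIntegral a β (a * θ)) ≤ 0 →
    Real.sin (a * θ - β) * (leadingAmplitude a c θ - Real.cos (gtiPhase a θ - β)) < 0 := by
  obtain ⟨A₁, hA₁⟩ := exists_scaled_oscIntegral_lt
  obtain ⟨A₂, hA₂⟩ := exists_abs_leadingAmplitude_le
  refine ⟨max A₁ A₂, fun a β c θ hA ha hc hcΓ hθ hcos hG => ?_⟩
  have ha0 : 0 < a := by linarith
  have hs0 : 0 < Real.sqrt (1 + θ ^ 2) := Real.sqrt_pos.2 (by positivity)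
  have hχ := leadingAmplitude_pos ha0 hc hθ
  have hphase : Real.cos (gtiPhase a θ - β) = Real.sin (a * θ - β) * (θ / Real.sqrt (1 + θ ^ 2)) := by
    rw [show gtiPhase a θ - β = (a * θ - β) - Real.arctan θ by rw [gtiPhase]; ring, Real.cos_sub, hcos,
      zero_mul, zero_add, Real.sin_arctan]
  have hr : 0 < θ / Real.sqrt (1 + θ ^ 2) := by positivity
  rw [hphase]
  -- If sin = 1, compare with the integral for θ ≤ 1/2, and use χ ≤ 1/4 < 1/3 ≤ θ/√(1+θ²) beyond. If
  -- sin = -1, then cos(φ-β) < 0 < χ settles it at once.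
  rcases mul_self_eq_one_iff.1 (show Real.sin (a * θ - β) * Real.sin (a * θ - β) = 1 by
    have := Real.sin_sq_add_cos_sq (a * θ - β); rw [hcos] at this; linarith) with h | h
  · rw [h, one_mul] at hG
    rw [h, one_mul, one_mul]
    rcases le_total θ (1 / 2) with h2 | h2
    · have h3 := hA₁ a β θ ((le_max_left _ _).trans hA) hθ h2 hcos h
      have hz : 0 < (a * θ) ^ a := Real.rpow_pos_of_pos (by positivity) _
      have h4 : leadingAmplitude a c θ = Real.sqrt (1 + θ ^ 2) * a / (a * θ) ^ a * c := by
        rw [leadingAmplitude, add_comm]; ring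
      have h5 : Real.sqrt (1 + θ ^ 2) * a / (a * θ) ^ a * c
          ≤ Real.sqrt (1 + θ ^ 2) * a / (a * θ) ^ a * oscIntegral a β (a * θ) := by
        gcongr; linarith
      linarith
    · have h3 := hA₂ a c θ ((le_max_right _ _).trans hA) ha (by rwa [abs_of_pos hc]) h2
      rw [abs_of_pos hχ] at h3
      have h4 : 1 / 3 ≤ θ / Real.sqrt (1 + θ ^ 2) := by
        rw [div_le_div_iff₀ (by norm_num) hs0, one_mul, Real.sqrt_le_left (by positivity)]
        nlinarith
      linarith
  · rw [h]
    linarith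

theorem exists_one_lt_leadingAmplitude (ha : 1 < a) (hc : 0 < c) {b : ℝ} (hb : 0 < b) :
    ∃ t, 0 < t ∧ t < b ∧ 1 < leadingAmplitude a c t := by
  have ha0 : 0 < a := by linarith
  have hcont : Continuous fun t : ℝ => (a * t) ^ a :=
    (Real.continuous_rpow_const ha0.le).comp (continuous_const.mul continuous_id)
  have h := (hcont.tendsto 0).eventually_lt_const (u := a * c) (by
    simp only [mul_zero]; rw [Real.zero_rpow ha0.ne']; positivity)
  obtain ⟨t, ht, ht0, htb⟩ := ((h.filter_mono nhdsWithin_le_nhds).and (Ioo_mem_nhdsGT hb)).exists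
  refine ⟨t, ht0, htb, ?_⟩
  rw [leadingAmplitude, lt_div_iff₀ (Real.rpow_pos_of_pos (mul_pos ha0 ht0) _), one_mul]
  have : 1 ≤ Real.sqrt (t ^ 2 + 1) := Real.one_le_sqrt.2 (by nlinarith)
  have : 0 < a * c := by positivity
  nlinarith

theorem neg_one_zpow_mul_self (n : ℤ) : ((-1 : ℝ) ^ n) * (-1) ^ n = 1 := by
  rcases Int.even_or_odd n with h | h <;> simp [h.neg_one_zpow]

theorem sign_mul_oscIntegral_sub_pos (ha : 1 < a) {n : ℤ} {z w : ℝ} (hz : 0 ≤ z) (hzw : z < w)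
    (h1 : n * Real.pi - Real.pi / 2 ≤ z - β) (h2 : w - β ≤ n * Real.pi + Real.pi / 2) :
    0 < (-1) ^ n * (oscIntegral a β w - oscIntegral a β z) := by
  obtain ⟨t, ht, hte⟩ := exists_hasDerivAt_eq_slope _ _ hzw (continuous_oscIntegral ha β).continuousOn
    (fun t _ => hasDerivAt_oscIntegral ha β t)
  rw [eq_div_iff (by linarith)] at hte
  rw [← hte]
  have hcos := Real.cos_pos_of_mem_Ioo (x := t - β - n * Real.pi) ⟨by linarith [ht.1], by linarith [ht.2]⟩
  rw [Real.cos_sub_int_mul_pi] at hcos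
  have := Real.rpow_pos_of_pos (hz.trans_lt ht.1) (a - 1)
  have h3 := mul_pos (mul_pos hcos this) (sub_pos.2 hzw)
  nlinarith

/-- For large parameters the half period of every zero contains a root. -/
theorem exists_root_halfPeriod : ∃ A : ℝ, ∀ a β c z : ℝ, A ≤ a → 1 < a → 0 < c → c ≤ Real.Gamma a →
    z ∈ zeroSet a β c → ∃ x ∈ rootSet a β c, halfPeriod a β x = halfPeriod a β z := by
  obtain ⟨A, hA⟩ := exists_sign_of_cos_eq_zero
  refine ⟨A, fun a β c z hAa ha hc hcΓ hz => ?_⟩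
  have ha0 : 0 < a := by linarith
  obtain ⟨h1, h2⟩ := halfPeriod_eq_iff.1 (rfl : halfPeriod a β z = _)
  set n := halfPeriod a β z
  have hsq := neg_one_zpow_mul_self n
  set L := (β + n * Real.pi - Real.pi / 2) / a with hL
  set R := (β + n * Real.pi + Real.pi / 2) / a with hR
  have haL : a * L - β = n * Real.pi - Real.pi / 2 := by rw [hL]; field_simp; ring
  have haR : a * R - β = n * Real.pi + Real.pi / 2 := by rw [hR]; field_simp; ring
  have hzR : z < R := by nlinarith
  have hLz : L ≤ z := by nlinarith
  have haz0 : 0 < a * z := mul_pos ha0 hz.1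
  -- I is monotone on the half period and equals c at z, so the sign of c - I at either end is
  -- known; the sign lemma passes it on to χ - cos.
  have hRs : (-1) ^ n * (leadingAmplitude a c R - Real.cos (gtiPhase a R - β)) < 0 := by
    have hs : Real.sin (a * R - β) = (-1) ^ n := by
      rw [haR, Real.sin_add_pi_div_two, Real.cos_int_mul_pi]
    rw [← hs]
    refine hA a β c R hAa ha hc hcΓ (hz.1.trans hzR) ?_ ?_
    · rw [haR, Real.cos_add_pi_div_two, Real.sin_int_mul_pi, neg_zero]
    · have h3 := sign_mul_oscIntegral_sub_pos ha haz0.le (show a * z < a * R by nlinarith) h1 haR.le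
      rw [hz.2] at h3
      rw [hs]
      linarith
  obtain ⟨t, ht0, hLt, htR, htG⟩ : ∃ t, 0 < t ∧ L ≤ t ∧ t < R ∧
      0 < (-1) ^ n * (leadingAmplitude a c t - Real.cos (gtiPhase a t - β)) := by
    rcases lt_or_ge 0 L with hL0 | hL0
    · refine ⟨L, hL0, le_rfl, hLz.trans_lt hzR, ?_⟩
      have hs : Real.sin (a * L - β) = -(-1) ^ n := by
        rw [haL, Real.sin_sub_pi_div_two, Real.cos_int_mul_pi]
      have := hA a β c L hAa ha hc hcΓ hL0
        (by rw [haL, Real.cos_sub_pi_div_two, Real.sin_int_mul_pi]) (by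
          rw [hs]
          rcases hLz.eq_or_lt with he | hlt
          · rw [he, hz.2]; simp
          · have h3 := sign_mul_oscIntegral_sub_pos ha (mul_pos ha0 hL0).le
              (show a * L < a * z by nlinarith) haL.ge h2.le
            rw [hz.2] at h3
            linarith)
      rw [hs] at this
      linarith
    -- The left end is not positive. Then I goes monotonically from 0 to c > 0, so n is even, and
    -- near 0 the amplitude exceeds 1 ≥ cos, which replaces the endpoint sign.
    · have h3 := sign_mul_oscIntegral_sub_pos (β := β) (n := n) ha le_rfl haz0 (by nlinarith) h2.le
      rw [hz.2, oscIntegral_zero, sub_zero] at h3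
      have h4 : (-1 : ℝ) ^ n = 1 := by
        rcases Int.even_or_odd n with h | h
        · exact h.neg_one_zpow
        · rw [h.neg_one_zpow] at h3; linarith
      obtain ⟨t, ht0, htR, ht1⟩ := exists_one_lt_leadingAmplitude ha hc (hz.1.trans hzR)
      refine ⟨t, ht0, hL0.trans ht0.le, htR, ?_⟩
      rw [h4]
      linarith [Real.cos_le_one (gtiPhase a t - β)]
  have hcont : ContinuousOn (fun x => (-1) ^ n * (leadingAmplitude a c x - Real.cos (gtiPhase a x - β)))
      (Set.Icc t R) :=
    continuousOn_const.mul (((continuousOn_leadingAmplitude ha0 c).mono fun x hx => ht0.trans_le hx.1).sub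
      (Real.continuous_cos.comp ((continuous_gtiPhase a).sub continuous_const)).continuousOn)
  obtain ⟨x, hx, hx0⟩ := intermediate_value_Ioo' htR.le hcont (show (0 : ℝ) ∈ _ from ⟨hRs, htG⟩)
  have h5 := (mul_eq_zero.1 hx0).resolve_left (by intro h; rw [h] at hsq; simp at hsq)
  refine ⟨x, ⟨ht0.trans hx.1, (sub_eq_zero.1 h5).symm⟩, halfPeriod_eq_iff.2 ⟨?_, ?_⟩⟩
  · rw [← haL]; nlinarith [hx.1]
  · rw [← haR]; nlinarith [hx.2]

/-- A differentiable function with positive derivative at each of its zeros has at most one zero. -/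
theorem eq_of_deriv_pos_at_zeros {f f' : ℝ → ℝ} {x y : ℝ} (hxy : x ≤ y)
    (hf : ∀ t ∈ Set.Icc x y, HasDerivAt f (f' t) t) (hpos : ∀ t ∈ Set.Icc x y, f t = 0 → 0 < f' t)
    (hx : f x = 0) (hy : f y = 0) : x = y := by
  by_contra hne
  have hlt : x < y := lt_of_le_of_ne hxy hne
  have hx' : x ∈ Set.Icc x y := ⟨le_rfl, hxy⟩
  obtain ⟨p, hxp, hpy, hp⟩ := (hf x hx').exists_gt_of_pos (hpos x hx' hx) hlt
  rw [hx] at hp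
  have hcont : ContinuousOn f (Set.Icc p y) := fun t ht =>
    (hf t ⟨hxp.le.trans ht.1, ht.2⟩).continuousAt.continuousWithinAt
  have hcomp : IsCompact (Set.Icc p y ∩ f ⁻¹' Set.Iic 0) :=
    isCompact_Icc.of_isClosed_subset (hcont.preimage_isClosed_of_isClosed isClosed_Icc isClosed_Iic)
      Set.inter_subset_left
  -- At the first return s to nonpositive values f vanishes, yet a positive derivative at s makes f
  -- negative just before it.
  obtain ⟨s, ⟨hs, hs0⟩, hmin⟩ := hcomp.exists_isLeast ⟨y, ⟨hpy.le, le_rfl⟩, hy.le⟩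
  have hs0 : f s ≤ 0 := hs0
  have hps : p < s := lt_of_le_of_ne hs.1 fun h => by rw [← h] at hs0; linarith
  have hpos' : ∀ t, p ≤ t → t < s → 0 < f t := by
    intro t hpt hts
    by_contra! hcon
    exact absurd (hmin ⟨⟨hpt, hts.le.trans hs.2⟩, hcon⟩) (not_le.2 hts)
  have hs' : s ∈ Set.Icc x y := ⟨hxp.le.trans hs.1, hs.2⟩
  have hfs : f s = 0 := by
    refine le_antisymm hs0 ?_
    obtain ⟨t, ht, ht0⟩ := intermediate_value_Icc' hps.le (hcont.mono (Set.Icc_subset_Icc_right hs.2))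
      (show (0 : ℝ) ∈ _ from ⟨hs0, hp.le⟩)
    rcases ht.2.eq_or_lt with h | h
    · rw [← h, ht0]
    · exact absurd ht0 (hpos' t ht.1 h).ne'
  have hd : HasDerivAt (fun t => -f (-t)) (f' s) (-s) := by
    have h1 : HasDerivAt f (f' s) (-(-s)) := by rw [neg_neg]; exact hf s hs'
    exact ((h1.comp (-s) (hasDerivAt_neg (-s))).neg).congr_deriv (by ring)
  obtain ⟨t, ht1, ht2, ht3⟩ := hd.exists_gt_of_pos (hpos s hs' hfs) (show -s < -p by linarith)
  rw [neg_neg, hfs] at ht3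
  have := hpos' (-t) (by linarith) (by linarith)
  linarith

/-- Within a half period the sign of St - C = -√(1+t²) cos(at-β) is fixed. At every root there, χ -
cos(φ-β), suitably signed, has derivative (a/t)|St-C| up to an error of at most 1, hence at least aδ
- 1 > 0. Zeros all crossed in the same direction cannot be repeated. -/
theorem injOn_halfPeriod_rootSet {δ : ℝ} (hδ : 0 < δ) (ha : 1 < a) (haδ : 1 < a * δ)
    (hnd : ∀ x ∈ rootSet a β c,
      δ * x ≤ |Real.sin (gtiPhase a x - β) * x - leadingAmplitude a c x|) :
    Set.InjOn (halfPeriod a β) (rootSet a β c) := by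
  have ha0 : 0 < a := by linarith
  have key : ∀ x ∈ rootSet a β c, ∀ y ∈ rootSet a β c, x ≤ y →
      halfPeriod a β x = halfPeriod a β y → x = y := by
    intro x hx y hy hxy h
    obtain ⟨h1, -⟩ := halfPeriod_eq_iff.1 h
    obtain ⟨-, h2⟩ := halfPeriod_eq_iff.1 (rfl : halfPeriod a β y = _)
    set n := halfPeriod a β y
    have hsq := neg_one_zpow_mul_self n
    have hd : ∀ t ∈ Set.Icc x y, HasDerivAt
        (fun t => -(-1) ^ n * (leadingAmplitude a c t - Real.cos (gtiPhase a t - β)))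
        (-(-1) ^ n * (-(leadingAmplitude a c t * (a / t - t / (1 + t ^ 2)))
          - (-Real.sin (gtiPhase a t - β) * (a - 1 / (1 + t ^ 2))))) t := fun t ht =>
      ((hasDerivAt_leadingAmplitude ha0 c (hx.1.trans_le ht.1)).sub
        ((hasDerivAt_gtiPhase a t).sub_const β).cos).const_mul _
    refine eq_of_deriv_pos_at_zeros hxy hd (fun t ht ht0 => ?_)
      (by rw [hx.2, sub_self, mul_zero]) (by rw [hy.2, sub_self, mul_zero])
    have ht' : 0 < t := hx.1.trans_le ht.1
    have h5 := (mul_eq_zero.1 ht0).resolve_left (by intro h; rw [neg_eq_zero] at h; rw [h] at hsq; simp at hsq)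
    have hroot : t ∈ rootSet a β c := ⟨ht', (sub_eq_zero.1 h5).symm⟩
    have hnt := hnd t hroot
    obtain ⟨C, hC⟩ : ∃ C, C = leadingAmplitude a c t := ⟨_, rfl⟩
    obtain ⟨S, hS⟩ : ∃ S, S = Real.sin (gtiPhase a t - β) := ⟨_, rfl⟩
    have hCr : Real.cos (gtiPhase a t - β) = C := hroot.2.trans hC.symm
    have hCS : C ^ 2 + S ^ 2 = 1 := by rw [← hCr, hS, Real.cos_sq_add_sin_sq]
    obtain ⟨hcos, -⟩ := cos_sin_of_phase hCr hS.symm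
    rw [← hC, ← hS] at hnt ⊢
    have hn : 0 < 1 + t ^ 2 := by positivity
    have hs0 : 0 < Real.sqrt (1 + t ^ 2) := Real.sqrt_pos.2 hn
    have hcpos : 0 ≤ Real.cos (a * t - β - n * Real.pi) :=
      Real.cos_nonneg_of_mem_Icc ⟨by nlinarith [ht.1], by nlinarith [ht.2]⟩
    rw [Real.cos_sub_int_mul_pi, hcos] at hcpos
    have hsgn : 0 ≤ -(-1) ^ n * (S * t - C) := by
      have := mul_nonneg hcpos hs0.le
      have e : (-1) ^ n * (-(S * t - C) / Real.sqrt (1 + t ^ 2)) * Real.sqrt (1 + t ^ 2)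
          = -(-1) ^ n * (S * t - C) := by field_simp
      rwa [e] at this
    have habs : |S * t - C| = -(-1) ^ n * (S * t - C) := by
      rw [← abs_of_nonneg hsgn, abs_mul, abs_neg, abs_zpow, abs_neg, abs_one, one_zpow, one_mul]
    rw [habs] at hnt
    have e : -(-1) ^ n * (-(C * (a / t - t / (1 + t ^ 2))) - -S * (a - 1 / (1 + t ^ 2)))
        = a / t * (-(-1) ^ n * (S * t - C)) - (-1) ^ n * ((C * t - S) / (1 + t ^ 2)) := by
      field_simp
      ring
    have h6 : a / t * (δ * t) ≤ a / t * (-(-1) ^ n * (S * t - C)) := by gcongr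
    have h7 : a / t * (δ * t) = a * δ := by field_simp
    have h8 : (-1) ^ n * ((C * t - S) / (1 + t ^ 2)) ≤ 1 := by
      refine (le_abs_self _).trans ?_
      rw [abs_mul, abs_zpow, abs_neg, abs_one, one_zpow, one_mul, abs_div, abs_of_pos hn, div_le_one hn]
      refine abs_le_of_sq_le_sq ?_ hn.le
      nlinarith [sq_nonneg (C + S * t), sq_nonneg t, sq_nonneg (t ^ 2)]
    rw [e]
    linarith
  intro x hx y hy h
  rcases le_total x y with hl | hl
  · exact key x hx y hy hl h
  · exact (key y hy x hx hl h.symm).symm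

theorem strictMono_halfPeriod_list {Z : Set ℝ} {z : ℕ → ℝ} (ha : 0 < a) (hz : IsIncreasingList Z z)
    (hinj : Set.InjOn (halfPeriod a β) Z) : StrictMono fun m => halfPeriod a β (z (m + 1)) := by
  intro m k hmk
  have hlt := hz.1 (show m + 1 ∈ Set.Ici 1 by simp) (show k + 1 ∈ Set.Ici 1 by simp)
    (Nat.add_lt_add_right hmk 1)
  exact lt_of_le_of_ne (halfPeriod_mono ha hlt.le) fun h => hlt.ne
    (hinj (mem_of_isIncreasingList hz (by omega)) (mem_of_isIncreasingList hz (by omega)) h)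

theorem exists_index_of_mem {Z : Set ℝ} {z : ℕ → ℝ} (hz : IsIncreasingList Z z) {x : ℝ} (hx : x ∈ Z) :
    ∃ m, 1 ≤ m ∧ z m = x := by
  rw [← hz.2] at hx
  obtain ⟨m, hm, rfl⟩ := hx
  exact ⟨m, hm, rfl⟩

/-- Strictly increasing sequences of integers are determined by their ranges. -/
theorem halfPeriod_list_eq {Z R : Set ℝ} {z r : ℕ → ℝ} (ha : 0 < a) (hz : IsIncreasingList Z z)
    (hr : IsIncreasingList R r) (hZ : Set.InjOn (halfPeriod a β) Z) (hR : Set.InjOn (halfPeriod a β) R)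
    (himg : halfPeriod a β '' Z = halfPeriod a β '' R) {m : ℕ} (hm : 1 ≤ m) :
    halfPeriod a β (z m) = halfPeriod a β (r m) := by
  have hrange : ∀ {Z : Set ℝ} {z : ℕ → ℝ}, IsIncreasingList Z z →
      Set.range (fun m => halfPeriod a β (z (m + 1))) = halfPeriod a β '' Z := by
    intro Z z hz
    ext k
    constructor
    · rintro ⟨m, rfl⟩
      exact Set.mem_image_of_mem _ (mem_of_isIncreasingList hz (by omega))
    · rintro ⟨x, hx, rfl⟩
      obtain ⟨m, hm, rfl⟩ := exists_index_of_mem hz hx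
      exact ⟨m - 1, by simp only [Nat.sub_add_cancel hm]⟩
  have h := ((strictMono_halfPeriod_list ha hz hZ).range_inj (strictMono_halfPeriod_list ha hr hR)).1
    (by rw [hrange hz, hrange hr, himg])
  have := congrFun h (m - 1)
  simpa only [Nat.sub_add_cancel hm] using this

end Matching

/-! ### The uniform expansion and its specialisation to ci and si. -/

section UniformExpansion

variable {a β c x : ℝ}

/-- For large parameters, if no root is degenerate, the zeros and the roots occupy the same half
periods. -/
theorem exists_image_halfPeriod_eq {δ : ℝ} (hδ : 0 < δ) : ∃ A : ℝ, ∀ a β c : ℝ, A ≤ a → 1 < a →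
    c ≠ 0 → |c| ≤ Real.Gamma a →
    (∀ x ∈ rootSet a β c,
      δ * min 1 x ≤ |Real.sin (gtiPhase a x - β) * x - leadingAmplitude a c x|) →
    Set.InjOn (halfPeriod a β) (rootSet a β c) ∧
      halfPeriod a β '' zeroSet a β c = halfPeriod a β '' rootSet a β c := by
  have hδ0 : 0 < min δ (1 / 4) := lt_min hδ (by norm_num)
  obtain ⟨A₁, hA₁⟩ := exists_abs_leadingAmplitude_le
  obtain ⟨A₂, hA₂⟩ := exists_root_halfPeriod
  obtain ⟨A₃, K, hA₃⟩ := exists_zero_near_root_of_nondegenerate hδ (le_refl 1)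
  refine ⟨max (max A₁ A₂) (max A₃ (1 / min δ (1 / 4) + 1)), fun a β c ha ha1 hc hcΓ hnd => ?_⟩
  have h1 : A₁ ≤ a := (le_max_left _ _).trans ((le_max_left _ _).trans ha)
  have h2 : A₂ ≤ a := (le_max_right _ _).trans ((le_max_left _ _).trans ha)
  have h3 : A₃ ≤ a := (le_max_left _ _).trans ((le_max_right _ _).trans ha)
  have h4 : 1 / min δ (1 / 4) + 1 ≤ a := (le_max_right _ _).trans ((le_max_right _ _).trans ha)
  have h5 : 1 < a * min δ (1 / 4) := by rw [← div_lt_iff₀ hδ0]; linarith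
  refine ⟨injOn_halfPeriod_rootSet hδ0 ha1 h5 fun x hx =>
    nondegenerate_mul_le hx (hA₁ a c x h1 ha1 hcΓ) (hnd x hx), Set.Subset.antisymm ?_ ?_⟩
  · rintro _ ⟨z, hz, rfl⟩
    rcases hc.lt_or_gt with hneg | hpos
    · rw [abs_of_neg hneg] at hcΓ
      obtain ⟨x, hx, hxz⟩ := hA₂ a (β + Real.pi) (-c) z h2 ha1 (by linarith) hcΓ
        (by rwa [zeroSet_add_pi])
      rw [rootSet_add_pi] at hx
      -- For negative c the pair (β+π, -c) has the same zeros and roots, and its half periods are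
      -- numbered one lower.
      have hshift : ∀ θ, halfPeriod a (β + Real.pi) θ = halfPeriod a β θ - 1 := fun θ => by
        rw [halfPeriod, halfPeriod, ← Int.floor_sub_one]
        congr 1
        field_simp [Real.pi_ne_zero]
        ring
      rw [hshift, hshift] at hxz
      exact ⟨x, hx, by omega⟩
    · rw [abs_of_pos hpos] at hcΓ
      obtain ⟨x, hx, hxz⟩ := hA₂ a β c z h2 ha1 hpos hcΓ hz
      exact ⟨x, hx, hxz⟩
  · rintro _ ⟨x, hx, rfl⟩
    obtain ⟨θ, hθ, hθx, -⟩ := hA₃ a β c x h3 hcΓ hx (hnd x hx)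
    exact ⟨θ, hθ, hθx⟩

/-- The zero built near the m-th root lies in that root's half period; so does the m-th zero when
all roots are nondegenerate, and a half period holds only one zero. -/
theorem uniformZeroExpansion (β : ℝ) (c : ℝ → ℝ) {ok : ℝ → Prop} {Z R : ℝ → Set ℝ}
    {D : ℝ → ℝ → ℝ} {e : ℕ → ℝ → ℝ → ℝ}
    (hc : ∀ a, 1 < a → ok a → c a ≠ 0 ∧ |c a| ≤ Real.Gamma a)
    (hZ : ∀ a, 1 < a → Z a = zeroSet a β (c a)) (hR : ∀ a, 1 < a → R a = rootSet a β (c a))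
    (hD : ∀ a x, 1 < a →
      |D a x| = |Real.sin (gtiPhase a x - β) * x - leadingAmplitude a (c a) x|)
    (he : ∀ k a x, 1 < a → e k a x
      = expansionCoeff k x (leadingAmplitude a (c a) x) (Real.sin (gtiPhase a x - β))) :
    UniformZeroExpansion ok Z R D e := by
  intro δ hδ N hN
  obtain ⟨A₁, K, hA₁⟩ := exists_zero_near_root_of_nondegenerate hδ hN
  obtain ⟨A₂, hA₂⟩ := exists_image_halfPeriod_eq hδ
  refine ⟨max A₁ A₂, K, fun a ha hAa hok z r hz hr => ?_⟩
  obtain ⟨hc0, hcΓ⟩ := hc a ha hok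
  rw [hZ a ha] at hz
  rw [hR a ha] at hr
  have happrox : ∀ x, zeroApprox e N a x = zeroApprox (fun k a x =>
      expansionCoeff k x (leadingAmplitude a (c a) x) (Real.sin (gtiPhase a x - β))) N a x := by
    intro x
    simp only [zeroApprox, he _ _ _ ha]
  have hnear : ∀ m, 1 ≤ m → δ * min 1 (r m) ≤ |D a (r m)| → ∃ θ ∈ zeroSet a β (c a),
      halfPeriod a β θ = halfPeriod a β (r m) ∧ |θ - zeroApprox e N a (r m)| ≤ K / a ^ (N + 1) := by
    intro m hm hnd
    rw [hD a _ ha] at hnd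
    rw [happrox]
    exact hA₁ a β (c a) (r m) ((le_max_left _ _).trans hAa) hcΓ (mem_of_isIncreasingList hr hm) hnd
  refine ⟨fun m hm hnd => ?_, fun hall m hm => ?_⟩
  · obtain ⟨θ, hθ, -, hθ2⟩ := hnear m hm hnd
    obtain ⟨j, hj, rfl⟩ := exists_index_of_mem hz hθ
    exact ⟨j, hj, hθ2⟩
  · obtain ⟨θ, hθ, hθ1, hθ2⟩ := hnear m hm (hall m hm)
    obtain ⟨hinj, himg⟩ := hA₂ a β (c a) ((le_max_right _ _).trans hAa) ha hc0 hcΓ fun x hx => by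
      obtain ⟨k, hk, rfl⟩ := exists_index_of_mem hr hx
      rw [← hD a _ ha]
      exact hall k hk
    have hzr := halfPeriod_list_eq (by linarith) hz hr (injOn_halfPeriod_zeroSet ha) hinj himg hm
    rw [injOn_halfPeriod_zeroSet ha (mem_of_isIncreasingList hz hm) hθ (hzr.trans hθ1.symm)]
    exact hθ2

theorem ciZeros_eq (a : ℝ) :
    ciZeros a = zeroSet a 0 (Real.Gamma a * Real.cos (Real.pi * a / 2)) := by
  ext θ
  simp only [ciZeros, zeroSet, Set.mem_ofPred_eq, gtici, gtiCi, oscIntegral, sub_zero]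
  rw [sub_eq_zero, eq_comm (a := Real.Gamma a * _)]

theorem siZeros_eq (a : ℝ) :
    siZeros a = zeroSet a (Real.pi / 2) (Real.Gamma a * Real.sin (Real.pi * a / 2)) := by
  ext θ
  simp only [siZeros, zeroSet, Set.mem_ofPred_eq, gtisi, gtiSi, oscIntegral, Real.cos_sub_pi_div_two]
  rw [sub_eq_zero, eq_comm (a := Real.Gamma a * _)]

theorem gtiChi_eq (ha : 1 < a) (x : ℝ) :
    gtiChi a x = leadingAmplitude a (Real.Gamma a * Real.cos (Real.pi * a / 2)) x := by
  rw [gtiChi, leadingAmplitude, Real.Gamma_add_one (by linarith), ← mul_assoc a]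

theorem gtiSigma_eq (ha : 1 < a) (x : ℝ) :
    gtiSigma a x = leadingAmplitude a (Real.Gamma a * Real.sin (Real.pi * a / 2)) x := by
  rw [gtiSigma, leadingAmplitude, Real.Gamma_add_one (by linarith), ← mul_assoc a]

theorem ciRoots_eq (ha : 1 < a) :
    ciRoots a = rootSet a 0 (Real.Gamma a * Real.cos (Real.pi * a / 2)) := by
  ext θ
  simp only [ciRoots, rootSet, Set.mem_ofPred_eq, gtiChi_eq ha, sub_zero]

theorem siRoots_eq (ha : 1 < a) :
    siRoots a = rootSet a (Real.pi / 2) (Real.Gamma a * Real.sin (Real.pi * a / 2)) := by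
  ext θ
  simp only [siRoots, rootSet, Set.mem_ofPred_eq, gtiSigma_eq ha, Real.cos_sub_pi_div_two]

theorem Gamma_mul_bound (ha : 1 < a) {t : ℝ} (ht : t ≠ 0) (h1 : |t| ≤ 1) :
    Real.Gamma a * t ≠ 0 ∧ |Real.Gamma a * t| ≤ Real.Gamma a := by
  have hΓ := Real.Gamma_pos_of_pos (show 0 < a by linarith)
  refine ⟨mul_ne_zero hΓ.ne' ht, ?_⟩
  rw [abs_mul, abs_of_pos hΓ]
  exact mul_le_of_le_one_right hΓ.le h1

end UniformExpansion

/-! ### The theorem, with β = 0 for ci and β = π/2 for si. -/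

theorem mainTheorem4 :
    ∃ q : ℕ → ℝ → ℝ → ℝ → ℝ,
      -- the coefficients
      (∀ k : ℕ, 2 ≤ k → IsRationalCoeff (q k)) ∧
      q 2 = qTilde2 ∧ q 3 = qTilde3 ∧ q 4 = qTilde4 ∧ q 5 = qTilde5 ∧
      (∀ x Ch Sh : ℝ, q 2 x Sh (-Ch) =
        x ^ 2 * (Ch * x ^ 2 - 2 * Sh * x - Ch) / ((x ^ 2 + 1) ^ 2 * (Ch * x + Sh))) ∧
      -- the zeros of `ci(a, aθ)` and their leading terms
      (∀ a : ℝ, 1 < a → Real.cos (Real.pi * a / 2) ≠ 0 →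
        (∃ c : ℕ → ℝ, IsIncreasingList (ciZeros a) c) ∧
        ∃ c₀ : ℕ → ℝ, IsIncreasingList (ciRoots a) c₀ ∧
          ∃ p : ℕ → ℕ, IsBranchNumbering p ∧ ∀ m : ℕ, 1 ≤ m →
            |gtiChi a (c₀ m)| ≤ 1 ∧
            gtiPhase a (c₀ m) =
              (-1) ^ (p m - 1) * Real.arccos (gtiChi a (c₀ m))
                + 2 * ((p m / 2 : ℕ) : ℝ) * Real.pi) ∧
      UniformZeroExpansion (fun a => Real.cos (Real.pi * a / 2) ≠ 0) ciZeros ciRoots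
        (fun a x => Real.sin (gtiPhase a x) * x - gtiChi a x)
        (fun k a x => q k x (gtiChi a x) (Real.sin (gtiPhase a x))) ∧
      -- the zeros of `si(a, aθ)` and their leading terms
      (∀ a : ℝ, 1 < a → Real.sin (Real.pi * a / 2) ≠ 0 →
        (∃ s : ℕ → ℝ, IsIncreasingList (siZeros a) s) ∧
        ∃ s₀ : ℕ → ℝ, IsIncreasingList (siRoots a) s₀ ∧
          ∃ (l : ℕ) (p : ℕ → ℕ),
            ((0 < Real.arcsin (gtiSigma a (s₀ 1)) ∧ l = 0) ∨
              (Real.arcsin (gtiSigma a (s₀ 1)) ≤ 0 ∧ l = 1)) ∧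
            IsBranchNumbering p ∧ ∀ m : ℕ, 1 ≤ m →
              |gtiSigma a (s₀ m)| ≤ 1 ∧
              gtiPhase a (s₀ m) =
                (-1) ^ (p m - 1) * |Real.arcsin (gtiSigma a (s₀ m))|
                  + ((l : ℝ) + (p m : ℝ) - 1) * Real.pi) ∧
      UniformZeroExpansion (fun a => Real.sin (Real.pi * a / 2) ≠ 0) siZeros siRoots
        (fun a x => Real.cos (gtiPhase a x) * x + gtiSigma a x)
        (fun k a x => q k x (gtiSigma a x) (-Real.cos (gtiPhase a x))) := by
  refine ⟨expansionCoeff, fun k _ => isRationalCoeff_expansionCoeff k, rfl, rfl, rfl, rfl,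
    fun x Ch Sh => ?_, fun a ha hcos => ?_, ?_, fun a ha hsin => ?_, ?_⟩
  · change qTilde2 x Sh (-Ch) = _
    rw [qTilde2, ← neg_div_neg_eq]
    congr 1 <;> ring
  · rw [ciZeros_eq, ciRoots_eq ha]
    obtain ⟨hc, -⟩ := Gamma_mul_bound ha hcos (Real.abs_cos_le_one _)
    simp only [gtiChi_eq ha]
    exact ⟨exists_isIncreasingList_zeroSet ha _ _, exists_branches_cos ha hc⟩
  · refine uniformZeroExpansion 0 (fun a => Real.Gamma a * Real.cos (Real.pi * a / 2))
      (fun a ha hok => Gamma_mul_bound ha hok (Real.abs_cos_le_one _)) (fun a _ => ciZeros_eq a)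
      (fun a ha => ciRoots_eq ha) (fun a x ha => ?_) (fun k a x ha => ?_)
    · rw [gtiChi_eq ha, sub_zero]
    · rw [gtiChi_eq ha, sub_zero]
  · rw [siZeros_eq, siRoots_eq ha]
    obtain ⟨hc, -⟩ := Gamma_mul_bound ha hsin (Real.abs_sin_le_one _)
    simp only [gtiSigma_eq ha]
    exact ⟨exists_isIncreasingList_zeroSet ha _ _, exists_branches_sin ha hc⟩
  · refine uniformZeroExpansion (Real.pi / 2) (fun a => Real.Gamma a * Real.sin (Real.pi * a / 2))
      (fun a ha hok => Gamma_mul_bound ha hok (Real.abs_sin_le_one _)) (fun a _ => siZeros_eq a)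
      (fun a ha => siRoots_eq ha) (fun a x ha => ?_) (fun k a x ha => ?_)
    -- For β = π/2 the pair (C, S) becomes (sin φ, -cos φ), so Sx - C is the negative of the stated
    -- nondegeneracy quantity; only its absolute value matters.
    · rw [gtiSigma_eq ha, Real.sin_sub_pi_div_two, ← abs_neg]
      congr 1
      ring
    · rw [gtiSigma_eq ha, Real.sin_sub_pi_div_two]
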